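/- **Laplacian of globally supported functions.** Let $d\ge 1$, $l\in\{0,1,2,\dots\}$, and let $V$ be a solid harmonic polynomial of degree $l$ on $\mathbb R^d$ (a polynomial, with real or complex coefficients, homogeneous of degree $l$ with $\Delta V=0$). Put $\vartheta=\frac d2+l$. Let $\alpha:\mathbb R^d\to(0,2]$ be any function. For a function $u$ of polynomial growth the variable-order Laplacian is the pseudo-differential operator $$(-\Delta)^{\alpha(x)/2}u(x)=\int_{\mathbb R^d}\hat u(\xi)\,(2\pi|\xi|)^{\alpha(x)}e^{2\pi i x\cdot\xi}\,d\xi ,\qquad \hat u(\xi)=\int_{\mathbb R^d} u(y)e^{-2\pi i y\cdot \xi}dy,$$ where $\hat u$ is taken in the sense of tempered distributions and the integral means the limit, as $\delta,\varepsilon\downarrow0$ jointly, of the pairing of $\hat u$ with the Schwartz function $(\delta+(2\pi|\xi|)^2)^{\alpha(x)/2}e^{-\varepsilon|\xi|^2}e^{2\pi i x\cdot\xi}$. Then the following functions $u$ are infinitely differentiable on $\mathbb R^d$, and for every $x\in\mathbb R^d$ the limit exists and has the stated value. (i) For $u(x)=V(x)e^{-|x|^2}$, $$(-\Delta)^{\alpha(x)/2}u(x)=\frac{2^{\alpha(x)}\Gamma(\vartheta+\frac{\alpha(x)}2)}{\Gamma(\vartheta)}\,V(x)\;{}_1F_1\Big(\vartheta+\tfrac{\alpha(x)}2;\vartheta;-|x|^2\Big).$$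 (ii) For $u(x)=V(x)(1+|x|^2)^{-\beta}$ with $\beta>0$, $$(-\Delta)^{\alpha(x)/2}u(x)=\frac{2^{\alpha(x)}\Gamma(\vartheta+\frac{\alpha(x)}2)\Gamma(\beta+\frac{\alpha(x)}2)}{\Gamma(\vartheta)\Gamma(\beta)}\,V(x)\;{}_2F_1\Big(\vartheta+\tfrac{\alpha(x)}2,\beta+\tfrac{\alpha(x)}2;\vartheta;-|x|^2\Big).$$ (iii) For $u(x)=V(x)J_{s-1}(|x|)/|x|^{s-1}$ with $s>0$, where $J_{s-1}$ is the Bessel function of the first kind and $J_{s-1}(r)/r^{s-1}$ has its limit value $2^{1-s}/\Gamma(s)$ at $r=0$, $$(-\Delta)^{\alpha(x)/2}u(x)=\frac{2^{1-s}\Gamma(\vartheta+\frac{\alpha(x)}2)}{\Gamma(\vartheta)\Gamma(s+\frac{\alpha(x)}2)}\,V(x)\;{}_1F_2\Big(\vartheta+\tfrac{\alpha(x)}2;s+\tfrac{\alpha(x)}2,\vartheta;-\tfrac14|x|^2\Big).$$ Here ${}_pF_q(a_1,\dots,a_p;b_1,\dots,b_q;r)=\sum_{n\ge0}\frac{(a_1)_n\cdots(a_p)_n}{(b_1)_n\cdots(b_q)_n}\frac{r^n}{n!}$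 with $(c)_n=c(c+1)\cdots(c+n-1)$, and ${}_2F_1$ is continued analytically from $(-1,1)$ to $(-\infty,1)$. Moreover, in each case the same right-hand side is the value of the other forms of the operator. If $\alpha(x)=2$, it equals $-\Delta u(x)$. If $\alpha(x)<2$ and $u(y)(1+|y|)^{-d-\alpha(x)}$ is integrable over $\mathbb R^d$, it equals the hypersingular integral $$C_{d,\alpha(x)}\lim_{r\downarrow0}\int_{|x-y|>r}\frac{u(x)-u(y)}{|x-y|^{d+\alpha(x)}}\,dy,\qquad C_{d,a}=\frac{2^{a-1}a\,\Gamma(\frac{a+d}2)}{\pi^{d/2}\,\Gamma(1-\frac a2)} .$$ -/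

import Mathlib

open MeasureTheory Filter Topology
open scoped FourierTransform ContDiff Laplacian RealInnerProductSpace

noncomputable section

namespace VarLap

/-! ### Solid harmonic polynomials -/

/-- `V` is a solid harmonic polynomial of degree `l`: it is homogeneous of degree `l` and its
Laplacian vanishes. -/
def IsSolidHarmonic {d : ℕ} (V : MvPolynomial (Fin d) ℂ) (l : ℕ) : Prop :=
  V.IsHomogeneous l ∧ ∑ i, MvPolynomial.pderiv i (MvPolynomial.pderiv i V) = 0

/-- The value of the polynomial `V` at the point `x` of `ℝ^d`. -/
def polyVal {d : ℕ} (V : MvPolynomial (Fin d) ℂ) (x : EuclideanSpace ℝ (Fin d)) : ℂ :=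
  MvPolynomial.eval (fun i => (x i : ℂ)) V

/-! ### Special functions -/

/-- The generalized hypergeometric series
`∑ₙ (a₁)ₙ ⋯ (aₚ)ₙ / ((b₁)ₙ ⋯ (b_q)ₙ) * rⁿ / n!`. It converges for every real `r` if `p ≤ q`,
and for `|r| < 1` if `p = q + 1`. -/
def hypSeries (a b : List ℝ) (r : ℝ) : ℝ :=
  ∑' n : ℕ, (a.map fun c => (ascPochhammer ℝ n).eval c).prod /
    (b.map fun c => (ascPochhammer ℝ n).eval c).prod * (r ^ n / (n.factorial : ℝ))

/-- Kummer's confluent hypergeometric function `₁F₁(a; b; r)`. -/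
def oneFOne (a b r : ℝ) : ℝ := hypSeries [a] [b] r

/-- The function `₁F₂(a; b, c; r)`. -/
def oneFTwo (a b c r : ℝ) : ℝ := hypSeries [a] [b, c] r

/-- `F` is the real-analytic continuation to `(-∞, 1)` of the Gauss hypergeometric series with
parameters `a, b; c`, which itself only converges on `(-1, 1)`. Such an `F` is unique
on `(-∞, 1)`. -/
def IsGaussContinuation (a b c : ℝ) (F : ℝ → ℝ) : Prop :=
  AnalyticOnNhd ℝ F (Set.Iio 1) ∧ ∀ r : ℝ, |r| < 1 → F r = hypSeries [a, b] [c] r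

open Classical in
/-- The Gauss hypergeometric function `₂F₁(a, b; c; r)` for real `r < 1`: the value at `r` of the
analytic continuation of the Gauss series. -/
def twoFOne (a b c r : ℝ) : ℝ :=
  if h : ∃ F : ℝ → ℝ, IsGaussContinuation a b c F then h.choose r else 0

/-- The Bessel function of the first kind `J_ν(r)`, for `r > 0` and `ν > -1`. -/
def besselJ (ν r : ℝ) : ℝ :=
  ∑' n : ℕ, (-1 : ℝ) ^ n / ((n.factorial : ℝ) * Real.Gamma (n + ν + 1)) *
    (r / 2) ^ (2 * (n : ℝ) + ν)

/-- The function `J_{s-1}(r) / r^{s-1}` for `r ≥ 0`, with its limit `2^{1-s} / Γ(s)` as value at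
the removable singularity `r = 0`. -/
def besselQuotient (s r : ℝ) : ℝ :=
  if r = 0 then (2 : ℝ) ^ (1 - s) / Real.Gamma s else besselJ (s - 1) r / r ^ (s - 1)

/-! ### The variable-order Laplacian

Throughout, `α : ℝ^d → (0, 2]` is the variable exponent. -/

/-- The symbol `(2π|ξ|)^{α(x)} e^{2πi x·ξ}` of the variable-order Laplacian at `x`, made smooth at
the origin (by `δ > 0`) and rapidly decreasing at infinity (by `ε > 0`):
`(δ + (2π|ξ|)²)^{α(x)/2} e^{-ε|ξ|²} e^{2πi x·ξ}`. It is a Schwartz function of `ξ`. -/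
def smoothedSymbol {d : ℕ} (α : EuclideanSpace ℝ (Fin d) → ℝ) (x : EuclideanSpace ℝ (Fin d))
    (δ ε : ℝ) (ξ : EuclideanSpace ℝ (Fin d)) : ℂ :=
  (((δ + (2 * Real.pi * ‖ξ‖) ^ 2) ^ (α x / 2) * Real.exp (-ε * ‖ξ‖ ^ 2) : ℝ) : ℂ) *
    Complex.exp (2 * Real.pi * (⟪x, ξ⟫ : ℝ) * Complex.I)

/-- Pseudo-differential form:
`(-Δ)^{α(x)/2} u(x) = ∫ û(ξ) (2π|ξ|)^{α(x)} e^{2πi x·ξ} dξ = c`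
for a function `u` of polynomial growth. The Fourier transform `û` is that of a tempered
distribution, `⟨û, m⟩ = ∫ u(y) 𝓕m(y) dy` for Schwartz functions `m`, and the integral is the limit
of `⟨û, m⟩` as the smoothed symbols `m` tend to the symbol. If `û |ξ|^{α(x)}` is absolutely
integrable together with `û`, this is the ordinary integral. -/
def HasPseudoDiffValue {d : ℕ} (α : EuclideanSpace ℝ (Fin d) → ℝ)
    (u : EuclideanSpace ℝ (Fin d) → ℂ) (x : EuclideanSpace ℝ (Fin d)) (c : ℂ) : Prop :=
  (∀ δ ε : ℝ, 0 < δ → 0 < ε → Integrable (fun y => u y * 𝓕 (smoothedSymbol α x δ ε) y)) ∧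
  Tendsto (fun p : ℝ × ℝ => ∫ y, u y * 𝓕 (smoothedSymbol α x p.1 p.2) y)
    (𝓝[>] (0 : ℝ) ×ˢ 𝓝[>] (0 : ℝ)) (𝓝 c)

/-- The normalization constant of the hypersingular integral. -/
def normConst (d : ℕ) (a : ℝ) : ℝ :=
  (2 : ℝ) ^ (a - 1) * a * Real.Gamma ((a + d) / 2) /
    (Real.sqrt (Real.pi ^ d) * Real.Gamma (1 - a / 2))

/-- Hypersingular integral form, for `α(x) < 2`:
`(-Δ)^{α(x)/2} u(x) = C_{d,α(x)} P.V. ∫ (u(x) - u(y)) / |x - y|^{d + α(x)} dy = c`. -/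
def HasHypersingularValue {d : ℕ} (α : EuclideanSpace ℝ (Fin d) → ℝ)
    (u : EuclideanSpace ℝ (Fin d) → ℂ) (x : EuclideanSpace ℝ (Fin d)) (c : ℂ) : Prop :=
  (∀ r : ℝ, 0 < r → IntegrableOn
    (fun y => (u x - u y) / ((‖x - y‖ ^ ((d : ℝ) + α x) : ℝ) : ℂ)) {y | r < ‖x - y‖}) ∧
  Tendsto (fun r : ℝ => (normConst d (α x) : ℂ) *
      ∫ y in {y | r < ‖x - y‖}, (u x - u y) / ((‖x - y‖ ^ ((d : ℝ) + α x) : ℝ) : ℂ))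
    (𝓝[>] (0 : ℝ)) (𝓝 c)

/-- `(-Δ)^{α(x)/2} u(x) = c`, in each of the forms of the operator:
* the pseudo-differential form (for all `0 < α(x) ≤ 2`);
* the hypersingular integral form, if `α(x) < 2` and the integral converges at infinity, that is,
  `u(y) / (1 + |y|)^{d + α(x)}` is integrable;
* the classical negative Laplacian, if `α(x) = 2`. -/
structure VarLaplacianEq {d : ℕ} (α : EuclideanSpace ℝ (Fin d) → ℝ)
    (u : EuclideanSpace ℝ (Fin d) → ℂ) (x : EuclideanSpace ℝ (Fin d)) (c : ℂ) : Prop where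
  pseudoDiff : HasPseudoDiffValue α u x c
  hypersingular : α x < 2 →
    Integrable (fun y => u y / (((1 + ‖y‖) ^ ((d : ℝ) + α x) : ℝ) : ℂ)) →
    HasHypersingularValue α u x c
  classical : α x = 2 → -(Δ u x) = c

end VarLap

end

/-!
# The variable-order Laplacian of solid harmonics times radial functions

Everything happens at a fixed point `x`, where the operator is the fractional power `(-Δ)^a` with
`a = α x / 2 ∈ (0, 1]`. All its forms are expressed by the heat orbit
`τ ↦ (e^{τΔ} u)(x) = ∫ u(y) p_τ(x - y) dy`, through the Balakrishnan formula
`λ^a = a / Γ(1 - a) * ∫₀^∞ (1 - e^{-λτ}) τ^{-1-a} dτ` for `a < 1` and `λ = -(d/dτ) e^{-λτ}` at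
`τ = 0` for `a = 1`:

* on the Fourier side it writes the smoothed symbol as a superposition of heat symbols, whose Fourier
  transforms are heat kernels (`hasPseudoDiffValue_of_lt`, `hasPseudoDiffValue_of_eq_two`);
* integrating the heat kernel against `τ^{-1-a}` gives the kernel of the hypersingular integral with
  its normalization constant (`hasHypersingularValue_of_lt`);
* the derivative of the orbit at `τ = 0` is the classical Laplacian (`neg_laplacian_eq`).

So it suffices to know that the heat orbit of `u` at `x` is `A h(τ)` and to compute the number `c`
that these formulas assign to the scalar orbit `h`. This is `varLaplacianEq_of_heat`, and the
relation between `h` and `c` is `HasFracPower`. It is compatible with rescaling of time and with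
superpositions (`HasFracPower.comp_mul`, `HasFracPower.integral_param`, `HasFracPower.tsum`), so that
all values follow from those of the orbits `τ^j e^{-τ}`.

The heat orbits come from the identity `Δ(V |x|^{2n}) = 4n(n + ϑ - 1) V |x|^{2n-2}`. A solid
harmonic is invariant under the heat flow, and completing the square gives the orbit
`V(x) (1 + 4tτ)^{-ϑ} e^{-t|x|²/(1 + 4tτ)}` of `V e^{-t|x|²}`.

* Gaussian: expanding the exponential leaves the orbits `(1 + τ)^{-p}`, with value
  `Γ(p + a) / Γ(p)`; their sum is `₁F₁`. A second expansion of the same orbit gives Kummer's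
  transformation.
* Inverse multiquadric: it is a Gamma mixture of Gaussians, so the value is a Laplace transform of
  `₁F₁`. Evaluated after Kummer's transformation it is `(1 + w)^{-β-a} ₂F₁(-a, β + a; ϑ; w/(1 + w))`
  for all `w = |x|² ≥ 0`, while for `w < 1` it is the Gauss series at `-w`. This is Pfaff's
  transformation, and it provides the analytic continuation.
* Bessel: the orbit is a double series, whose inner sums are multiples of `₁F₁(p; p + δ; -τ)` with
  `δ = s - ϑ`. For `δ > 0` Euler's integral is a superposition of exponential orbits; for
  `δ ≤ 0` a contiguous relation raises `δ` by `1` finitely often. The polynomial growth of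
  `J_{s-1}(r) / r^{s-1}` follows from a monotone energy (`abs_besselSeries_le`).
-/

namespace VarLap

open Set

/-! ### Fractional powers on orbits of a semigroup -/

/-- `h : [0, ∞) → ℝ` stands for an orbit `τ ↦ e^{-τA} v` of a contraction semigroup (evaluated at
a point), and `c` for the value `A ^ a v` of the fractional power of its generator. For `a < 1` this
is the Balakrishnan formula `c = a / Γ(1 - a) * ∫₀^∞ (h 0 - h τ) τ^{-1-a} dτ`, and for `a = 1` it is
`c = -h'(0+)`. The number `M` bounds both `h` and its Lipschitz constant; values of `h` at negative
times are irrelevant. -/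
structure HasFracPower (a M : ℝ) (h : ℝ → ℝ) (c : ℝ) : Prop where
  bound : ∀ τ, 0 ≤ τ → |h τ| ≤ M
  lip : ∀ σ τ, 0 ≤ σ → 0 ≤ τ → |h σ - h τ| ≤ M * |σ - τ|
  diff : ∀ τ, 0 < τ → DifferentiableAt ℝ h τ
  frac : a < 1 → a / Real.Gamma (1 - a) * ∫ τ in Ioi 0, (h 0 - h τ) * τ ^ (-1 - a) = c
  infinitesimal : a = 1 → Tendsto (deriv h) (𝓝[>] 0) (𝓝 (-c))

theorem integrableOn_min_mul_rpow {a : ℝ} (h0 : 0 < a) (h1 : a < 1) :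
    IntegrableOn (fun τ : ℝ => min 1 τ * τ ^ (-1 - a)) (Ioi 0) := by
  rw [← Ioc_union_Ioi_eq_Ioi (zero_le_one (α := ℝ))]
  refine IntegrableOn.union ?_ ?_
  · have : IntegrableOn (fun τ : ℝ => τ ^ (-a)) (Ioc 0 1) := by
      rw [← intervalIntegrable_iff_integrableOn_Ioc_of_le zero_le_one]
      exact intervalIntegral.intervalIntegrable_rpow' (by linarith)
    refine this.congr_fun (fun τ hτ => ?_) measurableSet_Ioc
    simp only
    rw [min_eq_right hτ.2]
    nth_rw 2 [← Real.rpow_one τ]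
    rw [← Real.rpow_add hτ.1]
    ring_nf
  · have : IntegrableOn (fun τ : ℝ => τ ^ (-1 - a)) (Ioi 1) :=
      integrableOn_Ioi_rpow_of_lt (by linarith) one_pos
    refine this.congr_fun (fun τ hτ => ?_) measurableSet_Ioi
    simp only
    rw [min_eq_left (le_of_lt hτ), one_mul]

theorem integral_count_nat (f : ℕ → ℝ) : ∫ n, f n ∂Measure.count = ∑' n, f n := by
  by_cases hf : Integrable f Measure.count
  · rw [integral_countable hf]
    simp [Measure.real]
  · rw [integral_undef hf, tsum_eq_zero_of_not_summable]
    rwa [integrable_count_iff, summable_norm_iff] at hf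

namespace HasFracPower

variable {a M c : ℝ} {h : ℝ → ℝ}

theorem nonneg (H : HasFracPower a M h c) : 0 ≤ M :=
  (abs_nonneg _).trans (H.bound 0 le_rfl)

theorem abs_deriv_le (H : HasFracPower a M h c) {τ : ℝ} (hτ : 0 < τ) : |deriv h τ| ≤ M := by
  refine norm_deriv_le_of_lip' (f := h) H.nonneg ?_
  filter_upwards [lt_mem_nhds hτ] with σ hσ using H.lip σ τ hσ.le hτ.le

theorem continuousOn (H : HasFracPower a M h c) : ContinuousOn h (Ici 0) := by
  have : LipschitzOnWith (Real.toNNReal M) h (Ici 0) := by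
    refine LipschitzOnWith.of_dist_le_mul fun x hx y hy => ?_
    rw [Real.coe_toNNReal _ H.nonneg]
    exact H.lip x y hx hy
  exact this.continuousOn

/-- The factor `min 1 τ` makes the difference integrable against `τ ^ (-1 - a)`. -/
theorem abs_sub_le (H : HasFracPower a M h c) {σ τ : ℝ} (hσ : 0 ≤ σ) (hτ : 0 ≤ τ) :
    |h σ - h (σ + τ)| ≤ 2 * M * min 1 τ := by
  have hM := H.nonneg
  rcases le_total 1 τ with h1 | h1
  · rw [min_eq_left h1]
    have := H.bound σ hσ
    have := H.bound (σ + τ) (by positivity)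
    have := abs_sub (h σ) (h (σ + τ))
    linarith
  · rw [min_eq_right h1]
    have := H.lip σ (σ + τ) hσ (by positivity)
    rw [show σ - (σ + τ) = -τ by ring, abs_neg, abs_of_nonneg hτ] at this
    nlinarith

theorem integrableOn (H : HasFracPower a M h c) (h0 : 0 < a) (h1 : a < 1) :
    IntegrableOn (fun τ => (h 0 - h τ) * τ ^ (-1 - a)) (Ioi 0) := by
  refine ((integrableOn_min_mul_rpow h0 h1).const_mul (2 * M)).mono' ?_ ?_
  · refine ContinuousOn.aestronglyMeasurable ?_ measurableSet_Ioi
    refine (continuousOn_const.sub (H.continuousOn.mono Ioi_subset_Ici_self)).mul ?_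
    exact fun τ hτ => (Real.continuousAt_rpow_const _ _ (Or.inl (ne_of_gt hτ))).continuousWithinAt
  · refine (ae_restrict_iff' measurableSet_Ioi).2 (ae_of_all _ fun τ hτ => ?_)
    have hτ : 0 < τ := hτ
    have := H.abs_sub_le le_rfl hτ.le
    rw [zero_add] at this
    rw [Real.norm_eq_abs, abs_mul, abs_of_pos (Real.rpow_pos_of_pos hτ _), ← mul_assoc]
    gcongr

theorem mono (H : HasFracPower a M h c) {M' : ℝ} (hM : M ≤ M') : HasFracPower a M' h c where
  bound τ hτ := (H.bound τ hτ).trans hM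
  lip σ τ hσ hτ := (H.lip σ τ hσ hτ).trans (by gcongr)
  diff := H.diff
  frac := H.frac
  infinitesimal := H.infinitesimal

theorem const_mul (H : HasFracPower a M h c) (k : ℝ) :
    HasFracPower a (|k| * M) (fun τ => k * h τ) (k * c) where
  bound τ hτ := by rw [abs_mul]; gcongr; exact H.bound τ hτ
  lip σ τ hσ hτ := by rw [← mul_sub, abs_mul, mul_assoc]; gcongr; exact H.lip σ τ hσ hτ
  diff τ hτ := (H.diff τ hτ).const_mul k
  frac h1 := by
    have : ∀ τ, (k * h 0 - k * h τ) * τ ^ (-1 - a) = k * ((h 0 - h τ) * τ ^ (-1 - a)) :=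
      fun τ => by ring
    simp_rw [this]
    rw [integral_const_mul, ← H.frac h1]
    ring
  infinitesimal h1 := by
    have : deriv (fun τ => k * h τ) = fun τ => k * deriv h τ := by
      ext τ; exact deriv_const_mul_field k
    rw [this, ← mul_neg]
    exact (H.infinitesimal h1).const_mul k

theorem add {M' c' : ℝ} {h' : ℝ → ℝ} (h0 : 0 < a) (H : HasFracPower a M h c)
    (H' : HasFracPower a M' h' c') :
    HasFracPower a (M + M') (fun τ => h τ + h' τ) (c + c') where
  bound τ hτ := (abs_add_le _ _).trans (add_le_add (H.bound τ hτ) (H'.bound τ hτ))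
  lip σ τ hσ hτ := by
    rw [add_sub_add_comm, add_mul]
    exact (abs_add_le _ _).trans (add_le_add (H.lip σ τ hσ hτ) (H'.lip σ τ hσ hτ))
  diff τ hτ := (H.diff τ hτ).add (H'.diff τ hτ)
  frac h1 := by
    rw [← H.frac h1, ← H'.frac h1, ← mul_add,
      ← integral_add (H.integrableOn h0 h1) (H'.integrableOn h0 h1)]
    congr 2
    ext τ
    ring
  infinitesimal h1 := by
    rw [neg_add]
    refine ((H.infinitesimal h1).add (H'.infinitesimal h1)).congr' ?_
    filter_upwards [self_mem_nhdsWithin] with τ hτ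
    exact (deriv_fun_add (H.diff τ hτ) (H'.diff τ hτ)).symm

/-- Rescaling time by `k` multiplies the generator by `k`. -/
theorem comp_mul (H : HasFracPower a M h c) {k : ℝ} (hk : 0 < k) :
    HasFracPower a (M * (1 + k)) (fun τ => h (k * τ)) (k ^ a * c) where
  bound τ hτ := (H.bound _ (by positivity)).trans (by nlinarith [H.nonneg])
  lip σ τ hσ hτ := by
    refine (H.lip _ _ (by positivity) (by positivity)).trans ?_
    rw [← mul_sub, abs_mul, abs_of_pos hk]
    nlinarith [mul_nonneg H.nonneg (abs_nonneg (σ - τ))]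
  diff τ hτ := by
    have := H.diff (k * τ) (by positivity)
    fun_prop
  frac h1 := by
    have key : ∫ τ in Ioi (0 : ℝ), (h (k * 0) - h (k * τ)) * τ ^ (-1 - a)
        = k ^ a * ∫ τ in Ioi (0 : ℝ), (h 0 - h τ) * τ ^ (-1 - a) := by
      have e := integral_comp_mul_left_Ioi (fun τ => (h 0 - h τ) * τ ^ (-1 - a)) 0 hk
      rw [mul_zero, smul_eq_mul] at e
      have : k ^ a * ∫ τ in Ioi (0 : ℝ), (h 0 - h τ) * τ ^ (-1 - a)
          = k ^ (1 + a) * (k⁻¹ * ∫ τ in Ioi (0 : ℝ), (h 0 - h τ) * τ ^ (-1 - a)) := by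
        rw [Real.rpow_add hk, Real.rpow_one]
        field_simp
      rw [this, ← e, ← integral_const_mul, mul_zero]
      refine setIntegral_congr_fun measurableSet_Ioi fun τ hτ => ?_
      rw [Real.mul_rpow hk.le (le_of_lt hτ), show (1 + a) = -(-1 - a) by ring, Real.rpow_neg hk.le]
      have : k ^ (-1 - a) ≠ 0 := (Real.rpow_pos_of_pos hk _).ne'
      field_simp
    rw [key, ← H.frac h1]
    ring
  infinitesimal h1 := by
    subst h1
    have : deriv (fun τ => h (k * τ)) = fun τ => k * deriv h (k * τ) := by
      ext τ
      simpa using deriv_comp_mul_left k h τ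
    rw [this, Real.rpow_one, ← mul_neg]
    refine ((H.infinitesimal rfl).comp ?_).const_mul k
    refine tendsto_nhdsWithin_iff.2 ⟨?_, ?_⟩
    · have : Tendsto (fun τ : ℝ => k * τ) (𝓝 0) (𝓝 (k * 0)) :=
        (continuous_const.mul continuous_id).tendsto 0
      rw [mul_zero] at this
      exact this.mono_left nhdsWithin_le_nhds
    · filter_upwards [self_mem_nhdsWithin] with τ hτ
      exact mul_pos hk hτ

/-- The constant `M` can be replaced by any common bound for `h` and `h'`. -/
theorem of_deriv_bound (H : HasFracPower a M h c) {M' : ℝ} (hb : ∀ τ, 0 ≤ τ → |h τ| ≤ M')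
    (hd : ∀ τ, 0 < τ → |deriv h τ| ≤ M') : HasFracPower a M' h c where
  bound := hb
  lip := by
    have hM : 0 ≤ M' := (abs_nonneg _).trans (hb 0 le_rfl)
    have key : ∀ σ τ, 0 ≤ σ → σ < τ → |h τ - h σ| ≤ M' * (τ - σ) := fun σ τ hσ hστ => by
      obtain ⟨ξ, hξ, e⟩ := exists_deriv_eq_slope h hστ
        (H.continuousOn.mono fun x hx => hσ.trans hx.1)
        (fun x hx => (H.diff x (hσ.trans_lt hx.1)).differentiableWithinAt)
      have h1 := hd ξ (hσ.trans_lt hξ.1)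
      rwa [e, abs_div, abs_of_pos (sub_pos.2 hστ), div_le_iff₀ (sub_pos.2 hστ)] at h1
    intro σ τ hσ hτ
    rcases lt_trichotomy σ τ with h1 | rfl | h1
    · rw [abs_sub_comm, abs_sub_comm σ, abs_of_pos (sub_pos.2 h1)]
      exact key σ τ hσ h1
    · simp
    · rw [abs_of_pos (sub_pos.2 h1)]
      exact key τ σ hτ h1
  diff := H.diff
  frac := H.frac
  infinitesimal := H.infinitesimal

/-- Superposition of orbits: `A ^ a` commutes with integrals over a parameter `z`. -/
theorem integral_param {Ω : Type*} [MeasurableSpace Ω] {μ : Measure Ω} [SFinite μ]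
    {M c : Ω → ℝ} {g : Ω → ℝ → ℝ} (h0 : 0 < a) (hg : Measurable (Function.uncurry g))
    (hM : Integrable M μ) (H : ∀ᵐ z ∂μ, HasFracPower a (M z) (g z) (c z)) :
    HasFracPower a (∫ z, M z ∂μ) (fun τ => ∫ z, g z τ ∂μ) (∫ z, c z ∂μ) := by
  have hgm : ∀ τ, AEStronglyMeasurable (fun z => g z τ) μ := fun τ =>
    (hg.comp (measurable_id.prodMk measurable_const)).aestronglyMeasurable
  have hgi : ∀ τ, 0 ≤ τ → Integrable (fun z => g z τ) μ := fun τ hτ =>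
    hM.mono' (hgm τ) (H.mono fun z h => h.bound τ hτ)
  -- the time derivative is measurable in `z` as a limit of difference quotients
  have hdm : ∀ τ, 0 < τ → AEStronglyMeasurable (fun z => deriv (g z) τ) μ := by
    intro τ hτ
    refine aestronglyMeasurable_of_tendsto_ae (u := atTop)
      (f := fun (n : ℕ) z => ((1 : ℝ) / (n + 1))⁻¹ * (g z (τ + 1 / (n + 1)) - g z τ))
      (fun n => ((hgm _).sub (hgm _)).const_mul _) ?_
    filter_upwards [H] with z h
    have := (h.diff τ hτ).hasDerivAt.tendsto_slope_zero
    refine this.comp (tendsto_nhdsWithin_iff.2 ⟨tendsto_one_div_add_atTop_nhds_zero_nat, ?_⟩)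
    filter_upwards with n
    simp only [mem_compl_iff, mem_singleton_iff]
    positivity
  have hd : ∀ τ, 0 < τ → HasDerivAt (fun τ => ∫ z, g z τ ∂μ) (∫ z, deriv (g z) τ ∂μ) τ := by
    intro τ hτ
    refine (hasDerivAt_integral_of_dominated_loc_of_deriv_le (F := fun τ z => g z τ)
      (F' := fun τ z => deriv (g z) τ) (bound := M) (s := Ioi 0) (Ioi_mem_nhds hτ)
      (Eventually.of_forall hgm) (hgi τ hτ.le) (hdm τ hτ) ?_ hM ?_).2
    · exact H.mono fun z h σ hσ => h.abs_deriv_le hσ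
    · exact H.mono fun z h σ hσ => (h.diff σ hσ).hasDerivAt
  refine ⟨fun τ hτ => ?_, fun σ τ hσ hτ => ?_, fun τ hτ => (hd τ hτ).differentiableAt,
    fun h1 => ?_, fun h1 => ?_⟩
  · exact norm_integral_le_of_norm_le (f := fun z => g z τ) hM (H.mono fun z h => h.bound τ hτ)
  · rw [← integral_sub (hgi σ hσ) (hgi τ hτ), ← integral_mul_const]
    exact norm_integral_le_of_norm_le (f := fun z => g z σ - g z τ) (hM.mul_const _)
      (H.mono fun z h => h.lip σ τ hσ hτ)
  · have hint : Integrable (fun p : Ω × ℝ => (g p.1 0 - g p.1 p.2) * p.2 ^ (-1 - a))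
        (μ.prod (volume.restrict (Ioi 0))) := by
      have h2 : Integrable (fun p : Ω × ℝ => 2 * M p.1 * (min 1 p.2 * p.2 ^ (-1 - a)))
          (μ.prod (volume.restrict (Ioi 0))) :=
        (hM.const_mul 2).mul_prod (integrableOn_min_mul_rpow h0 h1)
      refine h2.mono' ?_ ?_
      · refine Measurable.aestronglyMeasurable ?_
        have : Measurable fun p : Ω × ℝ => g p.1 0 :=
          hg.comp (measurable_fst.prodMk measurable_const)
        exact (this.sub hg).mul (measurable_snd.pow_const _)
      · have hz : ∀ᵐ p : Ω × ℝ ∂(μ.prod (volume.restrict (Ioi 0))),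
            HasFracPower a (M p.1) (g p.1) (c p.1) := Measure.quasiMeasurePreserving_fst.ae H
        have hτ : ∀ᵐ p : Ω × ℝ ∂(μ.prod (volume.restrict (Ioi 0))), 0 < p.2 :=
          Measure.quasiMeasurePreserving_snd.ae (ae_restrict_mem measurableSet_Ioi)
        filter_upwards [hz, hτ] with p h hτ
        have := h.abs_sub_le le_rfl hτ.le
        rw [zero_add] at this
        rw [Real.norm_eq_abs, abs_mul, abs_of_pos (Real.rpow_pos_of_pos hτ _), ← mul_assoc]
        gcongr
    have hc : ∀ᵐ z ∂μ, c z = a / Real.Gamma (1 - a) *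
        ∫ τ in Ioi 0, (g z 0 - g z τ) * τ ^ (-1 - a) := H.mono fun z h => (h.frac h1).symm
    rw [integral_congr_ae hc, integral_const_mul, integral_integral_swap hint]
    congr 1
    refine setIntegral_congr_fun measurableSet_Ioi fun τ hτ => ?_
    rw [integral_mul_const, integral_sub (hgi 0 le_rfl) (hgi τ (le_of_lt hτ))]
  · have : Tendsto (fun τ => ∫ z, deriv (g z) τ ∂μ) (𝓝[>] 0) (𝓝 (∫ z, -c z ∂μ)) := by
      refine tendsto_integral_filter_of_dominated_convergence M ?_ ?_ hM ?_
      · filter_upwards [self_mem_nhdsWithin] with τ hτ using hdm τ hτ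
      · filter_upwards [self_mem_nhdsWithin] with τ hτ
        exact H.mono fun z h => h.abs_deriv_le hτ
      · exact H.mono fun z h => h.infinitesimal h1
    rw [integral_neg] at this
    refine this.congr' ?_
    filter_upwards [self_mem_nhdsWithin] with τ hτ using ((hd τ hτ).deriv).symm

/-- Orbits that agree for nonnegative times have the same properties. -/
theorem congr (H : HasFracPower a M h c) {h' : ℝ → ℝ} (hh : ∀ τ, 0 ≤ τ → h' τ = h τ) :
    HasFracPower a M h' c where
  bound τ hτ := by rw [hh τ hτ]; exact H.bound τ hτ
  lip σ τ hσ hτ := by rw [hh τ hτ, hh σ hσ]; exact H.lip σ τ hσ hτ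
  diff τ hτ := (H.diff τ hτ).congr_of_eventuallyEq <| by
    filter_upwards [lt_mem_nhds hτ] with σ hσ using hh σ hσ.le
  frac h1 := by
    rw [← H.frac h1]
    congr 1
    refine setIntegral_congr_fun measurableSet_Ioi fun τ hτ => ?_
    rw [hh 0 le_rfl, hh τ (le_of_lt hτ)]
  infinitesimal h1 := by
    refine (H.infinitesimal h1).congr' ?_
    filter_upwards [self_mem_nhdsWithin] with τ hτ
    refine (Filter.EventuallyEq.deriv_eq ?_).symm
    filter_upwards [lt_mem_nhds hτ] with σ hσ using hh σ hσ.le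

/-- Superposition of countably many orbits. -/
theorem tsum {M c : ℕ → ℝ} {g : ℕ → ℝ → ℝ} (h0 : 0 < a) (hg : ∀ n, Measurable (g n))
    (hM : Summable M) (H : ∀ n, HasFracPower a (M n) (g n) (c n)) :
    HasFracPower a (∑' n, M n) (fun τ => ∑' n, g n τ) (∑' n, c n) := by
  simp_rw [← integral_count_nat]
  refine integral_param h0 (measurable_from_prod_countable_right hg) ?_ (ae_of_all _ H)
  rw [integrable_count_iff]
  exact hM.norm

end HasFracPower

/-! ### Exponential orbits -/

theorem integrableOn_exp_neg_mul_rpow {p : ℝ} (hp : -1 < p) :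
    IntegrableOn (fun τ : ℝ => Real.exp (-τ) * τ ^ p) (Ioi 0) := by
  have := Real.GammaIntegral_convergent (s := p + 1) (by linarith)
  simpa using this

theorem integral_exp_neg_mul_rpow {p : ℝ} (hp : -1 < p) :
    ∫ τ in Ioi (0 : ℝ), Real.exp (-τ) * τ ^ p = Real.Gamma (p + 1) := by
  rw [Real.Gamma_eq_integral (by linarith)]
  simp

theorem integral_one_sub_exp_neg_mul_rpow {a : ℝ} (h0 : 0 < a) (h1 : a < 1) :
    ∫ τ in Ioi (0 : ℝ), (1 - Real.exp (-τ)) * τ ^ (-1 - a) = Real.Gamma (1 - a) / a := by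
  have hle : ∀ τ : ℝ, 0 < τ → 0 ≤ 1 - Real.exp (-τ) ∧ 1 - Real.exp (-τ) ≤ min 1 τ := fun τ hτ => by
    have h2 : Real.exp (-τ) ≤ 1 := Real.exp_le_one_iff.2 (by linarith)
    have h3 := Real.exp_pos (-τ)
    have h4 := Real.add_one_le_exp (-τ)
    exact ⟨by linarith, le_min (by linarith) (by linarith)⟩
  have hi1 : IntegrableOn (fun τ : ℝ => (1 - Real.exp (-τ)) * τ ^ (-1 - a)) (Ioi 0) := by
    refine (integrableOn_min_mul_rpow h0 h1).mono' (by measurability) ?_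
    refine (ae_restrict_iff' measurableSet_Ioi).2 (ae_of_all _ fun τ hτ => ?_)
    have hp := Real.rpow_pos_of_pos (show 0 < τ from hτ) (-1 - a)
    rw [Real.norm_eq_abs, abs_mul, abs_of_pos hp, abs_of_nonneg (hle τ hτ).1]
    gcongr
    exact (hle τ hτ).2
  have hi2 := integrableOn_exp_neg_mul_rpow (p := -a) (by linarith)
  -- an antiderivative of the difference of the two integrands
  let F : ℝ → ℝ := fun τ => -((1 - Real.exp (-τ)) * τ ^ (-a) / a)
  have hF0 : F 0 = 0 := by simp [F]
  have hFle : ∀ τ : ℝ, 0 < τ → |F τ| ≤ min 1 τ * τ ^ (-a) / a := fun τ hτ => by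
    have hp := Real.rpow_pos_of_pos hτ (-a)
    rw [abs_neg, abs_div, abs_mul, abs_of_pos hp, abs_of_nonneg (hle τ hτ).1, abs_of_pos h0]
    gcongr
    exact (hle τ hτ).2
  have key : ∫ τ in Ioi (0 : ℝ), ((1 - Real.exp (-τ)) * τ ^ (-1 - a)
      - a⁻¹ * (Real.exp (-τ) * τ ^ (-a))) = 0 - F 0 := by
    refine integral_Ioi_of_hasDerivAt_of_tendsto (f := F) ?_ (fun τ hτ => ?_)
      (hi1.sub (hi2.const_mul _)) ?_
    · rw [ContinuousWithinAt, hF0, tendsto_zero_iff_norm_tendsto_zero]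
      have : Tendsto (fun τ : ℝ => τ ^ (1 - a) / a) (𝓝[Ici 0] 0) (𝓝 0) := by
        have : Tendsto (fun τ : ℝ => τ ^ (1 - a) / a) (𝓝 0) (𝓝 ((0 : ℝ) ^ (1 - a) / a)) :=
          ((Real.continuousAt_rpow_const _ _ (Or.inr (by linarith))).div_const a).tendsto
        rw [Real.zero_rpow (by linarith), zero_div] at this
        exact this.mono_left nhdsWithin_le_nhds
      refine squeeze_zero' (Eventually.of_forall fun _ => norm_nonneg _) ?_ this
      filter_upwards [self_mem_nhdsWithin] with τ hτ
      rcases (show (0 : ℝ) ≤ τ from hτ).eq_or_lt with rfl | hτ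
      · rw [hF0, Real.zero_rpow (by linarith)]; simp
      · refine (hFle τ hτ).trans ?_
        have hp := Real.rpow_pos_of_pos hτ (-a)
        rw [sub_eq_add_neg, Real.rpow_add hτ, Real.rpow_one]
        gcongr
        exact min_le_right _ _
    · have hτ : 0 < τ := hτ
      have d1 : HasDerivAt (fun τ : ℝ => 1 - Real.exp (-τ)) (Real.exp (-τ)) τ := by
        simpa using ((hasDerivAt_neg τ).exp).const_sub 1
      have d2 := Real.hasDerivAt_rpow_const (x := τ) (p := -a) (Or.inl hτ.ne')
      have d3 := ((d1.mul d2).div_const a).neg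
      refine d3.congr_deriv ?_
      rw [show -a - 1 = -1 - a by ring]
      field_simp
      ring
    · have : Tendsto (fun τ : ℝ => τ ^ (-a) / a) atTop (𝓝 (0 / a)) :=
        (tendsto_rpow_neg_atTop h0).div_const a
      rw [zero_div] at this
      rw [tendsto_zero_iff_norm_tendsto_zero]
      refine squeeze_zero' (Eventually.of_forall fun _ => norm_nonneg _) ?_ this
      filter_upwards [Ioi_mem_atTop 0] with τ hτ
      refine (hFle τ hτ).trans ?_
      have hp := Real.rpow_pos_of_pos hτ (-a)
      gcongr
      exact mul_le_of_le_one_left hp.le (min_le_left _ _)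
  rw [hF0, sub_zero, integral_sub hi1 (hi2.const_mul _), integral_const_mul,
    integral_exp_neg_mul_rpow (by linarith), sub_eq_zero] at key
  rw [key, show -a + 1 = 1 - a by ring]
  ring

theorem Gamma_add_nat {x : ℝ} (hx : 0 < x) (n : ℕ) :
    Real.Gamma (x + n) = (ascPochhammer ℝ n).eval x * Real.Gamma x := by
  induction n with
  | zero => simp
  | succ n ih =>
    rw [Nat.cast_succ, ← add_assoc, Real.Gamma_add_one (by positivity), ih, ascPochhammer_succ_eval]
    ring

theorem mul_factorial_le_ascPochhammer {s : ℝ} (hs : 0 < s) (n : ℕ) :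
    s * n.factorial ≤ (ascPochhammer ℝ (n + 1)).eval s := by
  induction n with
  | zero => simp
  | succ n ih =>
    rw [ascPochhammer_succ_eval, Nat.factorial_succ]
    push_cast
    calc s * ((n + 1) * n.factorial) = s * n.factorial * (n + 1) := by ring
      _ ≤ _ := mul_le_mul ih (by linarith) (by positivity) (ascPochhammer_pos _ s hs).le

theorem _root_.Real.pow_mul_exp_neg_le_factorial {x : ℝ} (hx : 0 ≤ x) (n : ℕ) :
    x ^ n * Real.exp (-x) ≤ n.factorial := by
  have h := Real.pow_div_factorial_le_exp x hx n
  rw [div_le_iff₀ (by positivity)] at h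
  rw [Real.exp_neg, ← div_eq_mul_inv, div_le_iff₀ (Real.exp_pos x)]
  linarith

/-- The orbits `τ ^ j e^{-τ}`, which are up to sign the derivatives with respect to `k` of
`e^{-kτ}`; correspondingly the values are up to sign the derivatives of `k ^ a` at `k = 1`. -/
theorem HasFracPower.pow_mul_exp_neg {a : ℝ} (h0 : 0 < a) (j : ℕ) :
    HasFracPower a (2 * j.factorial) (fun τ => τ ^ j * Real.exp (-τ))
      ((ascPochhammer ℝ j).eval (-a)) := by
  have hd : ∀ τ : ℝ, HasDerivAt (fun τ => τ ^ j * Real.exp (-τ))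
      (j * τ ^ (j - 1) * Real.exp (-τ) - τ ^ j * Real.exp (-τ)) τ := fun τ => by
    refine ((hasDerivAt_pow j τ).mul ((hasDerivAt_neg τ).exp)).congr_deriv ?_
    ring
  have hb : ∀ τ : ℝ, 0 ≤ τ → |τ ^ j * Real.exp (-τ)| ≤ j.factorial := fun τ hτ => by
    rw [abs_of_nonneg (by positivity)]
    exact Real.pow_mul_exp_neg_le_factorial hτ j
  have hdb : ∀ τ : ℝ, 0 ≤ τ → |deriv (fun τ => τ ^ j * Real.exp (-τ)) τ| ≤ 2 * j.factorial := by
    intro τ hτ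
    rw [(hd τ).deriv]
    refine (abs_sub _ _).trans ?_
    have h1 := hb τ hτ
    have h2 : |j * τ ^ (j - 1) * Real.exp (-τ)| ≤ j.factorial := by
      rw [abs_of_nonneg (by positivity)]
      rcases j with - | j
      · simp
      · have := Real.pow_mul_exp_neg_le_factorial hτ j
        rw [Nat.factorial_succ, Nat.cast_mul, mul_assoc]
        simp only [Nat.add_sub_cancel]
        gcongr
    linarith
  refine ⟨fun τ hτ => (hb τ hτ).trans (by linarith [(Nat.cast_nonneg _ : (0:ℝ) ≤ j.factorial)]),
    fun σ τ hσ hτ => ?_, fun τ _ => (hd τ).differentiableAt, fun h1 => ?_, fun h1 => ?_⟩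
  · exact (convex_Ici (0 : ℝ)).norm_image_sub_le_of_norm_deriv_le
      (fun x _ => (hd x).differentiableAt) (fun x hx => hdb x hx) hτ hσ
  · have hG : 0 < Real.Gamma (1 - a) := Real.Gamma_pos_of_pos (by linarith)
    rcases j with - | j
    · simp only [pow_zero, one_mul, neg_zero, Real.exp_zero, ascPochhammer_zero,
        Polynomial.eval_one, integral_one_sub_exp_neg_mul_rpow h0 h1]
      field_simp
    · have : ∫ τ in Ioi (0 : ℝ), ((0 : ℝ) ^ (j + 1) * Real.exp (-0) - τ ^ (j + 1) * Real.exp (-τ))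
          * τ ^ (-1 - a) = ∫ τ in Ioi (0 : ℝ), -(Real.exp (-τ) * τ ^ (j - a)) := by
        refine setIntegral_congr_fun measurableSet_Ioi fun τ hτ => ?_
        have hτ : 0 < τ := hτ
        simp only [ne_eq, Nat.add_eq_zero_iff, one_ne_zero, and_false, not_false_eq_true, zero_pow,
          zero_mul, zero_sub, neg_mul]
        rw [mul_right_comm, ← Real.rpow_natCast, ← Real.rpow_add hτ, mul_comm]
        push_cast
        ring_nf
      rw [this, integral_neg, integral_exp_neg_mul_rpow (by linarith [(Nat.cast_nonneg j : (0:ℝ) ≤ j)]),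
        show (j : ℝ) - a + 1 = (1 - a) + j by ring, Gamma_add_nat (by linarith), ascPochhammer_succ_left]
      simp only [Polynomial.eval_mul, Polynomial.eval_X, Polynomial.eval_comp, Polynomial.eval_add,
        Polynomial.eval_one]
      rw [neg_add_eq_sub]
      field_simp
  · subst h1
    have hc : Continuous (deriv fun τ : ℝ => τ ^ j * Real.exp (-τ)) := by
      have : (deriv fun τ : ℝ => τ ^ j * Real.exp (-τ)) = fun τ =>
        j * τ ^ (j - 1) * Real.exp (-τ) - τ ^ j * Real.exp (-τ) := funext fun τ => (hd τ).deriv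
      rw [this]
      fun_prop
    have h2 := (hc.tendsto 0).mono_left (nhdsWithin_le_nhds (s := Ioi 0))
    convert! h2 using 2
    rw [(hd 0).deriv]
    rcases j with - | - | j
    · simp
    · simp
    · simp [ascPochhammer_succ_left, Polynomial.eval_comp]

/-! ### The heat kernel -/

/-- The Euclidean space `ℝ^d`. -/
abbrev E (d : ℕ) := EuclideanSpace ℝ (Fin d)

variable {d : ℕ}

/-- The heat kernel on `ℝ^d`, that is, the convolution kernel of `e^{τΔ}`. -/
noncomputable def heatKernel (d : ℕ) (τ : ℝ) (z : E d) : ℝ :=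
  (4 * Real.pi * τ) ^ (-(d : ℝ) / 2) * Real.exp (-‖z‖ ^ 2 / (4 * τ))

/-- The time derivative of the heat kernel. -/
noncomputable def heatKernelDeriv (d : ℕ) (τ : ℝ) (z : E d) : ℝ :=
  (‖z‖ ^ 2 / (4 * τ ^ 2) - d / (2 * τ)) * heatKernel d τ z

/-- Polynomial growth of a function on `ℝ^d`. -/
def HasPolyGrowth (u : E d → ℂ) : Prop :=
  ∃ (C : ℝ) (k : ℕ), ∀ y, ‖u y‖ ≤ C * (1 + ‖y‖) ^ k

theorem one_add_pow_mul_exp_neg_le (k : ℕ) {c t : ℝ} (hc : 0 < c) (ht : 0 ≤ t) :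
    (1 + t) ^ k * Real.exp (-c * t) ≤ Real.exp c * (k.factorial / c ^ k) := by
  have h := Real.pow_mul_exp_neg_le_factorial (x := c * (1 + t)) (by positivity) k
  rw [mul_pow] at h
  have : Real.exp (-c * t) = Real.exp c * Real.exp (-(c * (1 + t))) := by
    rw [← Real.exp_add]; ring_nf
  rw [this, mul_left_comm]
  gcongr
  rw [le_div_iff₀ (by positivity)]
  linarith

theorem integrable_one_add_norm_pow_mul_exp (k : ℕ) {c : ℝ} (hc : 0 < c) :
    Integrable (fun y : E d => (1 + ‖y‖) ^ k * Real.exp (-c * ‖y‖)) := by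
  have hi : Integrable (fun y : E d => (1 + ‖y‖) ^ (-((d + 1 : ℕ) : ℝ))) :=
    integrable_one_add_norm (by simp)
  refine (hi.const_mul (Real.exp c * ((k + (d + 1)).factorial / c ^ (k + (d + 1))))).mono'
    (by fun_prop) (ae_of_all _ fun y => ?_)
  have h1 : 0 < 1 + ‖y‖ := by positivity
  have := one_add_pow_mul_exp_neg_le (k + (d + 1)) hc (norm_nonneg y)
  rw [Real.norm_of_nonneg (by positivity), Real.rpow_neg h1.le, Real.rpow_natCast,
    ← div_eq_mul_inv, le_div_iff₀ (by positivity)]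
  refine le_trans (le_of_eq ?_) this
  rw [pow_add]
  ring

theorem HasPolyGrowth.integrable_mul_exp {u : E d → ℂ} (hu : HasPolyGrowth u)
    (hm : AEStronglyMeasurable u volume) (x : E d) {c : ℝ} (hc : 0 < c) :
    Integrable (fun y => ‖u y‖ * Real.exp (-c * ‖x - y‖)) := by
  obtain ⟨C, k, h⟩ := hu
  have h1 := ((integrable_one_add_norm_pow_mul_exp (d := d) k hc).comp_sub_left x).const_mul
    (C * (1 + ‖x‖) ^ k)
  refine h1.mono' (hm.norm.mul (by fun_prop)) (ae_of_all _ fun y => ?_)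
  rw [Real.norm_of_nonneg (by positivity), ← mul_assoc]
  gcongr
  have hC : 0 ≤ C := by
    have := (norm_nonneg _).trans (h 0)
    simpa using this
  refine (h y).trans ?_
  rw [mul_assoc, ← mul_pow]
  gcongr
  have h2 : ‖y‖ ≤ ‖x‖ + ‖x - y‖ := by
    have := norm_sub_le x (x - y)
    simpa using this
  nlinarith [mul_nonneg (norm_nonneg x) (norm_nonneg (x - y))]

theorem heatKernel_pos {τ : ℝ} (hτ : 0 < τ) (z : E d) : 0 < heatKernel d τ z := by
  have := Real.pi_pos
  unfold heatKernel
  positivity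

theorem continuous_heatKernel (τ : ℝ) : Continuous (heatKernel d τ) := by
  unfold heatKernel
  fun_prop

theorem continuous_heatKernelDeriv (τ : ℝ) : Continuous (heatKernelDeriv d τ) := by
  have := continuous_heatKernel (d := d) τ
  unfold heatKernelDeriv
  fun_prop

theorem measurable_heatKernel : Measurable fun p : ℝ × E d => heatKernel d p.1 p.2 := by
  unfold heatKernel
  fun_prop

theorem heatKernel_neg (τ : ℝ) (z : E d) : heatKernel d τ (-z) = heatKernel d τ z := by
  simp [heatKernel]

theorem hasDerivAt_heatKernel {τ : ℝ} (hτ : 0 < τ) (z : E d) :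
    HasDerivAt (fun τ => heatKernel d τ z) (heatKernelDeriv d τ z) τ := by
  have hp := Real.pi_pos
  have h1 : HasDerivAt (fun τ : ℝ => 4 * Real.pi * τ) (4 * Real.pi) τ := by
    simpa using (hasDerivAt_id τ).const_mul (4 * Real.pi)
  have h2 := h1.rpow_const (p := -(d : ℝ) / 2) (Or.inl (by positivity))
  have h3 : HasDerivAt (fun τ : ℝ => -‖z‖ ^ 2 / (4 * τ)) (‖z‖ ^ 2 / (4 * τ ^ 2)) τ := by
    have := ((hasDerivAt_id τ).const_mul 4).fun_inv (by simpa using hτ.ne') |>.const_mul (-‖z‖ ^ 2)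
    refine this.congr_deriv ?_
    simp only [id]
    field_simp
  refine (h2.mul h3.exp).congr_deriv ?_
  rw [heatKernelDeriv, heatKernel, Real.rpow_sub_one (by positivity)]
  field_simp
  ring

/-- Exponential bounds, uniform for large times thanks to the factor `e^{-δτ}`. -/
theorem exists_heatKernel_le (d : ℕ) {τ₀ δ : ℝ} (hτ₀ : 0 < τ₀) (hδ : 0 < δ) :
    ∃ C c : ℝ, 0 < C ∧ 0 < c ∧ ∀ τ, τ₀ ≤ τ → ∀ z : E d,
      Real.exp (-δ * τ) * heatKernel d τ z ≤ C * Real.exp (-c * ‖z‖) ∧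
      Real.exp (-δ * τ) * |heatKernelDeriv d τ z| ≤ C * Real.exp (-c * ‖z‖) := by
  have hp := Real.pi_pos
  refine ⟨(4 * Real.pi * τ₀) ^ (-(d : ℝ) / 2) * (1 + (2 + d) / τ₀), Real.sqrt (δ / 2),
    by positivity, by positivity, fun τ hτ z => ?_⟩
  have hτ' : 0 < τ := hτ₀.trans_le hτ
  have hK : (4 * Real.pi * τ) ^ (-(d : ℝ) / 2) ≤ (4 * Real.pi * τ₀) ^ (-(d : ℝ) / 2) :=
    Real.rpow_le_rpow_of_nonpos (by positivity) (by gcongr)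
      (by rw [neg_div]; exact neg_nonpos.2 (by positivity))
  set X := ‖z‖ ^ 2 / (4 * τ) with hX
  have hX0 : 0 ≤ X := by positivity
  have hk : heatKernel d τ z = (4 * Real.pi * τ) ^ (-(d : ℝ) / 2) * Real.exp (-X) := by
    rw [heatKernel, hX, neg_div (4 * τ)]
  -- the arithmetic-geometric mean inequality
  have hexp : Real.exp (-δ * τ) * Real.exp (-(X / 2)) ≤ Real.exp (-Real.sqrt (δ / 2) * ‖z‖) := by
    rw [← Real.exp_add, Real.exp_le_exp]
    have h1 : Real.sqrt (δ / 2) ^ 2 = δ / 2 := Real.sq_sqrt (by positivity)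
    have h2 : Real.sqrt (δ / 2) * ‖z‖ ≤ δ * τ + X / 2 := by
      rw [hX, div_div, ← sub_le_iff_le_add', le_div_iff₀ (by positivity)]
      have h3 : (4 * Real.sqrt (δ / 2) * τ - ‖z‖) ^ 2
          = 8 * δ * τ ^ 2 - 8 * (Real.sqrt (δ / 2) * τ * ‖z‖) + ‖z‖ ^ 2 := by
        linear_combination 16 * τ ^ 2 * h1
      have := sq_nonneg (4 * Real.sqrt (δ / 2) * τ - ‖z‖)
      linarith
    linarith
  have hXe : X * Real.exp (-X) ≤ 2 * Real.exp (-(X / 2)) := by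
    have h1 := Real.pow_mul_exp_neg_le_factorial (x := X / 2) (by positivity) 1
    have h2 : Real.exp (-X) = Real.exp (-(X / 2)) * Real.exp (-(X / 2)) := by
      rw [← Real.exp_add]; ring_nf
    have h3 := Real.exp_pos (-(X / 2))
    simp only [pow_one, Nat.factorial_one, Nat.cast_one] at h1
    rw [h2]
    nlinarith
  have hXX : Real.exp (-X) ≤ Real.exp (-(X / 2)) := Real.exp_le_exp.2 (by linarith)
  constructor
  · calc _ ≤ Real.exp (-δ * τ) * ((4 * Real.pi * τ₀) ^ (-(d : ℝ) / 2) * Real.exp (-(X / 2))) := by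
          rw [hk]; gcongr
      _ = (4 * Real.pi * τ₀) ^ (-(d : ℝ) / 2) * (Real.exp (-δ * τ) * Real.exp (-(X / 2))) := by ring
      _ ≤ (4 * Real.pi * τ₀) ^ (-(d : ℝ) / 2) * (1 + (2 + d) / τ₀) *
          Real.exp (-Real.sqrt (δ / 2) * ‖z‖) := by
        gcongr
        exact le_mul_of_one_le_right (by positivity) (le_add_of_nonneg_right (by positivity))
  · have habs : |heatKernelDeriv d τ z| ≤
        (4 * Real.pi * τ₀) ^ (-(d : ℝ) / 2) * ((2 + d) / τ₀ * Real.exp (-(X / 2))) := by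
      have h1 : |‖z‖ ^ 2 / (4 * τ ^ 2) - d / (2 * τ)| ≤ (X + d) / τ := by
        have e1 : ‖z‖ ^ 2 / (4 * τ ^ 2) = X / τ := by rw [hX]; field_simp
        have e2 : (d : ℝ) / (2 * τ) ≤ d / τ := by
          gcongr; linarith
        rw [e1, add_div]
        refine (abs_sub _ _).trans ?_
        rw [abs_of_nonneg (by positivity), abs_of_nonneg (by positivity)]
        gcongr
      rw [heatKernelDeriv, abs_mul, abs_of_pos (heatKernel_pos hτ' z), hk]
      calc _ ≤ (X + d) / τ * ((4 * Real.pi * τ) ^ (-(d : ℝ) / 2) * Real.exp (-X)) := by gcongr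
        _ = (4 * Real.pi * τ) ^ (-(d : ℝ) / 2) * ((X * Real.exp (-X) + d * Real.exp (-X)) / τ) := by
          ring
        _ ≤ (4 * Real.pi * τ₀) ^ (-(d : ℝ) / 2) *
            ((2 * Real.exp (-(X / 2)) + d * Real.exp (-(X / 2))) / τ₀) := by gcongr
        _ = _ := by ring
    calc _ ≤ Real.exp (-δ * τ) * ((4 * Real.pi * τ₀) ^ (-(d : ℝ) / 2) *
          ((2 + d) / τ₀ * Real.exp (-(X / 2)))) := by gcongr
      _ = (4 * Real.pi * τ₀) ^ (-(d : ℝ) / 2) * ((2 + d) / τ₀) *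
          (Real.exp (-δ * τ) * Real.exp (-(X / 2))) := by ring
      _ ≤ _ := by
        gcongr
        linarith

/-- The heat flow of a function of polynomial growth is defined by a convergent integral. -/
theorem integrable_mul_heatKernel {u : E d → ℂ} (hu : HasPolyGrowth u)
    (hm : AEStronglyMeasurable u volume) (x : E d) {τ : ℝ} (hτ : 0 < τ) :
    Integrable (fun y => u y * heatKernel d τ (x - y)) := by
  obtain ⟨C, c, hC, hc, h⟩ := exists_heatKernel_le d hτ one_pos
  refine ((hu.integrable_mul_exp hm x hc).const_mul (Real.exp τ * C)).mono' (hm.mul ?_)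
    (ae_of_all _ fun y => ?_)
  · exact (Complex.continuous_ofReal.comp
      ((continuous_heatKernel τ).comp (by fun_prop))).aestronglyMeasurable
  · rw [norm_mul, Complex.norm_real, Real.norm_of_nonneg (heatKernel_pos hτ _).le]
    have := (h τ le_rfl (x - y)).1
    rw [neg_one_mul, Real.exp_neg, inv_mul_le_iff₀ (Real.exp_pos _)] at this
    nlinarith [norm_nonneg (u y)]

/-- The heat equation in integrated form. -/
theorem hasDerivAt_integral_mul_heatKernel {u : E d → ℂ} (hu : HasPolyGrowth u)
    (hm : AEStronglyMeasurable u volume) (x : E d) {τ : ℝ} (hτ : 0 < τ) :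
    Integrable (fun y => u y * heatKernelDeriv d τ (x - y)) ∧
    HasDerivAt (fun τ => ∫ y, u y * heatKernel d τ (x - y))
      (∫ y, u y * heatKernelDeriv d τ (x - y)) τ := by
  obtain ⟨C, c, hC, hc, h⟩ := exists_heatKernel_le d (half_pos hτ) one_pos
  have hn : Ioo (τ / 2) (2 * τ) ∈ 𝓝 τ := Ioo_mem_nhds (by linarith) (by linarith)
  refine hasDerivAt_integral_of_dominated_loc_of_deriv_le
    (F := fun τ y => u y * heatKernel d τ (x - y))
    (F' := fun τ y => u y * heatKernelDeriv d τ (x - y))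
    (bound := fun y => Real.exp (2 * τ) * C * (‖u y‖ * Real.exp (-c * ‖x - y‖)))
    hn ?_
    (integrable_mul_heatKernel hu hm x hτ) (hm.mul ?_) (ae_of_all _ fun y σ hσ => ?_)
    ((hu.integrable_mul_exp hm x hc).const_mul _) (ae_of_all _ fun y σ hσ => ?_)
  · filter_upwards [lt_mem_nhds hτ] with σ hσ
    exact (integrable_mul_heatKernel hu hm x hσ).aestronglyMeasurable
  · exact (Complex.continuous_ofReal.comp
      ((continuous_heatKernelDeriv τ).comp (by fun_prop))).aestronglyMeasurable
  · rw [norm_mul, Complex.norm_real, Real.norm_eq_abs]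
    have := (h σ hσ.1.le (x - y)).2
    rw [neg_one_mul, Real.exp_neg, inv_mul_le_iff₀ (Real.exp_pos _)] at this
    have h2 : Real.exp σ ≤ Real.exp (2 * τ) := Real.exp_le_exp.2 hσ.2.le
    calc _ ≤ ‖u y‖ * (Real.exp (2 * τ) * (C * Real.exp (-c * ‖x - y‖))) := by
          gcongr; exact this.trans (by gcongr)
      _ = _ := by ring
  · exact ((hasDerivAt_heatKernel ((half_pos hτ).trans hσ.1) (x - y)).ofReal_comp).const_mul (u y)

/-! ### The pseudo-differential form -/

/-- The symbol `e^{-τ(2π|ξ|)²} e^{2πi x·ξ}` of the heat semigroup at `x`. -/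
noncomputable def heatSymbol (x : E d) (τ : ℝ) (ξ : E d) : ℂ :=
  Complex.exp (-((4 * Real.pi ^ 2 * τ : ℝ) : ℂ) * ‖ξ‖ ^ 2 + 2 * Real.pi * Complex.I * (⟪x, ξ⟫ : ℝ))

theorem fourier_heatSymbol (x : E d) {τ : ℝ} (hτ : 0 < τ) (y : E d) :
    𝓕 (heatSymbol x τ) y = heatKernel d τ (x - y) := by
  have hp := Real.pi_pos
  have hb : 0 < ((4 * Real.pi ^ 2 * τ : ℝ) : ℂ).re := by
    rw [Complex.ofReal_re]; positivity
  have h := fourier_gaussian_innerProductSpace' hb x y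
  have e1 : (Real.pi / ((4 * Real.pi ^ 2 * τ : ℝ) : ℂ)) = ((4 * Real.pi * τ)⁻¹ : ℝ) := by
    rw [← Complex.ofReal_div]
    congr 1
    field_simp
  rw [show heatSymbol x τ = fun v => Complex.exp (-((4 * Real.pi ^ 2 * τ : ℝ) : ℂ) * ‖v‖ ^ 2
    + 2 * Real.pi * Complex.I * (⟪x, v⟫ : ℝ)) from rfl, h, e1, heatKernel]
  have e2 : ((4 * Real.pi * τ)⁻¹ : ℝ) ^ ((d : ℝ) / 2) = (4 * Real.pi * τ) ^ (-(d : ℝ) / 2) := by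
    rw [Real.inv_rpow (by positivity), ← Real.rpow_neg (by positivity), neg_div]
  rw [← e2, Complex.ofReal_mul ((4 * Real.pi * τ)⁻¹ ^ ((d : ℝ) / 2)),
    Complex.ofReal_cpow (by positivity)]
  congr 1
  · simp
  · rw [Complex.ofReal_exp]
    congr 1
    rw [← Complex.ofReal_pow, ← Complex.ofReal_pow, ← Complex.ofReal_neg, ← Complex.ofReal_mul,
      ← Complex.ofReal_div]
    congr 1
    field_simp

theorem norm_heatSymbol (x : E d) (τ : ℝ) (ξ : E d) :
    ‖heatSymbol x τ ξ‖ = Real.exp (-(4 * Real.pi ^ 2 * τ) * ‖ξ‖ ^ 2) := by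
  have : -((4 * Real.pi ^ 2 * τ : ℝ) : ℂ) * ‖ξ‖ ^ 2 + 2 * Real.pi * Complex.I * (⟪x, ξ⟫ : ℝ)
      = ((-(4 * Real.pi ^ 2 * τ) * ‖ξ‖ ^ 2 : ℝ) : ℂ) + ((2 * Real.pi * ⟪x, ξ⟫ : ℝ) : ℂ) * Complex.I := by
    push_cast; ring
  rw [heatSymbol, this, Complex.norm_exp, Complex.add_re, Complex.re_ofReal_mul, Complex.I_re,
    mul_zero, add_zero, Complex.ofReal_re]

theorem heatSymbol_add (x : E d) (τ σ : ℝ) (ξ : E d) :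
    heatSymbol x (τ + σ) ξ = (Real.exp (-σ * (2 * Real.pi * ‖ξ‖) ^ 2) : ℝ) * heatSymbol x τ ξ := by
  rw [heatSymbol, heatSymbol, Complex.ofReal_exp, ← Complex.exp_add]
  congr 1
  push_cast
  ring

theorem continuous_heatSymbol (x : E d) : Continuous fun p : ℝ × E d => heatSymbol x p.1 p.2 := by
  unfold heatSymbol
  fun_prop

theorem integrable_norm_pow_mul_exp_neg_sq (k : ℕ) {b : ℝ} (hb : 0 < b) :
    Integrable (fun ξ : E d => ‖ξ‖ ^ k * Real.exp (-b * ‖ξ‖ ^ 2)) := by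
  refine ((integrable_one_add_norm_pow_mul_exp (d := d) k hb).const_mul (Real.exp b)).mono'
    (by fun_prop) (ae_of_all _ fun ξ => ?_)
  rw [Real.norm_of_nonneg (by positivity), mul_left_comm, ← Real.exp_add]
  gcongr
  · linarith
  · nlinarith [mul_pos hb one_pos, mul_nonneg hb.le (sq_nonneg (‖ξ‖ - 1)),
      mul_nonneg hb.le (norm_nonneg ξ)]

theorem integrable_heatSymbol (x : E d) {τ : ℝ} (hτ : 0 < τ) : Integrable (heatSymbol x τ) := by
  have hp := Real.pi_pos
  refine (integrable_norm_pow_mul_exp_neg_sq (d := d) 0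
    (show 0 < 4 * Real.pi ^ 2 * τ by positivity)).mono'
    ((continuous_heatSymbol x).comp (Continuous.prodMk_right τ)).aestronglyMeasurable
    (ae_of_all _ fun ξ => ?_)
  rw [norm_heatSymbol, pow_zero, one_mul]

/-- The regularization `e^{-ε|ξ|²}` is the heat semigroup at time `ε / (4π²)`. -/
theorem smoothedSymbol_eq (α : E d → ℝ) (x : E d) (δ ε : ℝ) (ξ : E d) :
    smoothedSymbol α x δ ε ξ = ((δ + (2 * Real.pi * ‖ξ‖) ^ 2) ^ (α x / 2) : ℝ) *
      heatSymbol x (ε / (4 * Real.pi ^ 2)) ξ := by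
  have hp := Real.pi_pos
  rw [smoothedSymbol, heatSymbol, Complex.exp_add, Complex.ofReal_mul, mul_assoc]
  congr 2
  · rw [Complex.ofReal_exp]
    congr 1
    rw [mul_div_cancel₀ _ (by positivity)]
    push_cast
    ring
  · congr 1
    ring

/-- The Balakrishnan formula for the power `k ^ a` of a positive number. -/
theorem rpow_eq_integral {a k : ℝ} (h0 : 0 < a) (h1 : a < 1) (hk : 0 < k) :
    a / Real.Gamma (1 - a) * ∫ σ in Ioi (0 : ℝ), (1 - Real.exp (-(k * σ))) * σ ^ (-1 - a) = k ^ a := by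
  have := ((HasFracPower.pow_mul_exp_neg h0 0).comp_mul hk).frac h1
  simpa using this

theorem one_sub_exp_neg_le {k σ : ℝ} (hk : 0 ≤ k) (hσ : 0 ≤ σ) :
    |1 - Real.exp (-(k * σ))| ≤ (1 + k) * min 1 σ := by
  have h1 : Real.exp (-(k * σ)) ≤ 1 := Real.exp_le_one_iff.2 (by nlinarith)
  have h2 := Real.exp_pos (-(k * σ))
  have h3 := Real.add_one_le_exp (-(k * σ))
  rw [abs_of_nonneg (by linarith)]
  rcases le_total 1 σ with h | h
  · rw [min_eq_left h]; linarith
  · rw [min_eq_right h]; nlinarith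

/-- The Fourier transform of the smoothed symbol of order `< 2` is a superposition of heat kernels:
the Balakrishnan formula writes the symbol as a superposition of the symbols of the heat
semigroup. -/
theorem fourier_smoothedSymbol (α : E d → ℝ) (x : E d) {δ ε : ℝ} (hδ : 0 < δ) (hε : 0 < ε)
    (h0 : 0 < α x / 2) (h1 : α x / 2 < 1) (y : E d) :
    𝓕 (smoothedSymbol α x δ ε) y = ((α x / 2 / Real.Gamma (1 - α x / 2) * ∫ σ in Ioi (0 : ℝ),
      (heatKernel d (ε / (4 * Real.pi ^ 2)) (x - y) - Real.exp (-δ * σ) *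
        heatKernel d (ε / (4 * Real.pi ^ 2) + σ) (x - y)) * σ ^ (-1 - α x / 2) : ℝ) : ℂ) := by
  have hp := Real.pi_pos
  set a := α x / 2 with ha
  set η := ε / (4 * Real.pi ^ 2) with hη
  have hη0 : 0 < η := by positivity
  have hG : 0 < Real.Gamma (1 - a) := Real.Gamma_pos_of_pos (by linarith)
  set c := a / Real.Gamma (1 - a) with hc
  let k : E d → ℝ := fun ξ => δ + (2 * Real.pi * ‖ξ‖) ^ 2
  have hk : ∀ ξ, 0 < k ξ := fun ξ => by positivity
  let F : E d → ℝ → ℂ := fun ξ σ => ((1 - Real.exp (-(k ξ * σ))) * σ ^ (-1 - a) : ℝ) *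
    heatSymbol x η ξ
  have hF : ∀ ξ, smoothedSymbol α x δ ε ξ = c * ∫ σ in Ioi (0 : ℝ), F ξ σ := fun ξ => by
    rw [smoothedSymbol_eq, ← rpow_eq_integral h0 h1 (hk ξ), integral_mul_const,
      integral_complex_ofReal, Complex.ofReal_mul, mul_assoc]
  -- the hypothesis of Fubini's theorem
  have hFi : Integrable (Function.uncurry fun ξ σ => 𝐞 (-⟪ξ, y⟫) • F ξ σ)
      (volume.prod (volume.restrict (Ioi 0))) := by
    have hi : Integrable (fun ξ : E d => (1 + k ξ) * ‖heatSymbol x η ξ‖) := by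
      have b : 0 < 4 * Real.pi ^ 2 * η := by positivity
      have i1 := (integrable_norm_pow_mul_exp_neg_sq (d := d) 0 b).const_mul (1 + δ)
      have i2 := (integrable_norm_pow_mul_exp_neg_sq (d := d) 2 b).const_mul (4 * Real.pi ^ 2)
      refine (i1.add i2).congr (ae_of_all _ fun ξ => ?_)
      simp only [Pi.add_apply, norm_heatSymbol, k]
      ring
    refine (hi.mul_prod (integrableOn_min_mul_rpow h0 h1)).mono' ?_ ?_
    · refine Measurable.aestronglyMeasurable ?_
      have m1 : Measurable fun p : E d × ℝ => heatSymbol x η p.1 :=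
        ((continuous_heatSymbol x).comp (continuous_const.prodMk continuous_fst)).measurable
      have m2 : Measurable fun p : E d × ℝ => (𝐞 (-⟪p.1, y⟫) : ℂ) := by
        refine Continuous.measurable ?_
        exact continuous_subtype_val.comp (Real.continuous_fourierChar.comp (by fun_prop))
      simp only [Function.uncurry_def, Circle.smul_def, smul_eq_mul, F, k]
      refine m2.mul (Measurable.mul ?_ m1)
      fun_prop
    · have hσ : ∀ᵐ p : E d × ℝ ∂(volume.prod (volume.restrict (Ioi 0))), 0 < p.2 :=
        Measure.quasiMeasurePreserving_snd.ae (ae_restrict_mem measurableSet_Ioi)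
      filter_upwards [hσ] with p hσ
      simp only [Function.uncurry_def, Circle.norm_smul, F, norm_mul, Complex.norm_real,
        Real.norm_eq_abs]
      rw [abs_of_pos (Real.rpow_pos_of_pos hσ _)]
      calc _ ≤ (1 + k p.1) * min 1 p.2 * p.2 ^ (-1 - a) * ‖heatSymbol x η p.1‖ := by
            gcongr
            exact one_sub_exp_neg_le (hk _).le hσ.le
        _ = _ := by ring
  have hFσ : ∀ σ, 0 < σ → ∫ ξ, 𝐞 (-⟪ξ, y⟫) • F ξ σ = ((heatKernel d η (x - y) -
      Real.exp (-δ * σ) * heatKernel d (η + σ) (x - y)) * σ ^ (-1 - a) : ℝ) := fun σ hσ => by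
    have e : ∀ ξ, 𝐞 (-⟪ξ, y⟫) • F ξ σ = ((σ ^ (-1 - a) : ℝ) : ℂ) *
        (𝐞 (-⟪ξ, y⟫) • heatSymbol x η ξ - (Real.exp (-δ * σ) : ℝ) *
          (𝐞 (-⟪ξ, y⟫) • heatSymbol x (η + σ) ξ)) := fun ξ => by
      simp only [F, k, heatSymbol_add, Circle.smul_def, smul_eq_mul]
      rw [show -((δ + (2 * Real.pi * ‖ξ‖) ^ 2) * σ) = -δ * σ + -σ * (2 * Real.pi * ‖ξ‖) ^ 2 by ring,
        Real.exp_add]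
      push_cast
      ring
    simp_rw [e]
    rw [integral_const_mul, integral_sub, integral_const_mul, ← Real.fourier_eq,
      ← Real.fourier_eq, fourier_heatSymbol x hη0, fourier_heatSymbol x (by positivity)]
    · push_cast; ring
    · exact (Real.fourierIntegral_convergent_iff _).2 (integrable_heatSymbol x hη0)
    · exact ((Real.fourierIntegral_convergent_iff _).2
        (integrable_heatSymbol x (by positivity))).const_mul _
  calc 𝓕 (smoothedSymbol α x δ ε) y
      = ∫ ξ, c * ∫ σ in Ioi (0 : ℝ), 𝐞 (-⟪ξ, y⟫) • F ξ σ := by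
        rw [Real.fourier_eq]
        refine integral_congr_ae (ae_of_all _ fun ξ => ?_)
        simp only [hF]
        simp only [Circle.smul_def, smul_eq_mul]
        rw [integral_const_mul]
        ring
    _ = c * ∫ σ in Ioi (0 : ℝ), ∫ ξ, 𝐞 (-⟪ξ, y⟫) • F ξ σ := by
        rw [integral_const_mul, integral_integral_swap hFi]
    _ = _ := by
        rw [setIntegral_congr_fun measurableSet_Ioi fun σ hσ => hFσ σ hσ, integral_complex_ofReal,
          ← Complex.ofReal_mul]

/-- The bound under which the superposition of heat kernels in `fourier_smoothedSymbol` can be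
integrated against functions of polynomial growth: the factor `min 1 σ` compensates the singularity
of `σ ^ (-1 - a)`, and `δ > 0` gives exponential decay in `z`, uniformly in `σ`. -/
theorem exists_heatKernel_sub_le (d : ℕ) {η δ : ℝ} (hη : 0 < η) (hδ : 0 < δ) :
    ∃ C c : ℝ, 0 < C ∧ 0 < c ∧ ∀ σ, 0 < σ → ∀ z : E d,
      |heatKernel d η z - Real.exp (-δ * σ) * heatKernel d (η + σ) z|
        ≤ C * min 1 σ * Real.exp (-c * ‖z‖) := by
  obtain ⟨C, c, hC, hc, h⟩ := exists_heatKernel_le d hη hδ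
  refine ⟨(2 + δ) * (Real.exp (δ * η) * C), c, by positivity, hc, fun σ hσ z => ?_⟩
  set B := Real.exp (δ * η) * (C * Real.exp (-c * ‖z‖)) with hB
  have hB0 : 0 < B := by positivity
  let f : ℝ → ℝ := fun s => Real.exp (-δ * s) * heatKernel d (η + s) z
  have hexp : ∀ s, Real.exp (-δ * s) = Real.exp (δ * η) * Real.exp (-δ * (η + s)) := fun s => by
    rw [← Real.exp_add]; ring_nf
  have hf : ∀ s, 0 ≤ s → |f s| ≤ B := fun s hs => by
    rw [abs_of_pos (mul_pos (Real.exp_pos _) (heatKernel_pos (by positivity) z)), hexp, mul_assoc]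
    exact mul_le_mul_of_nonneg_left (h (η + s) (by linarith) z).1 (Real.exp_pos _).le
  have hd : ∀ s, 0 ≤ s → HasDerivAt f (-δ * f s + Real.exp (-δ * s) * heatKernelDeriv d (η + s) z) s :=
    fun s hs => by
    have d1 : HasDerivAt (fun s : ℝ => Real.exp (-δ * s)) (Real.exp (-δ * s) * (-δ)) s := by
      simpa using ((hasDerivAt_id s).const_mul (-δ)).exp
    have d2 := (hasDerivAt_heatKernel (show 0 < η + s by positivity) z).comp_const_add η s
    refine (d1.mul d2).congr_deriv ?_
    simp only [f]
    ring
  have hdb : ∀ s, 0 ≤ s → |-δ * f s + Real.exp (-δ * s) * heatKernelDeriv d (η + s) z| ≤ (1 + δ) * B :=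
    fun s hs => by
    refine (abs_add_le _ _).trans ?_
    have h1 : |-δ * f s| ≤ δ * B := by
      rw [abs_mul, abs_neg, abs_of_pos hδ]
      gcongr
      exact hf s hs
    have h2 : |Real.exp (-δ * s) * heatKernelDeriv d (η + s) z| ≤ B := by
      rw [abs_mul, abs_of_pos (Real.exp_pos _), hexp, mul_assoc]
      exact mul_le_mul_of_nonneg_left (h (η + s) (by linarith) z).2 (Real.exp_pos _).le
    linarith
  have hf0 : f 0 = heatKernel d η z := by simp [f]
  have h1 : |f 0 - f σ| ≤ 2 * B :=
    (abs_sub _ _).trans (by linarith [hf 0 le_rfl, hf σ hσ.le])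
  have h2 : |f 0 - f σ| ≤ (1 + δ) * B * σ := by
    have := (convex_Ici (0 : ℝ)).norm_image_sub_le_of_norm_hasDerivWithin_le
      (fun s hs => (hd s hs).hasDerivWithinAt) (fun s hs => hdb s hs) hσ.le (le_refl (0 : ℝ))
    rw [zero_sub, norm_neg, Real.norm_of_nonneg hσ.le] at this
    exact this
  rw [← hf0]
  change |f 0 - f σ| ≤ _
  rcases le_total 1 σ with h3 | h3
  · rw [min_eq_left h3]
    calc _ ≤ 2 * B := h1
      _ ≤ (2 + δ) * B := by gcongr; linarith
      _ = _ := by rw [hB]; ring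
  · rw [min_eq_right h3]
    calc _ ≤ (1 + δ) * B * σ := h2
      _ ≤ (2 + δ) * B * σ := by gcongr; linarith
      _ = _ := by rw [hB]; ring

/-- The pairing with the smoothed symbols of order `< 2`, in terms of the heat orbit. -/
theorem integral_mul_fourier_smoothedSymbol {u : E d → ℂ} (hu : HasPolyGrowth u)
    (hm : Continuous u) {α : E d → ℝ} {x : E d} {δ ε : ℝ} (hδ : 0 < δ) (hε : 0 < ε)
    (h0 : 0 < α x / 2) (h1 : α x / 2 < 1) {A : ℂ} {h : ℝ → ℝ}
    (hh : ∀ τ, 0 < τ → ∫ y, u y * heatKernel d τ (x - y) = A * h τ) :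
    Integrable (fun y => u y * 𝓕 (smoothedSymbol α x δ ε) y) ∧
    ∫ y, u y * 𝓕 (smoothedSymbol α x δ ε) y =
      A * ((α x / 2 / Real.Gamma (1 - α x / 2) * ∫ σ in Ioi (0 : ℝ), (h (ε / (4 * Real.pi ^ 2)) -
        Real.exp (-δ * σ) * h (ε / (4 * Real.pi ^ 2) + σ)) * σ ^ (-1 - α x / 2) : ℝ) : ℂ) := by
  have hp := Real.pi_pos
  set a := α x / 2 with ha
  set η := ε / (4 * Real.pi ^ 2) with hη
  have hη0 : 0 < η := by positivity
  set c := a / Real.Gamma (1 - a) with hc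
  let K : E d → ℝ → ℝ := fun y σ => (heatKernel d η (x - y) - Real.exp (-δ * σ) *
        heatKernel d (η + σ) (x - y)) * σ ^ (-1 - a)
  have hFT : ∀ y, u y * 𝓕 (smoothedSymbol α x δ ε) y =
      c * ∫ σ in Ioi (0 : ℝ), u y * (K y σ : ℂ) := fun y => by
    rw [fourier_smoothedSymbol α x hδ hε h0 h1, integral_const_mul, integral_complex_ofReal,
      Complex.ofReal_mul]
    ring
  have hi : Integrable (Function.uncurry fun y σ => u y * (K y σ : ℂ))
      (volume.prod (volume.restrict (Ioi 0))) := by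
    obtain ⟨C, b, hC, hb, hK⟩ := exists_heatKernel_sub_le d hη0 hδ
    refine ((hu.integrable_mul_exp hm.aestronglyMeasurable x hb).mul_prod
      ((integrableOn_min_mul_rpow h0 h1).const_mul C)).mono' ?_ ?_
    · refine Measurable.aestronglyMeasurable ?_
      have m1 : Measurable fun p : E d × ℝ => heatKernel d η (x - p.1) :=
        ((continuous_heatKernel η).comp (by fun_prop)).measurable
      have m2 : Measurable fun p : E d × ℝ => heatKernel d (η + p.2) (x - p.1) :=
        measurable_heatKernel.comp (by fun_prop : Measurable fun p : E d × ℝ => (η + p.2, x - p.1))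
      have m3 : Measurable fun p : E d × ℝ => u p.1 := hm.measurable.comp measurable_fst
      refine m3.mul (Complex.measurable_ofReal.comp ?_)
      simp only [K]
      fun_prop
    · have hσ : ∀ᵐ p : E d × ℝ ∂(volume.prod (volume.restrict (Ioi 0))), 0 < p.2 :=
        Measure.quasiMeasurePreserving_snd.ae (ae_restrict_mem measurableSet_Ioi)
      filter_upwards [hσ] with p hσ
      simp only [Function.uncurry_def, K, norm_mul, Complex.norm_real, Real.norm_eq_abs]
      rw [abs_of_pos (Real.rpow_pos_of_pos hσ _)]
      calc _ ≤ ‖u p.1‖ * (C * min 1 p.2 * Real.exp (-b * ‖x - p.1‖) * p.2 ^ (-1 - a)) := by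
            gcongr
            exact hK p.2 hσ _
        _ = _ := by ring
  have hσ : ∀ σ, 0 < σ → ∫ y, u y * (K y σ : ℂ) =
      A * (((h η - Real.exp (-δ * σ) * h (η + σ)) * σ ^ (-1 - a) : ℝ) : ℂ) := fun σ hσ => by
    have e : ∀ y, u y * (K y σ : ℂ) = (σ ^ (-1 - a) : ℝ) * (u y * heatKernel d η (x - y) -
        (Real.exp (-δ * σ) : ℝ) * (u y * heatKernel d (η + σ) (x - y))) := fun y => by
      simp only [K]
      push_cast
      ring
    simp_rw [e]
    rw [integral_const_mul, integral_sub (integrable_mul_heatKernel hu hm.aestronglyMeasurable x hη0)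
      ((integrable_mul_heatKernel hu hm.aestronglyMeasurable x (by positivity)).const_mul _),
      integral_const_mul, hh η hη0, hh (η + σ) (by positivity)]
    push_cast
    ring
  simp_rw [hFT]
  refine ⟨hi.integral_prod_left.const_mul _, ?_⟩
  rw [integral_const_mul, integral_integral_swap hi,
    setIntegral_congr_fun measurableSet_Ioi fun σ => hσ σ, integral_const_mul,
    integral_complex_ofReal, Complex.ofReal_mul]
  ring

/-- The pseudo-differential form of order `< 2`: as `δ, ε ↓ 0`, the integral in
`integral_mul_fourier_smoothedSymbol` tends to the one that defines the fractional power. -/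
theorem hasPseudoDiffValue_of_lt {u : E d → ℂ} (hu : HasPolyGrowth u)
    (hm : Continuous u) {α : E d → ℝ} {x : E d} (h0 : 0 < α x / 2) (h1 : α x / 2 < 1)
    {A : ℂ} {h : ℝ → ℝ} {M c : ℝ}
    (hh : ∀ τ, 0 < τ → ∫ y, u y * heatKernel d τ (x - y) = A * h τ)
    (H : HasFracPower (α x / 2) M h c) : HasPseudoDiffValue α u x (A * c) := by
  have hp := Real.pi_pos
  refine ⟨fun δ ε hδ hε => (integral_mul_fourier_smoothedSymbol hu hm hδ hε h0 h1 hh).1, ?_⟩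
  have hpos : ∀ᶠ p : ℝ × ℝ in 𝓝[>] (0 : ℝ) ×ˢ 𝓝[>] (0 : ℝ), 0 < p.1 ∧ 0 < p.2 :=
    Filter.prod_mem_prod self_mem_nhdsWithin self_mem_nhdsWithin
  have hpos1 : ∀ᶠ p : ℝ × ℝ in 𝓝[>] (0 : ℝ) ×ˢ 𝓝[>] (0 : ℝ), p.1 < 1 :=
    tendsto_fst.eventually (nhdsWithin_le_nhds (Iio_mem_nhds one_pos))
  have hfst : Tendsto (fun p : ℝ × ℝ => p.1) (𝓝[>] (0 : ℝ) ×ˢ 𝓝[>] (0 : ℝ)) (𝓝 0) :=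
    tendsto_fst.mono_right nhdsWithin_le_nhds
  have hsnd : Tendsto (fun p : ℝ × ℝ => p.2 / (4 * Real.pi ^ 2))
      (𝓝[>] (0 : ℝ) ×ˢ 𝓝[>] (0 : ℝ)) (𝓝 0) := by
    have := (tendsto_snd (f := 𝓝[>] (0 : ℝ)) (g := 𝓝[>] (0 : ℝ))).mono_right nhdsWithin_le_nhds
    simpa using this.div_const (4 * Real.pi ^ 2)
  have hsnd' : Tendsto (fun p : ℝ × ℝ => p.2 / (4 * Real.pi ^ 2))
      (𝓝[>] (0 : ℝ) ×ˢ 𝓝[>] (0 : ℝ)) (𝓝[Ici 0] 0) := by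
    refine tendsto_nhdsWithin_iff.2 ⟨hsnd, ?_⟩
    filter_upwards [hpos] with p hp
    have := hp.2
    simp only [mem_Ici]
    positivity
  have key : Tendsto (fun p : ℝ × ℝ => ∫ σ in Ioi (0 : ℝ), (h (p.2 / (4 * Real.pi ^ 2)) -
        Real.exp (-p.1 * σ) * h (p.2 / (4 * Real.pi ^ 2) + σ)) * σ ^ (-1 - α x / 2))
      (𝓝[>] (0 : ℝ) ×ˢ 𝓝[>] (0 : ℝ))
      (𝓝 (∫ σ in Ioi (0 : ℝ), (h 0 - h σ) * σ ^ (-1 - α x / 2))) := by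
    refine tendsto_integral_filter_of_dominated_convergence
      (fun σ => 4 * M * (min 1 σ * σ ^ (-1 - α x / 2))) ?_ ?_
      ((integrableOn_min_mul_rpow h0 h1).const_mul _) ?_
    · filter_upwards [hpos] with p hp'
      have hη : 0 ≤ p.2 / (4 * Real.pi ^ 2) := div_nonneg hp'.2.le (by positivity)
      refine ContinuousOn.aestronglyMeasurable ?_ measurableSet_Ioi
      refine (continuousOn_const.sub ((by fun_prop : ContinuousOn _ _).mul
        (H.continuousOn.comp (by fun_prop) fun σ hσ => ?_))).mul ?_
      · exact add_nonneg hη (le_of_lt hσ)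
      · exact fun σ hσ =>
          (Real.continuousAt_rpow_const _ _ (Or.inl (ne_of_gt hσ))).continuousWithinAt
    · filter_upwards [hpos, hpos1] with p hp' hp1
      have hη : 0 ≤ p.2 / (4 * Real.pi ^ 2) := div_nonneg hp'.2.le (by positivity)
      refine (ae_restrict_iff' measurableSet_Ioi).2 (ae_of_all _ fun σ hσ => ?_)
      have hσ : 0 < σ := hσ
      set η := p.2 / (4 * Real.pi ^ 2)
      rw [norm_mul, Real.norm_of_nonneg (Real.rpow_pos_of_pos hσ _).le, ← mul_assoc]
      gcongr
      -- each of the two summands contributes `2 * M * min 1 σ`; the second one because `δ ≤ 1`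
      have e : h η - Real.exp (-p.1 * σ) * h (η + σ) =
          (h η - h (η + σ)) + (1 - Real.exp (-(p.1 * σ))) * h (η + σ) := by
        rw [neg_mul]; ring
      rw [e]
      refine (norm_add_le _ _).trans ?_
      rw [norm_mul]
      have b1 := H.abs_sub_le hη hσ.le
      have b2 := one_sub_exp_neg_le hp'.1.le hσ.le
      have b3 := H.bound (η + σ) (by positivity)
      have b4 : |1 - Real.exp (-(p.1 * σ))| * |h (η + σ)| ≤ (2 * min 1 σ) * M := by
        gcongr
        exact b2.trans (by gcongr; linarith)
      simp only [Real.norm_eq_abs]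
      linarith
    · refine (ae_restrict_iff' measurableSet_Ioi).2 (ae_of_all _ fun σ hσ => ?_)
      have hσ : 0 < σ := hσ
      have c1 := (H.continuousOn 0 self_mem_Ici).tendsto.comp hsnd'
      have c2 : Tendsto (fun p : ℝ × ℝ => h (p.2 / (4 * Real.pi ^ 2) + σ))
          (𝓝[>] (0 : ℝ) ×ˢ 𝓝[>] (0 : ℝ)) (𝓝 (h σ)) := by
        refine (H.diff σ hσ).continuousAt.tendsto.comp ?_
        simpa using hsnd.add_const σ
      have c3 : Tendsto (fun p : ℝ × ℝ => Real.exp (-p.1 * σ))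
          (𝓝[>] (0 : ℝ) ×ˢ 𝓝[>] (0 : ℝ)) (𝓝 1) := by
        have := (Real.continuous_exp.tendsto (-0 * σ)).comp (hfst.neg.mul_const σ)
        simpa [Function.comp_def] using this
      have := (c1.sub (c3.mul c2)).mul_const (σ ^ (-1 - α x / 2))
      rw [one_mul] at this
      exact this
  have := (((Complex.continuous_ofReal.tendsto _).comp
    (key.const_mul (α x / 2 / Real.Gamma (1 - α x / 2)))).const_mul A)
  rw [H.frac h1] at this
  refine this.congr' ?_
  filter_upwards [hpos] with p hp'
  rw [(integral_mul_fourier_smoothedSymbol hu hm hp'.1 hp'.2 h0 h1 hh).2]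
  rfl

/-- The Fourier transform of the smoothed symbol of order `2`. The factor `(2π|ξ|)²` comes from
the time derivative of the heat symbol. -/
theorem fourier_smoothedSymbol_two {α : E d → ℝ} {x : E d} {δ ε : ℝ} (hε : 0 < ε)
    (h1 : α x = 2) (y : E d) :
    𝓕 (smoothedSymbol α x δ ε) y = δ * heatKernel d (ε / (4 * Real.pi ^ 2)) (x - y) -
      heatKernelDeriv d (ε / (4 * Real.pi ^ 2)) (x - y) := by
  have hp := Real.pi_pos
  set η := ε / (4 * Real.pi ^ 2) with hη
  have hη0 : 0 < η := by positivity
  have e : ∀ ξ, 𝐞 (-⟪ξ, y⟫) • smoothedSymbol α x δ ε ξ = δ * (𝐞 (-⟪ξ, y⟫) • heatSymbol x η ξ) -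
      𝐞 (-⟪ξ, y⟫) • (-((2 * Real.pi * ‖ξ‖) ^ 2 : ℝ) * heatSymbol x η ξ) := fun ξ => by
    rw [smoothedSymbol_eq, h1, div_self two_ne_zero, Real.rpow_one]
    simp only [Circle.smul_def, smul_eq_mul]
    push_cast
    ring
  have hs : ∀ τ ξ, HasDerivAt (fun τ => heatSymbol x τ ξ)
      (-((2 * Real.pi * ‖ξ‖) ^ 2 : ℝ) * heatSymbol x τ ξ) τ := fun τ ξ => by
    have h2 : HasDerivAt (fun τ : ℝ => -((4 * Real.pi ^ 2 * τ : ℝ) : ℂ) * ‖ξ‖ ^ 2 +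
        2 * Real.pi * Complex.I * (⟪x, ξ⟫ : ℝ)) (-((2 * Real.pi * ‖ξ‖) ^ 2 : ℝ) : ℂ) τ := by
      have := ((((hasDerivAt_id τ).const_mul (4 * Real.pi ^ 2)).ofReal_comp.neg).mul_const
        ((‖ξ‖ : ℂ) ^ 2)).add_const (2 * Real.pi * Complex.I * (⟪x, ξ⟫ : ℝ))
      refine this.congr_deriv ?_
      push_cast
      ring
    refine h2.cexp.congr_deriv ?_
    rw [heatSymbol, mul_comm]
  have hD : Integrable (fun ξ => 𝐞 (-⟪ξ, y⟫) • (-((2 * Real.pi * ‖ξ‖) ^ 2 : ℝ) * heatSymbol x η ξ)) ∧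
      HasDerivAt (fun τ => ∫ ξ, 𝐞 (-⟪ξ, y⟫) • heatSymbol x τ ξ)
        (∫ ξ, 𝐞 (-⟪ξ, y⟫) • (-((2 * Real.pi * ‖ξ‖) ^ 2 : ℝ) * heatSymbol x η ξ)) η := by
    have hc : ∀ τ, Continuous (heatSymbol x τ) := fun τ =>
      (continuous_heatSymbol x).comp (Continuous.prodMk_right τ)
    have hn : Ioi (η / 2) ∈ 𝓝 η := Ioi_mem_nhds (by linarith)
    have b : 0 < 4 * Real.pi ^ 2 * (η / 2) := by positivity
    have hce : Continuous fun ξ : E d => (𝐞 (-⟪ξ, y⟫) : ℂ) :=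
      continuous_subtype_val.comp (Real.continuous_fourierChar.comp (by fun_prop))
    refine hasDerivAt_integral_of_dominated_loc_of_deriv_le
      (F := fun τ ξ => 𝐞 (-⟪ξ, y⟫) • heatSymbol x τ ξ)
      (F' := fun τ ξ => 𝐞 (-⟪ξ, y⟫) • (-((2 * Real.pi * ‖ξ‖) ^ 2 : ℝ) * heatSymbol x τ ξ))
      (bound := fun ξ => 4 * Real.pi ^ 2 *
        (‖ξ‖ ^ 2 * Real.exp (-(4 * Real.pi ^ 2 * (η / 2)) * ‖ξ‖ ^ 2))) hn ?_ ?_ ?_ ?_ ?_ ?_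
    · refine Eventually.of_forall fun τ => Continuous.aestronglyMeasurable ?_
      simp only [Circle.smul_def, smul_eq_mul]
      exact hce.mul (hc τ)
    · exact (Real.fourierIntegral_convergent_iff _).2 (integrable_heatSymbol x hη0)
    · refine Continuous.aestronglyMeasurable ?_
      simp only [Circle.smul_def, smul_eq_mul]
      have := hc η
      fun_prop
    · refine ae_of_all _ fun ξ τ hτ => ?_
      have hτ : η / 2 < τ := hτ
      rw [Circle.norm_smul, norm_mul, norm_neg, Complex.norm_real, norm_heatSymbol,
        Real.norm_of_nonneg (by positivity)]
      calc _ = 4 * Real.pi ^ 2 * (‖ξ‖ ^ 2 * Real.exp (-(4 * Real.pi ^ 2 * τ) * ‖ξ‖ ^ 2)) := by ring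
        _ ≤ _ := by gcongr
    · exact (integrable_norm_pow_mul_exp_neg_sq 2 b).const_mul _
    · refine ae_of_all _ fun ξ τ hτ => ?_
      simp only [Circle.smul_def, smul_eq_mul]
      exact (hs τ ξ).const_mul _
  have hD2 : HasDerivAt (fun τ => ∫ ξ, 𝐞 (-⟪ξ, y⟫) • heatSymbol x τ ξ)
      (heatKernelDeriv d η (x - y) : ℂ) η := by
    refine ((hasDerivAt_heatKernel hη0 (x - y)).ofReal_comp).congr_of_eventuallyEq ?_
    filter_upwards [lt_mem_nhds hη0] with τ hτ
    rw [← Real.fourier_eq, fourier_heatSymbol x hτ]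
  rw [Real.fourier_eq]
  simp_rw [e]
  rw [integral_sub (((Real.fourierIntegral_convergent_iff _).2
    (integrable_heatSymbol x hη0)).const_mul _) hD.1, integral_const_mul, ← Real.fourier_eq,
    fourier_heatSymbol x hη0, hD.2.unique hD2]

/-- The pseudo-differential form of order `2`: the pairing with the smoothed symbol is
`A (δ h(η) - h'(η))` with `η = ε / (4π²)`. -/
theorem hasPseudoDiffValue_of_eq_two {u : E d → ℂ} (hu : HasPolyGrowth u)
    (hm : Continuous u) {α : E d → ℝ} {x : E d} (h1 : α x = 2)
    {A : ℂ} {h : ℝ → ℝ} {M c : ℝ}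
    (hh : ∀ τ, 0 < τ → ∫ y, u y * heatKernel d τ (x - y) = A * h τ)
    (H : HasFracPower (α x / 2) M h c) : HasPseudoDiffValue α u x (A * c) := by
  have hp := Real.pi_pos
  have hm' := hm.aestronglyMeasurable (μ := volume)
  have hval : ∀ δ ε : ℝ, 0 < ε → Integrable (fun y => u y * 𝓕 (smoothedSymbol α x δ ε) y) ∧
      ∫ y, u y * 𝓕 (smoothedSymbol α x δ ε) y = δ * (A * h (ε / (4 * Real.pi ^ 2))) -
        A * deriv h (ε / (4 * Real.pi ^ 2)) := fun δ ε hε => by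
    have hη0 : 0 < ε / (4 * Real.pi ^ 2) := by positivity
    set η := ε / (4 * Real.pi ^ 2) with hη
    have i1 := (integrable_mul_heatKernel hu hm' x hη0).const_mul (δ : ℂ)
    obtain ⟨i2, hd⟩ := hasDerivAt_integral_mul_heatKernel hu hm' x hη0
    have hd2 : HasDerivAt (fun τ => ∫ y, u y * heatKernel d τ (x - y)) (A * (deriv h η : ℝ)) η := by
      refine ((H.diff η hη0).hasDerivAt.ofReal_comp.const_mul A).congr_of_eventuallyEq ?_
      filter_upwards [lt_mem_nhds hη0] with τ hτ using hh τ hτ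
    have e : ∀ y, u y * 𝓕 (smoothedSymbol α x δ ε) y = δ * (u y * heatKernel d η (x - y)) -
        u y * heatKernelDeriv d η (x - y) := fun y => by
      rw [fourier_smoothedSymbol_two hε h1]
      ring
    simp_rw [e]
    refine ⟨i1.sub i2, ?_⟩
    rw [integral_sub i1 i2, integral_const_mul, hh η hη0, hd.unique hd2]
  refine ⟨fun δ ε hδ hε => (hval δ ε hε).1, ?_⟩
  have hpos : ∀ᶠ p : ℝ × ℝ in 𝓝[>] (0 : ℝ) ×ˢ 𝓝[>] (0 : ℝ), 0 < p.2 :=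
    tendsto_snd.eventually self_mem_nhdsWithin
  have hfst : Tendsto (fun p : ℝ × ℝ => (p.1 : ℂ)) (𝓝[>] (0 : ℝ) ×ˢ 𝓝[>] (0 : ℝ)) (𝓝 (0 : ℝ)) :=
    (Complex.continuous_ofReal.tendsto 0).comp (tendsto_fst.mono_right nhdsWithin_le_nhds)
  have hsnd : Tendsto (fun p : ℝ × ℝ => p.2 / (4 * Real.pi ^ 2))
      (𝓝[>] (0 : ℝ) ×ˢ 𝓝[>] (0 : ℝ)) (𝓝[>] 0) := by
    refine tendsto_nhdsWithin_iff.2 ⟨?_, ?_⟩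
    · have := (tendsto_snd (f := 𝓝[>] (0 : ℝ)) (g := 𝓝[>] (0 : ℝ))).mono_right nhdsWithin_le_nhds
      simpa using this.div_const (4 * Real.pi ^ 2)
    · filter_upwards [hpos] with p hp
      simp only [mem_Ioi]
      positivity
  have c1 := (((H.continuousOn 0 self_mem_Ici).mono Ioi_subset_Ici_self).tendsto.comp hsnd)
  have c2 := (H.infinitesimal (by rw [h1]; norm_num)).comp hsnd
  have c1' := (Complex.continuous_ofReal.tendsto _).comp c1
  have c2' := (Complex.continuous_ofReal.tendsto _).comp c2
  have := (hfst.mul (c1'.const_mul A)).sub (c2'.const_mul A)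
  have e : ((0 : ℝ) : ℂ) * (A * (h 0 : ℝ)) - A * ((-c : ℝ) : ℂ) = A * c := by
    push_cast; ring
  rw [e] at this
  refine this.congr' ?_
  filter_upwards [hpos] with p hp'
  rw [(hval p.1 p.2 hp').2]
  rfl

/-! ### The heat flow of polynomials -/

theorem heatKernel_quarter (z : E d) :
    heatKernel d (1 / 4) z = Real.pi ^ (-(d : ℝ) / 2) * Real.exp (-‖z‖ ^ 2) := by
  rw [heatKernel]
  ring_nf

theorem integral_heatKernel_quarter : ∫ z : E d, heatKernel d (1 / 4) z = 1 := by
  have hp := Real.pi_pos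
  have h := GaussianFourier.integral_rexp_neg_mul_sq_norm (V := E d) one_pos
  simp only [neg_mul, one_mul, div_one, finrank_euclideanSpace, Fintype.card_fin] at h
  simp_rw [heatKernel_quarter, integral_const_mul, h]
  rw [neg_div, Real.rpow_neg hp.le, inv_mul_cancel₀ (by positivity)]

/-- The heat flow at time `τ`, rescaled to the heat kernel at the fixed time `1 / 4`. -/
theorem integral_mul_heatKernel_eq (u : E d → ℂ) (x : E d) {τ : ℝ} (hτ : 0 < τ) :
    ∫ y, u y * heatKernel d τ (x - y) =
      ∫ z, u (x + (2 * Real.sqrt τ) • z) * heatKernel d (1 / 4) z := by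
  have hp := Real.pi_pos
  obtain ⟨s, hs⟩ : ∃ s, s = 2 * Real.sqrt τ := ⟨_, rfl⟩
  rw [← hs]
  have hs0 : 0 < s := by rw [hs]; positivity
  have hs2 : s ^ 2 = 4 * τ := by rw [hs, mul_pow, Real.sq_sqrt hτ.le]; norm_num
  have hscale : ∀ z : E d, heatKernel d (1 / 4) z = s ^ d * heatKernel d τ (s • z) := fun z => by
    rw [heatKernel_quarter, heatKernel, norm_smul, mul_pow, Real.norm_of_nonneg hs0.le, hs2,
      show 4 * Real.pi * τ = s ^ 2 * Real.pi by rw [hs2]; ring,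
      Real.mul_rpow (by positivity) hp.le, ← Real.rpow_natCast s 2, ← Real.rpow_mul hs0.le,
      show ((2 : ℕ) : ℝ) * (-(d : ℝ) / 2) = -(d : ℝ) by push_cast; ring, Real.rpow_neg hs0.le,
      Real.rpow_natCast]
    rw [show -(4 * τ * ‖z‖ ^ 2) / (4 * τ) = -‖z‖ ^ 2 by field_simp]
    field_simp
  calc ∫ y, u y * heatKernel d τ (x - y) = ∫ y, u (x + y) * heatKernel d τ y := by
        rw [← integral_add_left_eq_self (fun y => u y * (heatKernel d τ (x - y) : ℂ)) x]
        refine integral_congr_ae (ae_of_all _ fun y => ?_)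
        simp only
        rw [← heatKernel_neg τ y]
        congr 3
        abel
    _ = s ^ d * ∫ z, u (x + s • z) * heatKernel d τ (s • z) := by
        have := Measure.integral_comp_smul_of_nonneg (volume : Measure (E d))
          (fun y => u (x + y) * (heatKernel d τ y : ℂ)) s (hR := hs0.le)
        rw [this, finrank_euclideanSpace_fin, Complex.real_smul, ← mul_assoc, Complex.ofReal_inv,
          Complex.ofReal_pow, mul_inv_cancel₀ (by simp [hs0.ne']), one_mul]
    _ = _ := by
        rw [← integral_const_mul]
        refine integral_congr_ae (ae_of_all _ fun z => ?_)
        simp only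
        rw [hscale]
        push_cast
        ring

theorem HasPolyGrowth.const (c : ℂ) : HasPolyGrowth fun _ : E d => c :=
  ⟨‖c‖, 0, by simp⟩

theorem HasPolyGrowth.mul {u v : E d → ℂ} (hu : HasPolyGrowth u) (hv : HasPolyGrowth v) :
    HasPolyGrowth fun y => u y * v y := by
  obtain ⟨C, k, h⟩ := hu
  obtain ⟨C', k', h'⟩ := hv
  refine ⟨C * C', k + k', fun y => ?_⟩
  rw [norm_mul, pow_add]
  calc _ ≤ (C * (1 + ‖y‖) ^ k) * (C' * (1 + ‖y‖) ^ k') :=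
        mul_le_mul (h y) (h' y) (norm_nonneg _) ((norm_nonneg _).trans (h y))
    _ = _ := by ring

theorem HasPolyGrowth.add {u v : E d → ℂ} (hu : HasPolyGrowth u) (hv : HasPolyGrowth v) :
    HasPolyGrowth fun y => u y + v y := by
  obtain ⟨C, k, h⟩ := hu
  obtain ⟨C', k', h'⟩ := hv
  have hC : 0 ≤ C := by simpa using (norm_nonneg _).trans (h 0)
  have hC' : 0 ≤ C' := by simpa using (norm_nonneg _).trans (h' 0)
  refine ⟨C + C', max k k', fun y => (norm_add_le _ _).trans ?_⟩
  rw [add_mul]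
  have h1 : 1 ≤ 1 + ‖y‖ := by linarith [norm_nonneg y]
  refine add_le_add ((h y).trans ?_) ((h' y).trans ?_)
  · gcongr; exact le_max_left _ _
  · gcongr; exact le_max_right _ _

theorem HasPolyGrowth.of_le {u : E d → ℂ} {v : E d → ℂ} (hv : HasPolyGrowth v)
    (h : ∀ y, ‖u y‖ ≤ ‖v y‖) : HasPolyGrowth u := by
  obtain ⟨C, k, h'⟩ := hv
  exact ⟨C, k, fun y => (h y).trans (h' y)⟩

theorem HasPolyGrowth.coord (i : Fin d) : HasPolyGrowth fun y : E d => (y i : ℂ) := by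
  refine ⟨1, 1, fun y => ?_⟩
  have : ‖(y i : ℂ)‖ ≤ ‖y‖ := by
    rw [Complex.norm_real]
    exact PiLp.norm_apply_le y i
  linarith

/-- Polynomial growth of `z ↦ u (x + s z)`, uniformly for `s` in a bounded set. -/
theorem HasPolyGrowth.comp_affine {u : E d → ℂ} (hu : HasPolyGrowth u) (x : E d) (R : ℝ) :
    ∃ (C : ℝ) (k : ℕ), 0 ≤ C ∧ ∀ s : ℝ, |s| ≤ R → ∀ z, ‖u (x + s • z)‖ ≤ C * (1 + ‖z‖) ^ k := by
  obtain ⟨C, k, h⟩ := hu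
  have hC : 0 ≤ C := by simpa using (norm_nonneg _).trans (h 0)
  refine ⟨C * (1 + ‖x‖ + |R|) ^ k, k, by positivity, fun s hs z => (h _).trans ?_⟩
  rw [mul_assoc, ← mul_pow]
  gcongr
  have h1 : ‖x + s • z‖ ≤ ‖x‖ + |R| * ‖z‖ := by
    refine (norm_add_le _ _).trans ?_
    rw [norm_smul, Real.norm_eq_abs]
    have := hs.trans (le_abs_self R)
    gcongr
  nlinarith [mul_nonneg (norm_nonneg x) (norm_nonneg z), abs_nonneg R, norm_nonneg z]

theorem hasPolyGrowth_polyVal (p : MvPolynomial (Fin d) ℂ) : HasPolyGrowth (polyVal p) := by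
  induction p using MvPolynomial.induction_on with
  | C a => exact (HasPolyGrowth.const a).of_le fun y => by simp [polyVal]
  | add p q hp hq => exact (hp.add hq).of_le fun y => by simp [polyVal]
  | mul_X p i hp => exact (hp.mul (HasPolyGrowth.coord i)).of_le fun y => by simp [polyVal]

theorem hasFDerivAt_polyVal (p : MvPolynomial (Fin d) ℂ) (x : E d) :
    HasFDerivAt (polyVal p) (∑ i, polyVal (MvPolynomial.pderiv i p) x •
      (Complex.ofRealCLM.comp (EuclideanSpace.proj i : E d →L[ℝ] ℝ))) x := by
  induction p using MvPolynomial.induction_on with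
  | C a =>
    refine ((hasFDerivAt_const a x).congr_fderiv ?_).congr_of_eventuallyEq
      (Eventually.of_forall fun y => ?_)
    · ext v
      simp [polyVal]
    · simp [polyVal]
  | add p q hp hq =>
    refine ((hp.add hq).congr_fderiv ?_).congr_of_eventuallyEq (Eventually.of_forall fun y => ?_)
    · ext v
      simp [polyVal, add_mul, Finset.sum_add_distrib]
    · simp [polyVal]
  | mul_X p j hp =>
    have hj : HasFDerivAt (fun y : E d => (y j : ℂ))
        (Complex.ofRealCLM.comp (EuclideanSpace.proj j : E d →L[ℝ] ℝ)) x :=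
      (Complex.ofRealCLM.comp (EuclideanSpace.proj j : E d →L[ℝ] ℝ)).hasFDerivAt
    refine ((hp.mul hj).congr_fderiv ?_).congr_of_eventuallyEq (Eventually.of_forall fun y => ?_)
    · ext v
      simp [polyVal, add_mul, Finset.sum_add_distrib, Finset.mul_sum, MvPolynomial.pderiv_X,
        Pi.single_apply, apply_ite, mul_assoc]
    · simp [polyVal]

theorem continuous_polyVal (p : MvPolynomial (Fin d) ℂ) : Continuous (polyVal p) :=
  continuous_iff_continuousAt.2 fun x => (hasFDerivAt_polyVal p x).continuousAt

theorem integrable_mul_heatKernel_quarter {u : E d → ℂ} (hu : HasPolyGrowth u) (hm : Continuous u) :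
    Integrable (fun z => u z * heatKernel d (1 / 4) z) := by
  have := integrable_mul_heatKernel hu hm.aestronglyMeasurable 0 (show (0 : ℝ) < 1 / 4 by norm_num)
  simpa [heatKernel_neg] using this

theorem HasPolyGrowth.comp_add_smul {u : E d → ℂ} (hu : HasPolyGrowth u) (x : E d) (s : ℝ) :
    HasPolyGrowth fun z => u (x + s • z) := by
  obtain ⟨C, k, -, h⟩ := hu.comp_affine x |s|
  exact ⟨C, k, h s le_rfl⟩

/-- Gaussian integration by parts (Stein's lemma) for polynomials. -/
theorem integral_coord_mul_polyVal (p : MvPolynomial (Fin d) ℂ) (i : Fin d) (x : E d) (s : ℝ) :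
    ∫ z, (z i : ℂ) * polyVal p (x + s • z) * heatKernel d (1 / 4) z =
      s / 2 * ∫ z, polyVal (MvPolynomial.pderiv i p) (x + s • z) * heatKernel d (1 / 4) z := by
  let f : E d → ℂ := fun z => polyVal p (x + s • z)
  let g : E d → ℂ := fun z => heatKernel d (1 / 4) z
  let v : E d := EuclideanSpace.single i 1
  have hf : ∀ z, HasFDerivAt f ((∑ i, polyVal (MvPolynomial.pderiv i p) (x + s • z) •
      (Complex.ofRealCLM.comp (EuclideanSpace.proj i : E d →L[ℝ] ℝ))).comp
        (s • ContinuousLinearMap.id ℝ (E d))) z := fun z => by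
    have h : HasFDerivAt (fun z : E d => x + s • z) (s • ContinuousLinearMap.id ℝ (E d)) z :=
      ((hasFDerivAt_id z).const_smul s).const_add x
    exact (hasFDerivAt_polyVal p (x + s • z)).comp z h
  have hg : ∀ z, HasFDerivAt g (Complex.ofRealCLM.comp
      ((-2 * heatKernel d (1 / 4) z) • innerSL ℝ z)) z := fun z => by
    have h1 : HasFDerivAt (heatKernel d (1 / 4)) ((-2 * heatKernel d (1 / 4) z) • innerSL ℝ z) z := by
      have h2 := ((hasStrictFDerivAt_norm_sq z).hasFDerivAt.neg.exp).const_mul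
        (Real.pi ^ (-(d : ℝ) / 2))
      refine (h2.congr_fderiv ?_).congr_of_eventuallyEq (Eventually.of_forall heatKernel_quarter)
      ext w
      simp only [heatKernel_quarter]
      simp
      ring
    exact Complex.ofRealCLM.hasFDerivAt.comp z h1
  have hfv : ∀ z, fderiv ℝ f z v = s * polyVal (MvPolynomial.pderiv i p) (x + s • z) := fun z => by
    rw [(hf z).fderiv]
    simp [v, apply_ite, mul_comm]
  have hgv : ∀ z, fderiv ℝ g z v = -2 * z i * heatKernel d (1 / 4) z := fun z => by
    rw [(hg z).fderiv]
    simp [v, EuclideanSpace.inner_single_right]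
    ring
  have ip : ∀ q : MvPolynomial (Fin d) ℂ, HasPolyGrowth fun z => polyVal q (x + s • z) := fun q =>
    (hasPolyGrowth_polyVal q).comp_add_smul x s
  have cp : ∀ q : MvPolynomial (Fin d) ℂ, Continuous fun z => polyVal q (x + s • z) := fun q =>
    (continuous_polyVal q).comp (by fun_prop)
  have cz : Continuous fun z : E d => (z i : ℂ) := by fun_prop
  have key := integral_mul_fderiv_eq_neg_fderiv_mul_of_integrable (f := f) (g := g) (v := v)
    (μ := volume) ?_ ?_ ?_ (fun z _ => (hf z).differentiableAt) (fun z _ => (hg z).differentiableAt)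
  · simp only [hfv, hgv] at key
    have e1 : ∀ z, f z * (-2 * z i * (heatKernel d (1 / 4) z : ℂ)) =
        -2 * ((z i : ℂ) * polyVal p (x + s • z) * heatKernel d (1 / 4) z) := fun z => by
      simp only [f]; ring
    have e2 : ∀ z, s * polyVal (MvPolynomial.pderiv i p) (x + s • z) * g z =
        s * (polyVal (MvPolynomial.pderiv i p) (x + s • z) * heatKernel d (1 / 4) z) := fun z => by
      simp only [g]; ring
    simp_rw [e1, e2, integral_const_mul] at key
    linear_combination -(1 / 2) * key
  · simp only [hfv]
    exact integrable_mul_heatKernel_quarter ((HasPolyGrowth.const _).mul (ip _))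
      (continuous_const.mul (cp _))
  · simp only [hgv]
    have := integrable_mul_heatKernel_quarter
      ((ip p).mul ((HasPolyGrowth.const (-2)).mul (HasPolyGrowth.coord i)))
      ((cp p).mul (continuous_const.mul cz))
    refine this.congr (ae_of_all _ fun z => ?_)
    simp only [f]
    ring
  · exact integrable_mul_heatKernel_quarter (ip p) (cp p)

/-- The Laplacian of a polynomial. -/
noncomputable def polyLaplacian (p : MvPolynomial (Fin d) ℂ) : MvPolynomial (Fin d) ℂ :=
  ∑ i, MvPolynomial.pderiv i (MvPolynomial.pderiv i p)

/-- The heat equation for polynomials, in terms of `s = 2√τ`. -/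
theorem hasDerivAt_integral_polyVal (p : MvPolynomial (Fin d) ℂ) (x : E d) (s : ℝ) :
    HasDerivAt (fun s : ℝ => ∫ z, polyVal p (x + s • z) * heatKernel d (1 / 4) z)
      (s / 2 * ∫ z, polyVal (polyLaplacian p) (x + s • z) * heatKernel d (1 / 4) z) s := by
  have cp : ∀ (q : MvPolynomial (Fin d) ℂ) (s : ℝ), Continuous fun z => polyVal q (x + s • z) :=
    fun q s => (continuous_polyVal q).comp (by fun_prop)
  have ip : ∀ (q : MvPolynomial (Fin d) ℂ) (s : ℝ), HasPolyGrowth fun z => polyVal q (x + s • z) :=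
    fun q s => (hasPolyGrowth_polyVal q).comp_add_smul x s
  have cz : ∀ i, Continuous fun z : E d => (z i : ℂ) := fun i => by fun_prop
  have ck : Continuous fun z : E d => (heatKernel d (1 / 4) z : ℂ) :=
    Complex.continuous_ofReal.comp (continuous_heatKernel _)
  let G : ℝ → E d → ℂ := fun s z => ∑ i, (z i : ℂ) * polyVal (MvPolynomial.pderiv i p) (x + s • z)
  have hG : ∫ z, G s z * heatKernel d (1 / 4) z =
      s / 2 * ∫ z, polyVal (polyLaplacian p) (x + s • z) * heatKernel d (1 / 4) z := by
    have e : ∀ z, polyVal (polyLaplacian p) (x + s • z) * heatKernel d (1 / 4) z =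
        ∑ i, polyVal (MvPolynomial.pderiv i (MvPolynomial.pderiv i p)) (x + s • z) *
          (heatKernel d (1 / 4) z : ℂ) := fun z => by
      rw [← Finset.sum_mul, polyVal, polyLaplacian, map_sum]
      rfl
    simp_rw [e, G, Finset.sum_mul]
    rw [integral_finsetSum _ fun i _ => integrable_mul_heatKernel_quarter
        ((HasPolyGrowth.coord i).mul (ip _ s)) ((cz i).mul (cp _ s)),
      integral_finsetSum _ fun i _ => integrable_mul_heatKernel_quarter (ip _ s) (cp _ s),
      Finset.mul_sum]
    exact Finset.sum_congr rfl fun i _ => integral_coord_mul_polyVal _ i x s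
  have hbd : ∃ (C : ℝ) (k : ℕ), ∀ r : ℝ, |r| ≤ |s| + 1 → ∀ z, ‖G r z‖ ≤ C * (1 + ‖z‖) ^ k := by
    choose C k hC h using fun i =>
      (hasPolyGrowth_polyVal (MvPolynomial.pderiv i p)).comp_affine x (|s| + 1)
    refine ⟨∑ i, C i, ∑ i, (k i + 1), fun r hr z => ?_⟩
    rw [Finset.sum_mul]
    refine (norm_sum_le _ _).trans (Finset.sum_le_sum fun i hi => ?_)
    have h1 : ‖(z i : ℂ)‖ ≤ 1 + ‖z‖ := by
      rw [Complex.norm_real]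
      exact (PiLp.norm_apply_le z i).trans (by linarith)
    calc _ ≤ (1 + ‖z‖) * (C i * (1 + ‖z‖) ^ k i) := by
          rw [norm_mul]
          gcongr
          exact h i r hr z
      _ = C i * (1 + ‖z‖) ^ (k i + 1) := by ring
      _ ≤ _ := by
        refine mul_le_mul_of_nonneg_left ?_ (hC i)
        refine pow_le_pow_right₀ (by linarith [norm_nonneg z]) ?_
        exact Finset.single_le_sum (f := fun i => k i + 1) (fun _ _ => Nat.zero_le _) hi
  obtain ⟨C, k, hb⟩ := hbd
  rw [← hG]
  have hn : Metric.ball s 1 ∈ 𝓝 s := Metric.ball_mem_nhds s one_pos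
  have hi : Integrable (fun z : E d => C * (1 + ‖z‖) ^ k * heatKernel d (1 / 4) z) := by
    have hC : 0 ≤ C := by simpa using (norm_nonneg _).trans (hb s (by linarith) 0)
    have : HasPolyGrowth fun z : E d => ((C * (1 + ‖z‖) ^ k : ℝ) : ℂ) := ⟨C, k, fun y => by
        rw [Complex.norm_real, Real.norm_of_nonneg (mul_nonneg hC (by positivity))]⟩
    have := (integrable_mul_heatKernel_quarter this
      (Complex.continuous_ofReal.comp (by fun_prop))).norm
    refine this.congr (ae_of_all _ fun z => ?_)
    simp only
    rw [norm_mul, Complex.norm_real, Complex.norm_real,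
      Real.norm_of_nonneg (mul_nonneg hC (by positivity)),
      Real.norm_of_nonneg (heatKernel_pos (by norm_num) z).le]
  refine (hasDerivAt_integral_of_dominated_loc_of_deriv_le
    (F := fun (s : ℝ) z => polyVal p (x + s • z) * (heatKernel d (1 / 4) z : ℂ))
    (F' := fun s z => G s z * (heatKernel d (1 / 4) z : ℂ)) hn
    (Eventually.of_forall fun r => ((cp p r).mul ck).aestronglyMeasurable)
    (integrable_mul_heatKernel_quarter (ip p s) (cp p s)) ?_
    (ae_of_all _ fun z r hr => ?_) hi (ae_of_all _ fun z r _ => ?_)).2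
  · refine Continuous.aestronglyMeasurable (Continuous.mul ?_ ck)
    exact continuous_finsetSum _ fun i _ => (cz i).mul (cp _ s)
  · rw [norm_mul, Complex.norm_real, Real.norm_of_nonneg (heatKernel_pos (by norm_num) z).le]
    have hr' : |r| ≤ |s| + 1 := by
      rw [Metric.mem_ball, Real.dist_eq] at hr
      have := abs_sub_abs_le_abs_sub r s
      linarith
    have := heatKernel_pos (show (0 : ℝ) < 1 / 4 by norm_num) z
    gcongr
    exact hb r hr' z
  · have h1 : HasDerivAt (fun r : ℝ => x + r • z) z r := by
      simpa using ((hasDerivAt_id r).smul_const z).const_add x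
    refine (((hasFDerivAt_polyVal p (x + r • z)).comp_hasDerivAt r h1).mul_const _).congr_deriv ?_
    simp [G, mul_comm]

/-- If `Δ p₀ = 0` and `Δ pₙ₊₁ = pₙ`, then the heat flow of `pₙ` is `∑ₖ τ^(n-k) / (n-k)! * pₖ`. -/
theorem integral_polyVal_tower {p : ℕ → MvPolynomial (Fin d) ℂ} (h0 : polyLaplacian (p 0) = 0)
    (hs : ∀ n, polyLaplacian (p (n + 1)) = p n) (n : ℕ) (x : E d) (s : ℝ) :
    ∫ z, polyVal (p n) (x + s • z) * heatKernel d (1 / 4) z =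
      ∑ k ∈ Finset.range (n + 1), (s ^ 2 / 4) ^ k / k.factorial * polyVal (p (n - k)) x := by
  have hz : ∀ q : MvPolynomial (Fin d) ℂ,
      ∫ z, polyVal q (x + (0 : ℝ) • z) * heatKernel d (1 / 4) z = polyVal q x := fun q => by
    simp only [zero_smul, add_zero]
    rw [integral_const_mul, integral_complex_ofReal, integral_heatKernel_quarter]
    simp
  induction n generalizing s with
  | zero =>
    have hd : ∀ s, HasDerivAt (fun s : ℝ => ∫ z, polyVal (p 0) (x + s • z) * heatKernel d (1 / 4) z)
        0 s := fun s => by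
      have := hasDerivAt_integral_polyVal (p 0) x s
      rw [h0] at this
      simpa [polyVal] using this
    have := is_const_of_deriv_eq_zero (fun s => (hd s).differentiableAt) (fun s => (hd s).deriv) s 0
    rw [hz] at this
    rw [this]
    simp
  | succ n ih =>
    let f : ℝ → ℂ := fun s => (∫ z, polyVal (p (n + 1)) (x + s • z) * heatKernel d (1 / 4) z) -
      ∑ k ∈ Finset.range (n + 1 + 1), ((s : ℂ) ^ 2 / 4) ^ k / k.factorial * polyVal (p (n + 1 - k)) x
    have hd : ∀ s, HasDerivAt f 0 s := fun s => by
      have h1 := hasDerivAt_integral_polyVal (p (n + 1)) x s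
      rw [hs, ih] at h1
      have h2 : ∀ k, HasDerivAt (fun s : ℝ => ((s : ℂ) ^ 2 / 4) ^ (k + 1) / (k + 1).factorial *
          polyVal (p (n + 1 - (k + 1))) x)
          (s / 2 * ((s ^ 2 / 4) ^ k / k.factorial * polyVal (p (n - k)) x)) s := fun k => by
        have h3 : HasDerivAt (fun s : ℝ => (s : ℂ)) 1 s := Complex.ofRealCLM.hasDerivAt
        have := ((((h3.pow 2).div_const 4).pow (k + 1)).div_const
          ((k + 1).factorial : ℂ)).mul_const (polyVal (p (n + 1 - (k + 1))) x)
        refine this.congr_deriv ?_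
        rw [Nat.factorial_succ, Nat.succ_sub_succ]
        have h4 : (k.factorial : ℂ) ≠ 0 := Nat.cast_ne_zero.2 (Nat.factorial_ne_zero k)
        have h5 : (k + 1 : ℂ) ≠ 0 := Nat.cast_add_one_ne_zero k
        simp only [Pi.pow_apply]
        push_cast
        field_simp
        norm_num
        ring
      have h3 := HasDerivAt.fun_sum (u := Finset.range (n + 1)) fun k _ => h2 k
      rw [← Finset.mul_sum] at h3
      have h4 := (h1.sub (h3.add_const (polyVal (p (n + 1)) x)))
      rw [sub_self] at h4
      refine h4.congr_of_eventuallyEq (Eventually.of_forall fun s => ?_)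
      simp only [f, Pi.sub_apply]
      rw [Finset.sum_range_succ']
      simp
    have := is_const_of_deriv_eq_zero (fun s => (hd s).differentiableAt) (fun s => (hd s).deriv) s 0
    have hf0 : f 0 = 0 := by
      simp only [f]
      rw [hz, Finset.sum_range_succ', sub_eq_zero]
      simp
    rw [hf0] at this
    exact sub_eq_zero.1 this

/-! ### The heat flow of solid harmonics times radial functions -/

theorem polyVal_smul {V : MvPolynomial (Fin d) ℂ} {l : ℕ} (hV : V.IsHomogeneous l) (c : ℝ)
    (x : E d) : polyVal V (c • x) = (c : ℂ) ^ l * polyVal V x := by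
  simp only [polyVal, MvPolynomial.eval_eq, Finset.mul_sum]
  refine Finset.sum_congr rfl fun m hm => ?_
  have hd : m.degree = l := by
    rw [Finsupp.degree_eq_weight_one]
    exact hV (MvPolynomial.mem_support_iff.1 hm)
  simp only [PiLp.smul_apply, smul_eq_mul, Complex.ofReal_mul, mul_pow, Finset.prod_mul_distrib,
    Finset.prod_pow_eq_pow_sum]
  rw [← hd, Finsupp.degree_apply]
  ring

/-- The polynomial `|x|²`. -/
noncomputable def normSqPoly (d : ℕ) : MvPolynomial (Fin d) ℂ :=
  ∑ i, MvPolynomial.X i ^ 2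

theorem polyVal_normSqPoly (x : E d) : polyVal (normSqPoly d) x = (‖x‖ : ℂ) ^ 2 := by
  rw [← Complex.ofReal_pow, EuclideanSpace.real_norm_sq_eq]
  simp [polyVal, normSqPoly]

theorem isHomogeneous_normSqPoly : (normSqPoly d).IsHomogeneous 2 :=
  MvPolynomial.IsHomogeneous.sum _ _ _ fun i _ => MvPolynomial.isHomogeneous_X_pow i 2

theorem pderiv_normSqPoly (i : Fin d) :
    MvPolynomial.pderiv i (normSqPoly d) = 2 * MvPolynomial.X i := by
  rw [normSqPoly, map_sum, Finset.sum_eq_single i]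
  · simp
  · intro j _ hj
    simp [Derivation.leibniz_pow, MvPolynomial.pderiv_X_of_ne hj]
  · simp

/-- The Leibniz rule for `Δ(p |x|²)`, with the mixed term given by Euler's identity. -/
theorem polyLaplacian_mul_normSqPoly {p : MvPolynomial (Fin d) ℂ} {n : ℕ}
    (hp : p.IsHomogeneous n) :
    polyLaplacian (p * normSqPoly d) =
      polyLaplacian p * normSqPoly d + (4 * n + 2 * d : ℂ) • p := by
  have h : ∀ i, MvPolynomial.pderiv i (MvPolynomial.pderiv i (p * normSqPoly d)) =
      MvPolynomial.pderiv i (MvPolynomial.pderiv i p) * normSqPoly d +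
      (4 * (MvPolynomial.X i * MvPolynomial.pderiv i p) + 2 * p) := fun i => by
    have h2 : MvPolynomial.pderiv i (2 : MvPolynomial (Fin d) ℂ) = 0 := by
      simpa using (MvPolynomial.pderiv i : Derivation ℂ (MvPolynomial (Fin d) ℂ) _).map_natCast 2
    simp only [Derivation.leibniz, pderiv_normSqPoly, smul_eq_mul, map_add,
      MvPolynomial.pderiv_X_self, h2]
    ring
  have he := hp.sum_X_mul_pderiv
  simp_rw [polyLaplacian, h, Finset.sum_add_distrib, ← Finset.sum_mul, ← Finset.mul_sum, he]
  simp only [Finset.sum_const, Finset.card_univ, Fintype.card_fin, nsmul_eq_mul, add_smul,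
    MvPolynomial.smul_eq_C_mul, map_mul, map_natCast, map_ofNat]
  ring

theorem isHomogeneous_mul_normSqPoly_pow {V : MvPolynomial (Fin d) ℂ} {l : ℕ}
    (hV : V.IsHomogeneous l) (n : ℕ) : (V * normSqPoly d ^ n).IsHomogeneous (l + 2 * n) :=
  hV.mul (isHomogeneous_normSqPoly.pow n)

theorem polyLaplacian_mul_normSqPoly_pow {V : MvPolynomial (Fin d) ℂ} {l : ℕ}
    (hV : IsSolidHarmonic V l) (n : ℕ) :
    polyLaplacian (V * normSqPoly d ^ (n + 1)) =
      (4 * (n + 1) * (n + ((d : ℝ) / 2 + l : ℝ)) : ℂ) • (V * normSqPoly d ^ n) := by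
  induction n with
  | zero =>
    have h0 : polyLaplacian V = 0 := hV.2
    rw [zero_add, pow_one, polyLaplacian_mul_normSqPoly hV.1, h0]
    simp only [zero_mul, zero_add, pow_zero, mul_one, Nat.cast_zero]
    congr 1
    push_cast
    ring
  | succ n ih =>
    rw [pow_succ, ← mul_assoc, polyLaplacian_mul_normSqPoly
      (isHomogeneous_mul_normSqPoly_pow hV.1 (n + 1)), ih, smul_mul_assoc, mul_assoc V, ← pow_succ,
      ← add_smul]
    congr 1
    push_cast
    ring

/-- The polynomials `V(x) |x|^{2n} / (4^n n! Γ(n + ϑ))`, each of which is the Laplacian of the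
next one. -/
noncomputable def harmonicTower (V : MvPolynomial (Fin d) ℂ) (ϑ : ℝ) (n : ℕ) :
    MvPolynomial (Fin d) ℂ :=
  ((4 ^ n * n.factorial * Real.Gamma (n + ϑ) : ℝ) : ℂ)⁻¹ • (V * normSqPoly d ^ n)

theorem polyVal_harmonicTower (V : MvPolynomial (Fin d) ℂ) (ϑ : ℝ) (n : ℕ) (x : E d) :
    polyVal (harmonicTower V ϑ n) x =
      polyVal V x * (((‖x‖ ^ 2 / 4) ^ n / (n.factorial * Real.Gamma (n + ϑ)) : ℝ) : ℂ) := by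
  have h := polyVal_normSqPoly x
  simp only [polyVal] at h
  simp only [polyVal, harmonicTower, MvPolynomial.smul_eval, map_mul, map_pow, h]
  push_cast
  rw [div_pow]
  field_simp

theorem polyLaplacian_smul (c : ℂ) (p : MvPolynomial (Fin d) ℂ) :
    polyLaplacian (c • p) = c • polyLaplacian p := by
  simp [polyLaplacian, Finset.smul_sum]

/-- The heat flow of `V(x) |x|^{2n}`. -/
theorem integral_harmonicTower {V : MvPolynomial (Fin d) ℂ} {l : ℕ} (hV : IsSolidHarmonic V l)
    {ϑ : ℝ} (hϑ : ϑ = (d : ℝ) / 2 + l) (hϑ0 : 0 < ϑ) (n : ℕ) (x : E d) {τ : ℝ} (hτ : 0 < τ) :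
    ∫ y, polyVal (harmonicTower V ϑ n) y * heatKernel d τ (x - y) =
      ∑ k ∈ Finset.range (n + 1), (τ : ℂ) ^ k / k.factorial *
        polyVal (harmonicTower V ϑ (n - k)) x := by
  rw [integral_mul_heatKernel_eq _ x hτ, integral_polyVal_tower]
  · have : (((2 * Real.sqrt τ : ℝ) : ℂ) ^ 2 / 4) = τ := by
      rw [← Complex.ofReal_pow, mul_pow, Real.sq_sqrt hτ.le]
      push_cast
      ring
    simp_rw [this]
  · have h0 : polyLaplacian V = 0 := hV.2
    rw [harmonicTower, polyLaplacian_smul, pow_zero (normSqPoly d), mul_one V, h0, smul_zero]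
  · intro n
    rw [harmonicTower, polyLaplacian_smul, polyLaplacian_mul_normSqPoly_pow hV, smul_smul,
      harmonicTower, ← hϑ]
    congr 1
    have hn : (n : ℝ) + ϑ ≠ 0 := by positivity
    have hG : Real.Gamma (n + ϑ) ≠ 0 := (Real.Gamma_pos_of_pos (by positivity)).ne'
    rw [show ((n + 1 : ℕ) : ℝ) + ϑ = n + ϑ + 1 by push_cast; ring, Real.Gamma_add_one hn,
      Nat.factorial_succ]
    have hn' : (n : ℂ) + ϑ ≠ 0 := by exact_mod_cast hn
    have hG' : (Real.Gamma (n + ϑ) : ℂ) ≠ 0 := by exact_mod_cast hG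
    have h1 : (n + 1 : ℂ) ≠ 0 := Nat.cast_add_one_ne_zero n
    have h2 : (n.factorial : ℂ) ≠ 0 := Nat.cast_ne_zero.2 (Nat.factorial_ne_zero n)
    push_cast
    rw [pow_succ]
    field_simp

/-- Solid harmonics are invariant under the heat flow. -/
theorem integral_polyVal_mul_heatKernel {V : MvPolynomial (Fin d) ℂ} {l : ℕ}
    (hV : IsSolidHarmonic V l) (hd : 1 ≤ d) (x : E d) {τ : ℝ} (hτ : 0 < τ) :
    ∫ y, polyVal V y * heatKernel d τ (x - y) = polyVal V x := by
  have hϑ0 : 0 < (d : ℝ) / 2 + l := by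
    have : (1 : ℝ) ≤ d := by exact_mod_cast hd
    positivity
  have h := integral_harmonicTower hV rfl hϑ0 0 x hτ
  have hG : (Real.Gamma ((d : ℝ) / 2 + l) : ℂ) ≠ 0 := by
    exact_mod_cast (Real.Gamma_pos_of_pos hϑ0).ne'
  simp only [polyVal_harmonicTower, zero_add, Finset.range_one, Finset.sum_singleton, pow_zero,
    Nat.factorial_zero, Nat.cast_one, div_one, one_mul, Nat.cast_zero, tsub_zero] at h
  simp_rw [mul_right_comm (polyVal V _) _ ((heatKernel d τ _ : ℝ) : ℂ)] at h
  rw [integral_mul_const] at h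
  refine mul_right_cancel₀ ?_ h
  simpa using hG

/-- The heat flow of a solid harmonic times a Gaussian. The product of two Gaussians is a Gaussian
with a shifted center, so this reduces to the invariance of `V` under the heat flow. -/
theorem integral_polyVal_mul_exp_mul_heatKernel {V : MvPolynomial (Fin d) ℂ} {l : ℕ}
    (hV : IsSolidHarmonic V l) (hd : 1 ≤ d) {ϑ : ℝ} (hϑ : ϑ = (d : ℝ) / 2 + l) (x : E d)
    {t τ : ℝ} (ht : 0 ≤ t) (hτ : 0 < τ) :
    ∫ y, polyVal V y * (Real.exp (-t * ‖y‖ ^ 2) : ℝ) * heatKernel d τ (x - y) =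
      polyVal V x * (((1 + 4 * t * τ) ^ (-ϑ) * Real.exp (-t * ‖x‖ ^ 2 / (1 + 4 * t * τ)) : ℝ) : ℂ) := by
  have hp := Real.pi_pos
  obtain ⟨A, hA⟩ : ∃ A, A = 1 + 4 * t * τ := ⟨_, rfl⟩
  have hA0 : 0 < A := by rw [hA]; positivity
  rw [← hA]
  -- completing the square
  have key : ∀ y : E d, Real.exp (-t * ‖y‖ ^ 2) * heatKernel d τ (x - y) =
      A ^ (-(d : ℝ) / 2) * Real.exp (-t * ‖x‖ ^ 2 / A) * heatKernel d (τ / A) (A⁻¹ • x - y) := by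
    intro y
    have e1 : (4 * Real.pi * τ) ^ (-(d : ℝ) / 2) =
        A ^ (-(d : ℝ) / 2) * (4 * Real.pi * (τ / A)) ^ (-(d : ℝ) / 2) := by
      rw [← Real.mul_rpow hA0.le (by positivity)]
      congr 1
      field_simp
    have e2 : -t * ‖y‖ ^ 2 + -‖x - y‖ ^ 2 / (4 * τ) =
        -t * ‖x‖ ^ 2 / A + -‖A⁻¹ • x - y‖ ^ 2 / (4 * (τ / A)) := by
      rw [norm_sub_sq_real, norm_sub_sq_real, norm_smul, real_inner_smul_left, Real.norm_of_nonneg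
        (inv_nonneg.2 hA0.le)]
      field_simp
      rw [hA]
      ring
    rw [heatKernel, heatKernel, e1]
    calc _ = A ^ (-(d : ℝ) / 2) * (4 * Real.pi * (τ / A)) ^ (-(d : ℝ) / 2) *
          Real.exp (-t * ‖y‖ ^ 2 + -‖x - y‖ ^ 2 / (4 * τ)) := by rw [Real.exp_add]; ring
      _ = _ := by rw [e2, Real.exp_add]; ring
  have e : ∀ y, polyVal V y * (Real.exp (-t * ‖y‖ ^ 2) : ℝ) * heatKernel d τ (x - y) =
      ((A ^ (-(d : ℝ) / 2) * Real.exp (-t * ‖x‖ ^ 2 / A) : ℝ) : ℂ) *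
        (polyVal V y * heatKernel d (τ / A) (A⁻¹ • x - y)) := fun y => by
    rw [mul_assoc, ← Complex.ofReal_mul, key]
    push_cast
    ring
  simp_rw [e]
  rw [integral_const_mul, integral_polyVal_mul_heatKernel hV hd _ (by positivity),
    polyVal_smul hV.1, hϑ, neg_add, Real.rpow_add hA0, Real.rpow_neg hA0.le (l : ℝ),
    Real.rpow_natCast, neg_div]
  push_cast
  ring

/-! ### Second differences -/

/-- The symmetric second difference of `u` at `x`, in the normalization
`u(x) - (u(x + z) + u(x - z)) / 2`. -/
noncomputable def secondDiff (u : E d → ℂ) (x z : E d) : ℂ := u x - (u (x + z) + u (x - z)) / 2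

/-- The second difference is quadratically small near `0`, because the gradient is locally
Lipschitz, and of polynomial growth at infinity. -/
theorem exists_secondDiff_le {u : E d → ℂ} (hu : HasPolyGrowth u) (hc : ContDiff ℝ 2 u) (x : E d) :
    ∃ (C : ℝ) (k : ℕ), 0 ≤ C ∧ ∀ z, ‖secondDiff u x z‖ ≤ C * ‖z‖ ^ 2 * (1 + ‖z‖) ^ k := by
  obtain ⟨K, hK⟩ : ∃ K, LipschitzOnWith K (fderiv ℝ u) (Metric.closedBall x 1) := by
    have h1 : ContDiff ℝ 1 (fderiv ℝ u) := hc.fderiv_right (by norm_num)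
    exact (h1.locallyLipschitz.locallyLipschitzOn).exists_lipschitzOnWith_of_compact
      (isCompact_closedBall x 1)
  have hdiff : Differentiable ℝ u := hc.differentiable (by norm_num)
  have near : ∀ z : E d, ‖z‖ ≤ 1 → ‖secondDiff u x z‖ ≤ K * ‖z‖ ^ 2 := fun z hz => by
    have hD : ∀ w : E d, HasFDerivAt (fun w => u (x + w) + u (x - w))
        (fderiv ℝ u (x + w) - fderiv ℝ u (x - w)) w := fun w => by
      have h1 := (hdiff (x + w)).hasFDerivAt.comp w ((hasFDerivAt_id w).const_add x)
      have h2 := (hdiff (x - w)).hasFDerivAt.comp w ((hasFDerivAt_id w).const_sub x)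
      refine (h1.add h2).congr_fderiv ?_
      ext v
      simp [sub_eq_add_neg]
    have := (convex_closedBall (0 : E d) ‖z‖).norm_image_sub_le_of_norm_hasFDerivWithin_le
      (f := fun w => u (x + w) + u (x - w)) (C := 2 * K * ‖z‖) (x := 0) (y := z)
      (fun w _ => (hD w).hasFDerivWithinAt) (fun w hw => ?_) (by simp) (by simp)
    · have e : secondDiff u x z = -((u (x + z) + u (x - z) - (u (x + 0) + u (x - 0))) / 2) := by
        simp only [secondDiff, add_zero, sub_zero]
        ring
      rw [e, norm_neg, norm_div]
      simp only [sub_zero] at this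
      rw [Complex.norm_ofNat]
      have : ‖u (x + z) + u (x - z) - (u (x + 0) + u (x - 0))‖ ≤ 2 * K * ‖z‖ * ‖z‖ := by
        simpa using this
      linarith
    · have hw' : ‖w‖ ≤ ‖z‖ := by simpa using hw
      have h1 := hK.norm_sub_le (x := x + w) (y := x - w) (by simpa using hw'.trans hz)
        (by simpa using hw'.trans hz)
      have h2 : ‖x + w - (x - w)‖ ≤ 2 * ‖z‖ := by
        rw [show x + w - (x - w) = w + w by abel]
        exact (norm_add_le _ _).trans (by linarith)
      calc _ ≤ _ := h1
        _ ≤ K * (2 * ‖z‖) := by gcongr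
        _ = _ := by ring
  obtain ⟨C, k, hC, h⟩ := hu.comp_affine x 1
  refine ⟨K + 2 * C, k, by positivity, fun z => ?_⟩
  have hb : 0 ≤ ‖z‖ := norm_nonneg z
  have h1 : 1 ≤ (1 + ‖z‖) ^ k := one_le_pow₀ (by linarith)
  rcases le_total ‖z‖ 1 with hz | hz
  · calc _ ≤ K * ‖z‖ ^ 2 * 1 := by simpa using near z hz
      _ ≤ _ := by gcongr; linarith
  · have a1 := h 0 (by simp) z
    have a2 := h 1 (by simp) z
    have a3 := h (-1) (by simp) z
    simp only [zero_smul, add_zero, one_smul, neg_smul] at a1 a2 a3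
    rw [← sub_eq_add_neg] at a3
    have a4 : ‖secondDiff u x z‖ ≤ 2 * C * (1 + ‖z‖) ^ k := by
      rw [secondDiff]
      refine (norm_sub_le _ _).trans ?_
      rw [norm_div, Complex.norm_ofNat]
      have := norm_add_le (u (x + z)) (u (x - z))
      linarith
    refine a4.trans ?_
    have : 1 ≤ ‖z‖ ^ 2 := one_le_pow₀ hz
    have hk : 0 ≤ (1 + ‖z‖) ^ k := by positivity
    calc 2 * C * (1 + ‖z‖) ^ k ≤ 2 * C * ‖z‖ ^ 2 * (1 + ‖z‖) ^ k :=
          mul_le_mul_of_nonneg_right (le_mul_of_one_le_right (by positivity) this) hk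
      _ ≤ _ := by
          gcongr
          simp

theorem continuous_secondDiff {u : E d → ℂ} (hu : Continuous u) (x : E d) :
    Continuous (secondDiff u x) := by
  unfold secondDiff
  fun_prop

/-- Since the heat kernel is even and of mass `1`, its pairing with the second difference is the
increment of the heat orbit. -/
theorem integral_secondDiff_mul_heatKernel {u : E d → ℂ} (hu : HasPolyGrowth u) (hm : Continuous u)
    (x : E d) {τ : ℝ} (hτ : 0 < τ) :
    ∫ z, secondDiff u x z * heatKernel d τ z = u x - ∫ y, u y * heatKernel d τ (x - y) := by
  have i0 := integrable_mul_heatKernel hu hm.aestronglyMeasurable x hτ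
  have i1 : Integrable fun z => u (x - z) * heatKernel d τ z := by
    have := i0.comp_sub_left x
    simpa using this
  have i2 : Integrable fun z => u (x + z) * heatKernel d τ z := by
    have := i1.comp_neg
    simpa [heatKernel_neg] using this
  have e1 : ∫ z, u (x - z) * heatKernel d τ z = ∫ y, u y * heatKernel d τ (x - y) := by
    have := integral_sub_left_eq_self (fun y => u y * (heatKernel d τ (x - y) : ℂ)) volume x
    simpa using this
  have e2 : ∫ z, u (x + z) * heatKernel d τ z = ∫ y, u y * heatKernel d τ (x - y) := by
    rw [← e1, ← integral_neg_eq_self (fun z => u (x - z) * (heatKernel d τ z : ℂ))]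
    simp [heatKernel_neg]
  have i3 := integrable_mul_heatKernel (HasPolyGrowth.const (d := d) 1)
    continuous_const.aestronglyMeasurable 0 hτ
  simp only [one_mul, zero_sub, heatKernel_neg] at i3
  have e3 : ∫ z : E d, (heatKernel d τ z : ℂ) = 1 := by
    have h := integral_mul_heatKernel_eq (fun _ : E d => (1 : ℂ)) 0 hτ
    simp only [one_mul, zero_sub, heatKernel_neg] at h
    rw [h, integral_complex_ofReal, integral_heatKernel_quarter, Complex.ofReal_one]
  have e : ∀ z, secondDiff u x z * heatKernel d τ z = u x * heatKernel d τ z -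
      1 / 2 * (u (x + z) * heatKernel d τ z + u (x - z) * heatKernel d τ z) := fun z => by
    rw [secondDiff]; ring
  have i4 : Integrable fun z => 1 / 2 * (u (x + z) * heatKernel d τ z + u (x - z) * heatKernel d τ z) :=
    (i2.add i1).const_mul _
  simp_rw [e]
  rw [integral_sub (i3.const_mul _) i4, integral_const_mul, integral_const_mul, integral_add i2 i1, e1, e2, e3]
  ring

/-! ### The classical Laplacian as the generator of the heat flow -/

theorem tendsto_secondDiff_smul {u : E d → ℂ} (hc : ContDiff ℝ 2 u) (x z : E d) :
    Tendsto (fun s : ℝ => secondDiff u x (s • z) / (s : ℂ) ^ 2) (𝓝[>] 0)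
      (𝓝 (-(fderiv ℝ (fderiv ℝ u) x z z) / 2)) := by
  have hdiff : Differentiable ℝ u := hc.differentiable (by norm_num)
  have h1 : ContDiff ℝ 1 (fderiv ℝ u) := hc.fderiv_right (by norm_num)
  have h2 : HasFDerivAt (fderiv ℝ u) (fderiv ℝ (fderiv ℝ u) x) x :=
    (h1.differentiable (by norm_num) x).hasFDerivAt
  have T : ∀ w : E d, (fun h : ℝ => u (x + h • w) - u x - h • fderiv ℝ u x w -
      (h ^ 2 / 2) • fderiv ℝ (fderiv ℝ u) x w w) =o[𝓝[>] 0] fun h => h ^ 2 := fun w => by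
    have := (convex_univ (𝕜 := ℝ) (E := E d)).taylor_approx_two_segment
      (f := u) (f' := fderiv ℝ u) (f'' := fderiv ℝ (fderiv ℝ u) x) (x := x)
      (fun y _ => (hdiff y).hasFDerivAt) (mem_univ x) h2.hasFDerivWithinAt
      (v := 0) (w := w) (by simp) (by simp)
    simpa using this
  have hO : (fun h : ℝ => h ^ 2) =O[𝓝[>] 0] fun h : ℝ => (h : ℂ) ^ 2 :=
    Asymptotics.IsBigO.of_bound 1 (Eventually.of_forall fun h => by simp)
  have T1 := ((T z).add (T (-z)) :).trans_isBigO hO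
  have T2 := (T1.tendsto_div_nhds_zero.div_const (-2)).const_add
    (-(fderiv ℝ (fderiv ℝ u) x z z) / 2)
  simp only [zero_div, add_zero] at T2
  refine T2.congr' ?_
  filter_upwards [self_mem_nhdsWithin] with s hs
  have hs : (s : ℂ) ≠ 0 := by exact_mod_cast (ne_of_gt hs)
  simp only [secondDiff, smul_neg, map_neg, neg_neg, _root_.neg_apply,
    ← sub_eq_add_neg, Complex.real_smul]
  push_cast
  field_simp
  ring

/-- The covariance matrix of the heat kernel at time `1 / 4`. -/
theorem integral_coord_mul_coord (i j : Fin d) :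
    ∫ z : E d, (z i : ℂ) * z j * heatKernel d (1 / 4) z = if i = j then 1 / 2 else 0 := by
  have h := integral_coord_mul_polyVal (MvPolynomial.X j) i (0 : E d) 1
  have e : ∀ z : E d, polyVal (MvPolynomial.X j) (0 + (1 : ℝ) • z) = z j := fun z => by
    simp [polyVal]
  simp_rw [e] at h
  rw [h, MvPolynomial.pderiv_X]
  rcases eq_or_ne i j with rfl | hij
  · rw [Pi.single_eq_same]
    have e2 : ∀ z : E d, polyVal (1 : MvPolynomial (Fin d) ℂ) z = 1 := fun z => by simp [polyVal]
    simp_rw [e2, one_mul]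
    rw [integral_complex_ofReal, integral_heatKernel_quarter]
    simp
  · rw [Pi.single_eq_of_ne hij.symm]
    have e2 : ∀ z : E d, polyVal (0 : MvPolynomial (Fin d) ℂ) z = 0 := fun z => by simp [polyVal]
    simp [e2, hij]

theorem integral_bilin_mul_heatKernel (B : E d →L[ℝ] E d →L[ℝ] ℂ) :
    ∫ z, B z z * heatKernel d (1 / 4) z = 1 / 2 * ∑ i, B (EuclideanSpace.basisFun (Fin d) ℝ i)
      (EuclideanSpace.basisFun (Fin d) ℝ i) := by
  have e : ∀ z : E d, B z z * heatKernel d (1 / 4) z =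
      ∑ i, ∑ j, B (EuclideanSpace.basisFun (Fin d) ℝ i) (EuclideanSpace.basisFun (Fin d) ℝ j) *
        ((z i : ℂ) * z j * heatKernel d (1 / 4) z) := fun z => by
    have h : B z z = B (∑ i, (EuclideanSpace.basisFun (Fin d) ℝ).repr z i •
        EuclideanSpace.basisFun (Fin d) ℝ i) (∑ i, (EuclideanSpace.basisFun (Fin d) ℝ).repr z i •
        EuclideanSpace.basisFun (Fin d) ℝ i) := by rw [OrthonormalBasis.sum_repr]
    rw [h]
    simp only [map_sum, _root_.sum_apply, map_smul, _root_.smul_apply,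
      EuclideanSpace.basisFun_repr, Complex.real_smul, Finset.sum_mul, Finset.mul_sum]
    rw [Finset.sum_comm]
    exact Finset.sum_congr rfl fun i _ => Finset.sum_congr rfl fun j _ => by ring
  have hi : ∀ i j : Fin d, Integrable fun z : E d => (z i : ℂ) * z j * heatKernel d (1 / 4) z :=
    fun i j => integrable_mul_heatKernel_quarter ((HasPolyGrowth.coord i).mul (HasPolyGrowth.coord j))
      (by fun_prop)
  simp_rw [e]
  rw [integral_finsetSum _ fun i _ => integrable_finsetSum _ fun j _ => (hi i j).const_mul _]
  simp_rw [integral_finsetSum _ fun j _ => (hi _ j).const_mul _, integral_const_mul,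
    integral_coord_mul_coord]
  simp [Finset.mul_sum, mul_comm]

theorem laplacian_eq_sum_fderiv (u : E d → ℂ) (x : E d) :
    Δ u x = ∑ i, fderiv ℝ (fderiv ℝ u) x (EuclideanSpace.basisFun (Fin d) ℝ i)
      (EuclideanSpace.basisFun (Fin d) ℝ i) := by
  rw [InnerProductSpace.laplacian_eq_iteratedFDeriv_orthonormalBasis u
    (EuclideanSpace.basisFun (Fin d) ℝ)]
  simp [iteratedFDeriv_two_apply]

/-- With `s = 2√τ`, rescaling turns the quotient into the integral of `4 s⁻²` times the second
difference at `s z` against the heat kernel at time `1 / 4`, and the limit is taken under the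
integral sign. -/
theorem tendsto_integral_secondDiff_div {u : E d → ℂ} (hu : HasPolyGrowth u)
    (hc : ContDiff ℝ 2 u) (x : E d) :
    Tendsto (fun τ : ℝ => (∫ z, secondDiff u x z * heatKernel d τ z) / τ) (𝓝[>] 0)
      (𝓝 (-(Δ u x))) := by
  obtain ⟨C, k, hC, hb⟩ := exists_secondDiff_le hu hc x
  have key : Tendsto (fun s : ℝ => ∫ z, 4 * (secondDiff u x (s • z) / (s : ℂ) ^ 2) *
      heatKernel d (1 / 4) z) (𝓝[>] 0) (𝓝 (∫ z, 4 * (-(fderiv ℝ (fderiv ℝ u) x z z) / 2) *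
      heatKernel d (1 / 4) z)) := by
    have hint : Integrable fun z : E d => ((C * ‖z‖ ^ 2 * (1 + ‖z‖) ^ k : ℝ) : ℂ) *
        heatKernel d (1 / 4) z := by
      refine integrable_mul_heatKernel_quarter ⟨C, k + 2, fun z => ?_⟩ (by fun_prop)
      rw [Complex.norm_real, Real.norm_of_nonneg (by positivity), pow_add, mul_assoc, mul_comm (‖z‖ ^ 2)]
      gcongr
      linarith
    refine tendsto_integral_filter_of_dominated_convergence _ ?_ ?_ (hint.norm.const_mul 4) ?_
    · refine Eventually.of_forall fun s => Continuous.aestronglyMeasurable ?_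
      have := continuous_secondDiff hc.continuous x
      have := continuous_heatKernel (d := d) (1 / 4)
      fun_prop
    · filter_upwards [Ioo_mem_nhdsGT (show (0 : ℝ) < 1 by norm_num)] with s hs
      refine ae_of_all _ fun z => ?_
      rw [norm_mul, norm_mul, norm_mul, norm_div, Complex.norm_ofNat, mul_assoc]
      gcongr
      rw [norm_pow, Complex.norm_real, Complex.norm_real, Real.norm_of_nonneg hs.1.le,
        Real.norm_of_nonneg (by positivity), div_le_iff₀ (by have := hs.1; positivity)]
      refine (hb _).trans ?_
      rw [norm_smul, Real.norm_of_nonneg hs.1.le, mul_pow]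
      have h1 : s * ‖z‖ ≤ ‖z‖ := mul_le_of_le_one_left (norm_nonneg z) hs.2.le
      have h2 : 0 ≤ 1 + s * ‖z‖ := by have := hs.1; positivity
      calc C * (s ^ 2 * ‖z‖ ^ 2) * (1 + s * ‖z‖) ^ k ≤ C * (s ^ 2 * ‖z‖ ^ 2) * (1 + ‖z‖) ^ k := by
            gcongr
        _ = _ := by ring
    · exact ae_of_all _ fun z => ((tendsto_secondDiff_smul hc x z).const_mul 4).mul_const _
  have e1 : ∫ z, 4 * (-(fderiv ℝ (fderiv ℝ u) x z z) / 2) * heatKernel d (1 / 4) z = -(Δ u x) := by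
    have : ∀ z, 4 * (-(fderiv ℝ (fderiv ℝ u) x z z) / 2) * heatKernel d (1 / 4) z =
        -2 * (fderiv ℝ (fderiv ℝ u) x z z * heatKernel d (1 / 4) z) := fun z => by ring
    simp_rw [this]
    rw [integral_const_mul, integral_bilin_mul_heatKernel, laplacian_eq_sum_fderiv]
    ring
  rw [e1] at key
  have hs : Tendsto (fun τ : ℝ => 2 * Real.sqrt τ) (𝓝[>] 0) (𝓝[>] 0) := by
    refine tendsto_nhdsWithin_iff.2 ⟨?_, ?_⟩
    · have : Tendsto (fun τ : ℝ => 2 * Real.sqrt τ) (𝓝 0) (𝓝 (2 * Real.sqrt 0)) :=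
        (by fun_prop : Continuous fun τ : ℝ => 2 * Real.sqrt τ).tendsto 0
      rw [Real.sqrt_zero, mul_zero] at this
      exact this.mono_left nhdsWithin_le_nhds
    · filter_upwards [self_mem_nhdsWithin] with τ hτ
      have : 0 < Real.sqrt τ := Real.sqrt_pos.2 hτ
      simp only [mem_Ioi]
      positivity
  refine (key.comp hs).congr' ?_
  filter_upwards [self_mem_nhdsWithin] with τ hτ
  have hτ : 0 < τ := hτ
  have h := integral_mul_heatKernel_eq (secondDiff u x) 0 hτ
  simp only [zero_sub, zero_add, heatKernel_neg] at h
  rw [h, div_eq_inv_mul _ (τ : ℂ), ← integral_const_mul, Function.comp_def]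
  refine integral_congr_ae (ae_of_all _ fun z => ?_)
  have hτ' : (τ : ℂ) ≠ 0 := by exact_mod_cast hτ.ne'
  have hsq : ((2 * Real.sqrt τ : ℝ) : ℂ) ^ 2 = 4 * τ := by
    rw [← Complex.ofReal_pow, mul_pow, Real.sq_sqrt hτ.le]
    push_cast
    norm_num
  simp only [hsq]
  field_simp

/-- The right derivative at `0` of the heat orbit `∫ u p_τ(x - ·) = A h(τ)` is `Δ u x`. -/
theorem neg_laplacian_eq {u : E d → ℂ} (hu : HasPolyGrowth u) (hc : ContDiff ℝ 2 u) {x : E d}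
    {A : ℂ} {h : ℝ → ℝ} {M c : ℝ}
    (hh : ∀ τ, 0 < τ → ∫ y, u y * heatKernel d τ (x - y) = A * h τ) (hx : u x = A * h 0)
    (H : HasFracPower 1 M h c) : -(Δ u x) = A * c := by
  have hder : HasDerivWithinAt h (-c) (Ici 0) 0 := by
    refine hasDerivWithinAt_Ici_of_tendsto_deriv (s := Ioi 0)
      (fun τ hτ => (H.diff τ hτ).differentiableWithinAt)
      ((H.continuousOn 0 self_mem_Ici).mono Ioi_subset_Ici_self) self_mem_nhdsWithin
      (H.infinitesimal rfl)
  have h1 := hasDerivWithinAt_iff_tendsto_slope.1 hder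
  have h2 : Tendsto (fun τ : ℝ => A * ((-slope h 0 τ : ℝ) : ℂ)) (𝓝[>] 0) (𝓝 (A * c)) := by
    refine ((Complex.continuous_ofReal.tendsto _).comp ?_).const_mul A
    have := h1.neg
    rw [neg_neg] at this
    refine this.mono_left (nhdsWithin_mono _ ?_)
    intro τ hτ
    have hτ : 0 < τ := hτ
    exact ⟨hτ.le, hτ.ne'⟩
  refine tendsto_nhds_unique (tendsto_integral_secondDiff_div hu hc x) (h2.congr' ?_)
  filter_upwards [self_mem_nhdsWithin] with τ hτ
  have hτ : 0 < τ := hτ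
  rw [integral_secondDiff_mul_heatKernel hu hc.continuous x hτ, hh τ hτ, hx, slope_def_field]
  push_cast
  ring

/-! ### The hypersingular integral -/

theorem integral_rpow_mul_exp_neg_div {q b : ℝ} (hq : 0 < q) (hb : 0 < b) :
    IntegrableOn (fun τ : ℝ => τ ^ (-1 - q) * Real.exp (-b / τ)) (Ioi 0) ∧
    ∫ τ in Ioi (0 : ℝ), τ ^ (-1 - q) * Real.exp (-b / τ) = Real.Gamma q * b ^ (-q) := by
  have h : ∫ τ in Ioi (0 : ℝ), τ ^ (-1 - q) * Real.exp (-b / τ) = Real.Gamma q * b ^ (-q) := by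
    have h1 := integral_comp_rpow_Ioi (fun y : ℝ => y ^ (q - 1) * Real.exp (-(b * y)))
      (show (-1 : ℝ) ≠ 0 by norm_num)
    rw [Real.integral_rpow_mul_exp_neg_mul_Ioi hq hb] at h1
    rw [Real.rpow_neg hb.le, ← Real.inv_rpow hb.le, mul_comm (Real.Gamma q), ← one_div b, ← h1]
    refine setIntegral_congr_fun measurableSet_Ioi fun τ hτ => ?_
    have hτ : 0 < τ := hτ
    simp only [smul_eq_mul, abs_neg, abs_one, one_mul]
    rw [← Real.rpow_mul hτ.le, ← mul_assoc, ← Real.rpow_add hτ, Real.rpow_neg_one]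
    congr 2 <;> ring
  refine ⟨Integrable.of_integral_ne_zero ?_, h⟩
  rw [h]
  exact (mul_pos (Real.Gamma_pos_of_pos hq) (by positivity)).ne'

/-- Integrating the heat kernel against `τ ^ (-1 - a)` gives the kernel of the hypersingular integral,
with its normalization constant. -/
theorem integral_heatKernel_mul_rpow (d : ℕ) {a : ℝ} (h0 : 0 < a) {z : E d} (hz : z ≠ 0) :
    IntegrableOn (fun τ : ℝ => heatKernel d τ z * τ ^ (-1 - a)) (Ioi 0) ∧
    a / Real.Gamma (1 - a) * ∫ τ in Ioi (0 : ℝ), heatKernel d τ z * τ ^ (-1 - a) =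
      normConst d (2 * a) / ‖z‖ ^ ((d : ℝ) + 2 * a) := by
  have hp := Real.pi_pos
  have hz0 : 0 < ‖z‖ := norm_pos_iff.2 hz
  have hq : 0 < (d : ℝ) / 2 + a := by positivity
  obtain ⟨i, e⟩ := integral_rpow_mul_exp_neg_div hq (show 0 < ‖z‖ ^ 2 / 4 by positivity)
  have hk : EqOn (fun τ : ℝ => (4 * Real.pi) ^ (-(d : ℝ) / 2) *
      (τ ^ (-1 - ((d : ℝ) / 2 + a)) * Real.exp (-(‖z‖ ^ 2 / 4) / τ)))
      (fun τ : ℝ => heatKernel d τ z * τ ^ (-1 - a)) (Ioi 0) := fun τ hτ => by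
    have hτ : 0 < τ := hτ
    simp only [heatKernel]
    rw [Real.mul_rpow (by positivity) hτ.le, show -1 - ((d : ℝ) / 2 + a) = -(d : ℝ) / 2 + (-1 - a) by
      ring, Real.rpow_add hτ, show -(‖z‖ ^ 2 / 4) / τ = -‖z‖ ^ 2 / (4 * τ) by field_simp]
    ring
  refine ⟨IntegrableOn.congr_fun (i.const_mul _) hk measurableSet_Ioi, ?_⟩
  rw [← setIntegral_congr_fun measurableSet_Ioi hk, integral_const_mul, e, normConst]
  have h2 : Real.sqrt (Real.pi ^ d) = Real.pi ^ ((d : ℝ) / 2) := by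
    rw [Real.sqrt_eq_rpow, ← Real.rpow_natCast, ← Real.rpow_mul hp.le]
    congr 1
    ring
  have h4 : (4 : ℝ) = 2 ^ (2 : ℝ) := by norm_num
  have e1 : (4 * Real.pi) ^ (-(d : ℝ) / 2) = 2 ^ (-(d : ℝ)) / Real.pi ^ ((d : ℝ) / 2) := by
    rw [Real.mul_rpow (by norm_num) hp.le, h4, ← Real.rpow_mul (by norm_num), neg_div,
      Real.rpow_neg hp.le, div_eq_mul_inv]
    congr 2
    ring
  have e2 : (‖z‖ ^ 2 / 4) ^ (-((d : ℝ) / 2 + a)) = 2 ^ ((d : ℝ) + 2 * a) / ‖z‖ ^ ((d : ℝ) + 2 * a) := by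
    rw [Real.rpow_neg (by positivity), Real.div_rpow (by positivity) (by norm_num), inv_div, h4,
      ← Real.rpow_mul (by norm_num), ← Real.rpow_natCast ‖z‖ 2, ← Real.rpow_mul hz0.le]
    congr 2 <;> (push_cast; ring)
  have e3 : (2 : ℝ) ^ (2 * a - 1) * (2 * a) = 2 ^ (-(d : ℝ)) * 2 ^ ((d : ℝ) + 2 * a) * a := by
    rw [← Real.rpow_add two_pos, Real.rpow_sub_one two_ne_zero, show -(d : ℝ) + (d + 2 * a) = 2 * a by
      ring]
    ring
  rw [h2, e1, e2, e3, show (2 * a + d) / 2 = (d : ℝ) / 2 + a by ring,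
    show 1 - 2 * a / 2 = 1 - a by ring]
  field_simp

theorem integrableOn_div_norm_rpow {w : E d → ℂ} (hw : Continuous w) {p : ℝ} (hp : 0 ≤ p)
    (hi : Integrable fun y => w y / (((1 + ‖y‖) ^ p : ℝ) : ℂ)) (x : E d) {r : ℝ} (hr : 0 < r) :
    IntegrableOn (fun z => w (x + z) / ((‖z‖ ^ p : ℝ) : ℂ)) {z | r < ‖z‖} := by
  have hS : MeasurableSet {z : E d | r < ‖z‖} := measurableSet_lt measurable_const measurable_norm
  set K := (1 + ‖x‖) / r + 1 with hK
  have hi' : Integrable fun z => w (x + z) / (((1 + ‖x + z‖) ^ p : ℝ) : ℂ) := hi.comp_add_left x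
  refine (hi'.norm.const_mul (K ^ p)).integrableOn.mono' ?_ ?_
  · refine Measurable.aestronglyMeasurable ?_
    have := hw.measurable
    fun_prop
  · refine (ae_restrict_iff' hS).2 (ae_of_all _ fun z hz => ?_)
    have hz : r < ‖z‖ := hz
    have hz0 : 0 < ‖z‖ := hr.trans hz
    rw [norm_div, norm_div, Complex.norm_real, Complex.norm_real, Real.norm_of_nonneg (by positivity),
      Real.norm_of_nonneg (by positivity), ← mul_div_assoc, div_le_div_iff₀ (by positivity)
      (by positivity)]
    have h1 : 1 + ‖x + z‖ ≤ K * ‖z‖ := by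
      have h2 := norm_add_le x z
      have h3 : 1 + ‖x‖ ≤ (1 + ‖x‖) / r * ‖z‖ := by
        rw [div_mul_eq_mul_div, le_div_iff₀ hr]
        gcongr
      rw [hK]
      linarith
    have hK0 : 0 ≤ K := by positivity
    calc ‖w (x + z)‖ * (1 + ‖x + z‖) ^ p ≤ ‖w (x + z)‖ * (K * ‖z‖) ^ p := by gcongr
      _ = _ := by rw [Real.mul_rpow hK0 hz0.le]; ring

section

variable {u : E d → ℂ} {p : ℝ}

theorem integrableOn_sub_div_norm_rpow (hc : Continuous u) (hp : (d : ℝ) < p)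
    (hi : Integrable fun y => u y / (((1 + ‖y‖) ^ p : ℝ) : ℂ)) (x : E d) {r : ℝ} (hr : 0 < r) :
    IntegrableOn (fun z => (u x - u (x + z)) / ((‖z‖ ^ p : ℝ) : ℂ)) {z | r < ‖z‖} := by
  have hp0 : 0 ≤ p := (Nat.cast_nonneg d).trans hp.le
  have h1 : Integrable fun y : E d => u x / (((1 + ‖y‖) ^ p : ℝ) : ℂ) := by
    have := (integrable_one_add_norm (E := E d) (μ := volume) (r := p) (by simpa using hp)).ofReal
      (𝕜 := ℂ) |>.const_mul (u x)
    refine this.congr (ae_of_all _ fun y => ?_)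
    simp only [Complex.coe_algebraMap]
    rw [Real.rpow_neg (by positivity), Complex.ofReal_inv, div_eq_mul_inv]
  simp_rw [sub_div]
  exact (integrableOn_div_norm_rpow (w := fun _ => u x) continuous_const hp0 h1 x hr).sub
    (integrableOn_div_norm_rpow hc hp0 hi x hr)

/-- The symmetrized hypersingular integral converges absolutely: at infinity by the hypothesis on
`u`, and near `0` because the second difference is `O(|z|²)` and `p < d + 2`. -/
theorem integrable_secondDiff_div (hd : 1 ≤ d) (hu : HasPolyGrowth u) (hc : ContDiff ℝ 2 u)
    (hp : (d : ℝ) < p) (hp2 : p < d + 2)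
    (hi : Integrable fun y => u y / (((1 + ‖y‖) ^ p : ℝ) : ℂ)) (x : E d) :
    Integrable fun z => secondDiff u x z / ((‖z‖ ^ p : ℝ) : ℂ) := by
  have : Nontrivial (E d) := by
    have : Nonempty (Fin d) := ⟨⟨0, hd⟩⟩
    infer_instance
  have hp0 : 0 ≤ p := (Nat.cast_nonneg d).trans hp.le
  have hm := (continuous_secondDiff hc.continuous x).measurable
  have far : IntegrableOn (fun z => secondDiff u x z / ((‖z‖ ^ p : ℝ) : ℂ)) {z | 1 / 2 < ‖z‖} := by
    have h1 := integrableOn_sub_div_norm_rpow hc.continuous hp hi x (show (0 : ℝ) < 1 / 2 by norm_num)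
    have h2 : IntegrableOn (fun z => (u x - u (x - z)) / ((‖z‖ ^ p : ℝ) : ℂ)) {z | 1 / 2 < ‖z‖} := by
      have hS : MeasurableSet {z : E d | 1 / 2 < ‖z‖} :=
        measurableSet_lt measurable_const measurable_norm
      rw [← integrable_indicator_iff hS] at h1 ⊢
      refine h1.comp_neg.congr (ae_of_all _ fun z => ?_)
      simp [indicator, sub_eq_add_neg]
    refine ((h1.add h2).const_mul (1 / 2)).congr (ae_of_all _ fun z => ?_)
    simp only [Pi.add_apply, secondDiff]
    ring
  have near : IntegrableOn (fun z => secondDiff u x z / ((‖z‖ ^ p : ℝ) : ℂ)) (Metric.ball 0 1) := by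
    obtain ⟨C, k, hC, hb⟩ := exists_secondDiff_le hu hc x
    have h1 : IntegrableOn (fun z : E d => C * 2 ^ k * ‖z‖ ^ (2 - p)) (Metric.ball 0 1) := by
      refine Integrable.const_mul ?_ _
      refine (integrableOn_fun_norm_addHaar (volume : Measure (E d))
        (f := fun t : ℝ => t ^ (2 - p))).2 ?_
      have h2 : IntegrableOn (fun t : ℝ => t ^ ((d : ℝ) + 1 - p)) (Ioo 0 1) :=
        (intervalIntegral.integrableOn_Ioo_rpow_iff one_pos).2 (by linarith)
      refine h2.congr_fun (fun t ht => ?_) measurableSet_Ioo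
      have ht : 0 < t := ht.1
      simp only [smul_eq_mul, finrank_euclideanSpace_fin]
      rw [← Real.rpow_natCast t, ← Real.rpow_add ht, Nat.cast_sub hd]
      congr 1
      push_cast
      ring
    refine Integrable.mono' h1 ?_ ?_
    · exact Measurable.aestronglyMeasurable (by fun_prop)
    · refine (ae_restrict_iff' measurableSet_ball).2 (ae_of_all _ fun z hz => ?_)
      have hz : ‖z‖ < 1 := by simpa using hz
      rcases eq_or_ne z 0 with rfl | hz0
      · simp only [secondDiff, add_zero, sub_zero, add_self_div_two, sub_self, zero_div, norm_zero]
        positivity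
      have hz0 : 0 < ‖z‖ := norm_pos_iff.2 hz0
      rw [norm_div, Complex.norm_real, Real.norm_of_nonneg (by positivity), div_le_iff₀ (by positivity),
        mul_assoc, ← Real.rpow_add hz0, show 2 - p + p = ((2 : ℕ) : ℝ) by push_cast; ring,
        Real.rpow_natCast]
      calc _ ≤ _ := hb z
        _ ≤ C * ‖z‖ ^ 2 * 2 ^ k := by gcongr; linarith
        _ = _ := by ring
  have := near.union far
  rwa [show Metric.ball (0 : E d) 1 ∪ {z | 1 / 2 < ‖z‖} = univ from ?_, integrableOn_univ] at this
  refine eq_univ_of_forall fun z => ?_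
  rcases lt_or_ge ‖z‖ 1 with h | h
  · exact Or.inl (by simpa using h)
  · exact Or.inr (by simp only [mem_ofPred_eq]; linarith)

/-- Symmetrizing the truncated hypersingular integral. -/
theorem setIntegral_sub_div_norm_rpow (hc : Continuous u) (hp : (d : ℝ) < p)
    (hi : Integrable fun y => u y / (((1 + ‖y‖) ^ p : ℝ) : ℂ)) (x : E d) {r : ℝ} (hr : 0 < r) :
    IntegrableOn (fun y => (u x - u y) / ((‖x - y‖ ^ p : ℝ) : ℂ)) {y | r < ‖x - y‖} ∧
    ∫ y in {y | r < ‖x - y‖}, (u x - u y) / ((‖x - y‖ ^ p : ℝ) : ℂ) =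
      ∫ z in {z | r < ‖z‖}, secondDiff u x z / ((‖z‖ ^ p : ℝ) : ℂ) := by
  have hS : MeasurableSet {z : E d | r < ‖z‖} := measurableSet_lt measurable_const measurable_norm
  have hS' : MeasurableSet {y : E d | r < ‖x - y‖} :=
    measurableSet_lt measurable_const (by fun_prop)
  set F : E d → ℂ := indicator {z | r < ‖z‖} fun z => (u x - u (x + z)) / ((‖z‖ ^ p : ℝ) : ℂ) with hF
  have hFi : Integrable F := (integrable_indicator_iff hS).2
    (integrableOn_sub_div_norm_rpow hc hp hi x hr)
  have e1 : indicator {y | r < ‖x - y‖} (fun y => (u x - u y) / ((‖x - y‖ ^ p : ℝ) : ℂ)) =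
      fun y => F (y - x) := by
    funext y
    simp only [hF, indicator, mem_ofPred_eq, norm_sub_rev x y, add_sub_cancel]
  have e2 : indicator {z | r < ‖z‖} (fun z => secondDiff u x z / ((‖z‖ ^ p : ℝ) : ℂ)) =
      fun z => 1 / 2 * (F z + F (-z)) := by
    funext z
    simp only [hF, indicator, mem_ofPred_eq, norm_neg, secondDiff, ← sub_eq_add_neg]
    split_ifs
    · ring
    · ring
  rw [← integrable_indicator_iff hS', ← integral_indicator hS', ← integral_indicator hS, e1, e2]
  refine ⟨hFi.comp_sub_right x, ?_⟩
  rw [integral_sub_right_eq_self F x, integral_const_mul, integral_add hFi hFi.comp_neg,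
    integral_neg_eq_self]
  ring

end

/-- The hypersingular form: write its kernel as a superposition of heat kernels and exchange the
integrals over `z` and `τ`. -/
theorem hasHypersingularValue_of_lt (hd : 1 ≤ d) {u : E d → ℂ} (hu : HasPolyGrowth u)
    (hc : ContDiff ℝ 2 u) {α : E d → ℝ} {x : E d} (h0 : 0 < α x / 2) (h1 : α x / 2 < 1)
    {A : ℂ} {h : ℝ → ℝ} {M c : ℝ}
    (hh : ∀ τ, 0 < τ → ∫ y, u y * heatKernel d τ (x - y) = A * h τ) (hx : u x = A * h 0)
    (H : HasFracPower (α x / 2) M h c)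
    (hi : Integrable fun y => u y / (((1 + ‖y‖) ^ ((d : ℝ) + α x) : ℝ) : ℂ)) :
    HasHypersingularValue α u x (A * c) := by
  set p := (d : ℝ) + α x with hp
  set a := α x / 2 with ha
  have ha2 : α x = 2 * a := by rw [ha]; ring
  have hp1 : (d : ℝ) < p := by linarith
  have hI := integrable_secondDiff_div hd hu hc hp1 (by linarith) hi x
  refine ⟨fun r hr => (setIntegral_sub_div_norm_rpow hc.continuous hp1 hi x hr).1, ?_⟩
  have hlim : Tendsto (fun r : ℝ => ∫ z in {z | r < ‖z‖}, secondDiff u x z / ((‖z‖ ^ p : ℝ) : ℂ))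
      (𝓝[>] 0) (𝓝 (∫ z, secondDiff u x z / ((‖z‖ ^ p : ℝ) : ℂ))) := by
    have hS : ∀ r, MeasurableSet {z : E d | r < ‖z‖} := fun r =>
      measurableSet_lt measurable_const measurable_norm
    simp_rw [← integral_indicator (hS _)]
    refine tendsto_integral_filter_of_dominated_convergence _ (Eventually.of_forall fun r =>
      hI.aestronglyMeasurable.indicator (hS r)) (Eventually.of_forall fun r => ae_of_all _ fun z =>
      norm_indicator_le_norm_self _ _) hI.norm (ae_of_all _ fun z => ?_)
    rcases eq_or_ne z 0 with rfl | hz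
    · have : secondDiff u x 0 = 0 := by simp [secondDiff]
      simp [indicator, this]
    · refine tendsto_const_nhds.congr' ?_
      filter_upwards [Ioo_mem_nhdsGT (norm_pos_iff.2 hz)] with r hr
      rw [indicator_of_mem]
      exact hr.2
  have hval : (normConst d (α x) : ℂ) * ∫ z, secondDiff u x z / ((‖z‖ ^ p : ℝ) : ℂ) = A * c := by
    set k := a / Real.Gamma (1 - a) with hk
    have hG : 0 < Real.Gamma (1 - a) := Real.Gamma_pos_of_pos (by linarith)
    have hk0 : 0 < k := by positivity
    let G : E d × ℝ → ℂ := fun q => secondDiff u x q.1 *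
      ((heatKernel d q.2 q.1 * q.2 ^ (-1 - a) : ℝ) : ℂ)
    have hz0 : secondDiff u x 0 = 0 := by simp [secondDiff]
    have hGi : Integrable G (volume.prod (volume.restrict (Ioi 0))) := by
      refine (integrable_prod_iff ?_).2 ⟨ae_of_all _ fun z => ?_, ?_⟩
      · refine Measurable.aestronglyMeasurable ?_
        have m1 := (continuous_secondDiff hc.continuous x).measurable
        have m2 : Measurable fun q : E d × ℝ => heatKernel d q.2 q.1 :=
          measurable_heatKernel.comp measurable_swap
        fun_prop
      · rcases eq_or_ne z 0 with rfl | hz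
        · simp [G, hz0]
        · have := Integrable.ofReal (𝕜 := ℂ) (integral_heatKernel_mul_rpow d h0 hz).1
          exact this.const_mul (secondDiff u x z)
      · refine (hI.norm.const_mul (normConst d (2 * a) / k)).congr (ae_of_all _ fun z => ?_)
        rcases eq_or_ne z 0 with rfl | hz
        · simp [G, hz0]
        · have e : ∫ τ in Ioi (0 : ℝ), ‖heatKernel d τ z * τ ^ (-1 - a)‖ =
              ∫ τ in Ioi (0 : ℝ), heatKernel d τ z * τ ^ (-1 - a) :=
            setIntegral_congr_fun measurableSet_Ioi fun τ hτ => Real.norm_of_nonneg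
              (mul_pos (heatKernel_pos hτ z) (Real.rpow_pos_of_pos hτ _)).le
          have e2 := (integral_heatKernel_mul_rpow d h0 hz).2
          rw [← hk, ← ha2, ← hp, mul_comm, ← eq_div_iff hk0.ne'] at e2
          have e3 : ∀ τ, ‖G (z, τ)‖ = ‖secondDiff u x z‖ * ‖heatKernel d τ z * τ ^ (-1 - a)‖ :=
            fun τ => by simp only [G]; rw [norm_mul, Complex.norm_real]
          simp_rw [e3]
          rw [integral_const_mul, e, norm_div, Complex.norm_real, Real.norm_of_nonneg (by positivity),
            ← ha2, e2]
          field_simp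
    have s1 : ∀ z, ∫ τ in Ioi (0 : ℝ), G (z, τ) =
        (normConst d (α x) / k : ℝ) * (secondDiff u x z / ((‖z‖ ^ p : ℝ) : ℂ)) := fun z => by
      rcases eq_or_ne z 0 with rfl | hz
      · simp [G, hz0]
      · have e2 := (integral_heatKernel_mul_rpow d h0 hz).2
        rw [← hk, ← ha2, ← hp, mul_comm, ← eq_div_iff hk0.ne'] at e2
        simp only [G]
        rw [integral_const_mul, integral_complex_ofReal, e2]
        push_cast
        ring
    have s2 : ∀ τ ∈ Ioi (0 : ℝ), ∫ z, G (z, τ) = A * (((h 0 - h τ) * τ ^ (-1 - a) : ℝ) : ℂ) := by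
      intro τ hτ
      have e : ∀ z, G (z, τ) = (secondDiff u x z * heatKernel d τ z) * (τ ^ (-1 - a) : ℝ) := fun z => by
        simp only [G]
        push_cast
        ring
      simp_rw [e]
      rw [integral_mul_const, integral_secondDiff_mul_heatKernel hu hc.continuous x hτ, hh τ hτ, hx]
      push_cast
      ring
    have s3 := integral_integral_swap (f := fun z τ => G (z, τ)) hGi
    simp_rw [s1] at s3
    rw [integral_const_mul, setIntegral_congr_fun measurableSet_Ioi s2, integral_const_mul,
      integral_complex_ofReal] at s3
    have hf := H.frac h1
    rw [← hk] at hf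
    rw [← hf]
    have hk' : (k : ℂ) ≠ 0 := by exact_mod_cast hk0.ne'
    push_cast at s3 ⊢
    field_simp at s3
    rw [s3]
    ring
  rw [← hval]
  refine (hlim.const_mul _).congr' ?_
  filter_upwards [self_mem_nhdsWithin] with r hr
  rw [(setIntegral_sub_div_norm_rpow hc.continuous hp1 hi x hr).2]

/-- All forms of the operator are determined by the heat orbit `τ ↦ A h(τ)` of `u` at `x`. -/
theorem varLaplacianEq_of_heat (hd : 1 ≤ d) {u : E d → ℂ} (hu : HasPolyGrowth u)
    (hc : ContDiff ℝ ∞ u) {α : E d → ℝ} {x : E d} (hα : 0 < α x ∧ α x ≤ 2)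
    {A : ℂ} {h : ℝ → ℝ} {M c : ℝ}
    (hh : ∀ τ, 0 < τ → ∫ y, u y * heatKernel d τ (x - y) = A * h τ) (hx : u x = A * h 0)
    (H : HasFracPower (α x / 2) M h c) : VarLaplacianEq α u x (A * c) := by
  have hc2 : ContDiff ℝ 2 u := hc.of_le (WithTop.coe_le_coe.2 le_top)
  refine ⟨?_, fun h2 hi => hasHypersingularValue_of_lt hd hu hc2 (by linarith [hα.1]) (by linarith)
    hh hx H hi, fun h2 => neg_laplacian_eq hu hc2 hh hx (M := M) (by simpa [h2] using H)⟩
  rcases hα.2.lt_or_eq with h2 | h2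
  · exact hasPseudoDiffValue_of_lt hu hc.continuous (by linarith [hα.1]) (by linarith) hh H
  · exact hasPseudoDiffValue_of_eq_two hu hc.continuous h2 hh H

/-! ### Orbits of Gaussian type -/

namespace HasFracPower

variable {a : ℝ}

theorem unique {M M' c c' : ℝ} {h : ℝ → ℝ} (h1 : a ≤ 1) (H : HasFracPower a M h c)
    (H' : HasFracPower a M' h c') : c = c' := by
  rcases h1.lt_or_eq with h1 | h1
  · rw [← H.frac h1, ← H'.frac h1]
  · have := tendsto_nhds_unique (H.infinitesimal h1) (H'.infinitesimal h1)
    linarith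

/-- The orbits `τⁿ (1 + τ)^{-p-n}` are superpositions of the orbits `(zτ)ⁿ e^{-zτ}` with respect to
`z^{p-1} e^{-z} dz / Γ(p + n)`. -/
theorem pow_mul_one_add_rpow (h0 : 0 < a) {p : ℝ} (hp : 0 < p) (n : ℕ) :
    HasFracPower a (2 * n.factorial * ((1 + p) * Real.Gamma p) / Real.Gamma (p + n))
      (fun τ => τ ^ n * (1 + τ) ^ (-(p + n)))
      ((ascPochhammer ℝ n).eval (-a) * Real.Gamma (p + a) / Real.Gamma (p + n)) := by
  have hG : 0 < Real.Gamma (p + n) := Real.Gamma_pos_of_pos (by positivity)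
  let k : ℝ → ℝ := fun z => z ^ (p - 1) * Real.exp (-z) / Real.Gamma (p + n)
  have hk : ∀ z, 0 < z → 0 ≤ k z := fun z hz => by positivity
  have i1 : IntegrableOn (fun z : ℝ => Real.exp (-z) * z ^ (p - 1)) (Ioi 0) :=
    Real.GammaIntegral_convergent hp
  have i2 : IntegrableOn (fun z : ℝ => Real.exp (-z) * z ^ (p + 1 - 1)) (Ioi 0) :=
    Real.GammaIntegral_convergent (by linarith)
  have eM : EqOn (fun z => |k z| * (2 * n.factorial * (1 + z))) (fun z => 2 * n.factorial /
      Real.Gamma (p + n) * (Real.exp (-z) * z ^ (p - 1) + Real.exp (-z) * z ^ (p + 1 - 1)))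
      (Ioi 0) := fun z hz => by
    have hz : 0 < z := hz
    simp only
    rw [abs_of_nonneg (hk z hz), show p + 1 - 1 = (p - 1) + 1 by ring, Real.rpow_add_one hz.ne']
    simp only [k]
    ring
  have key := integral_param (μ := volume.restrict (Ioi (0 : ℝ))) (a := a)
    (g := fun z τ => k z * ((z * τ) ^ n * Real.exp (-(z * τ))))
    (M := fun z => |k z| * (2 * n.factorial * (1 + z)))
    (c := fun z => k z * (z ^ a * (ascPochhammer ℝ n).eval (-a))) h0 ?_ ?_ ?_
  · have vM : ∫ z in Ioi (0 : ℝ), |k z| * (2 * n.factorial * (1 + z)) =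
        2 * n.factorial * ((1 + p) * Real.Gamma p) / Real.Gamma (p + n) := by
      rw [setIntegral_congr_fun measurableSet_Ioi eM, integral_const_mul, integral_add i1 i2,
        ← Real.Gamma_eq_integral hp, ← Real.Gamma_eq_integral (by linarith),
        Real.Gamma_add_one hp.ne']
      ring
    have vc : ∫ z in Ioi (0 : ℝ), k z * (z ^ a * (ascPochhammer ℝ n).eval (-a)) =
        (ascPochhammer ℝ n).eval (-a) * Real.Gamma (p + a) / Real.Gamma (p + n) := by
      have e : EqOn (fun z => k z * (z ^ a * (ascPochhammer ℝ n).eval (-a))) (fun z =>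
          (ascPochhammer ℝ n).eval (-a) / Real.Gamma (p + n) * (Real.exp (-z) * z ^ (p + a - 1)))
          (Ioi 0) := fun z hz => by
        have hz : 0 < z := hz
        simp only [k]
        rw [show p + a - 1 = (p - 1) + a by ring, Real.rpow_add hz]
        ring
      rw [setIntegral_congr_fun measurableSet_Ioi e, integral_const_mul,
        ← Real.Gamma_eq_integral (by linarith)]
      ring
    rw [vM, vc] at key
    refine key.congr fun τ hτ => ?_
    have e : EqOn (fun z => k z * ((z * τ) ^ n * Real.exp (-(z * τ)))) (fun z =>
        τ ^ n / Real.Gamma (p + n) * (z ^ (p + n - 1) * Real.exp (-((1 + τ) * z)))) (Ioi 0) :=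
      fun z hz => by
        have hz : 0 < z := hz
        simp only [k]
        rw [show p + n - 1 = (p - 1) + n by ring, Real.rpow_add hz, Real.rpow_natCast,
          show -((1 + τ) * z) = -z + -(z * τ) by ring, Real.exp_add, mul_pow]
        ring
    rw [setIntegral_congr_fun measurableSet_Ioi e, integral_const_mul,
      Real.integral_rpow_mul_exp_neg_mul_Ioi (by positivity) (by positivity), one_div,
      Real.inv_rpow (by positivity), Real.rpow_neg (by positivity)]
    field_simp
  · simp only [Function.uncurry_def, k]
    fun_prop
  · exact IntegrableOn.congr_fun (Integrable.const_mul (i1.add i2) _) eM.symm measurableSet_Ioi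
  · refine (ae_restrict_iff' measurableSet_Ioi).2 (ae_of_all _ fun z hz => ?_)
    have hz : 0 < z := hz
    exact ((pow_mul_exp_neg h0 n).comp_mul hz).const_mul (k z)

theorem one_add_rpow (h0 : 0 < a) {p : ℝ} (hp : 0 < p) :
    HasFracPower a (2 * (1 + p)) (fun τ => (1 + τ) ^ (-p)) (Real.Gamma (p + a) / Real.Gamma p) := by
  have hG : 0 < Real.Gamma p := Real.Gamma_pos_of_pos hp
  have := pow_mul_one_add_rpow h0 hp 0
  simp only [Nat.factorial_zero, Nat.cast_one, Nat.cast_zero, add_zero, pow_zero, one_mul,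
    ascPochhammer_zero, Polynomial.eval_one, mul_one] at this
  rwa [mul_div_assoc, mul_div_cancel_right₀ _ hG.ne'] at this

variable {ϑ v : ℝ}

/-- Expanding the exponential gives the value, but with a bound that grows exponentially in `v`;
`gaussian` improves it. -/
theorem gaussian_aux (h0 : 0 < a) (hϑ : 0 < ϑ) (hv : 0 ≤ v) :
    HasFracPower a (∑' n : ℕ, v ^ n / n.factorial * (2 * (1 + (ϑ + n))))
      (fun τ => (1 + τ) ^ (-ϑ) * Real.exp (-v / (1 + τ)))
      (Real.Gamma (ϑ + a) / Real.Gamma ϑ * oneFOne (ϑ + a) ϑ (-v)) := by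
  have hG : 0 < Real.Gamma ϑ := Real.Gamma_pos_of_pos hϑ
  have hs : Summable fun n : ℕ => v ^ n / n.factorial * (2 * (1 + (ϑ + n))) := by
    have s1 := (Real.summable_pow_div_factorial v).mul_left (2 * (1 + ϑ))
    have s2 : Summable fun n : ℕ => n * (v ^ n / n.factorial) := by
      rw [← summable_nat_add_iff 1]
      refine ((Real.summable_pow_div_factorial v).mul_left v).congr fun n => ?_
      rw [Nat.factorial_succ]
      push_cast
      field_simp
      ring
    refine (s1.add (s2.mul_left 2)).congr fun n => ?_
    ring
  have key := HasFracPower.tsum (a := a) (M := fun n : ℕ => v ^ n / n.factorial * (2 * (1 + (ϑ + n))))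
    (g := fun n τ => (-v) ^ n / n.factorial * (1 + τ) ^ (-(ϑ + n)))
    (c := fun n => (-v) ^ n / n.factorial * (Real.Gamma (ϑ + n + a) / Real.Gamma (ϑ + n))) h0
    (fun n => by fun_prop) hs (fun n => ?_)
  · have e : ∑' n : ℕ, (-v) ^ n / n.factorial * (Real.Gamma (ϑ + n + a) / Real.Gamma (ϑ + n)) =
        Real.Gamma (ϑ + a) / Real.Gamma ϑ * oneFOne (ϑ + a) ϑ (-v) := by
      rw [oneFOne, hypSeries, ← tsum_mul_left]
      refine tsum_congr fun n => ?_
      rw [show ϑ + n + a = ϑ + a + n by ring, Gamma_add_nat (by positivity) n, Gamma_add_nat hϑ n]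
      have : (ascPochhammer ℝ n).eval ϑ ≠ 0 := (ascPochhammer_pos n ϑ hϑ).ne'
      simp only [List.map_cons, List.map_nil, List.prod_cons, List.prod_nil, mul_one]
      field_simp
    rw [e] at key
    refine key.congr fun τ hτ => ?_
    have h1 : 0 < 1 + τ := by linarith
    rw [Real.exp_eq_exp_ℝ, NormedSpace.exp_eq_tsum_div, ← tsum_mul_left]
    refine tsum_congr fun n => ?_
    rw [neg_add, Real.rpow_add h1, Real.rpow_neg h1.le (n : ℝ), Real.rpow_natCast, div_pow]
    field_simp
  · refine ((one_add_rpow h0 (show 0 < ϑ + n by positivity)).const_mul _).mono (le_of_eq ?_)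
    rw [abs_div, abs_pow, abs_neg, abs_of_nonneg hv, Nat.abs_cast]

theorem hasDerivAt_gaussian (ϑ v : ℝ) {τ : ℝ} (hτ : 0 ≤ τ) :
    HasDerivAt (fun τ => (1 + τ) ^ (-ϑ) * Real.exp (-v / (1 + τ)))
      ((-ϑ * (1 + τ) ^ (-ϑ - 1) + v * ((1 + τ) ^ (-ϑ) * ((1 + τ) ^ 2)⁻¹)) *
        Real.exp (-v / (1 + τ))) τ := by
  have h1 : 0 < 1 + τ := by linarith
  have d0 : HasDerivAt (fun τ : ℝ => 1 + τ) 1 τ := (hasDerivAt_id τ).const_add 1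
  have d1 := d0.rpow_const (p := -ϑ) (Or.inl h1.ne')
  have d2 := (d0.fun_inv h1.ne').const_mul (-v) |>.exp
  simp only [← div_eq_mul_inv] at d2
  refine (d1.mul d2).congr_deriv ?_
  field_simp

/-- The heat orbit of a Gaussian, with a bound linear in `v`, so that superpositions over `v` with
exponentially decreasing weights are possible. -/
theorem gaussian (h0 : 0 < a) (hϑ : 0 < ϑ) (hv : 0 ≤ v) :
    HasFracPower a (1 + ϑ + v) (fun τ => (1 + τ) ^ (-ϑ) * Real.exp (-v / (1 + τ)))
      (Real.Gamma (ϑ + a) / Real.Gamma ϑ * oneFOne (ϑ + a) ϑ (-v)) := by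
  have he : ∀ τ : ℝ, 0 ≤ τ → Real.exp (-v / (1 + τ)) ≤ 1 := fun τ hτ => by
    rw [Real.exp_le_one_iff, neg_div]
    have : 0 ≤ v / (1 + τ) := by positivity
    linarith
  have hr : ∀ τ : ℝ, 0 ≤ τ → ∀ q : ℝ, q ≤ 0 → (1 + τ) ^ q ≤ 1 := fun τ hτ q hq =>
    Real.rpow_le_one_of_one_le_of_nonpos (by linarith) hq
  refine (gaussian_aux h0 hϑ hv).of_deriv_bound (fun τ hτ => ?_) fun τ hτ => ?_
  · rw [abs_of_nonneg (by positivity)]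
    have := mul_le_one₀ (hr τ hτ (-ϑ) (by linarith)) (Real.exp_pos _).le (he τ hτ)
    linarith
  · have h1 : 0 < 1 + τ := by linarith
    rw [(hasDerivAt_gaussian ϑ v hτ.le).deriv, abs_mul, abs_of_pos (Real.exp_pos _)]
    refine (mul_le_of_le_one_right (abs_nonneg _) (he τ hτ.le)).trans ?_
    refine (abs_add_le _ _).trans ?_
    rw [abs_mul, abs_neg, abs_of_pos hϑ, abs_of_pos (Real.rpow_pos_of_pos h1 _),
      abs_of_nonneg (by positivity)]
    have b1 : ϑ * (1 + τ) ^ (-ϑ - 1) ≤ ϑ := mul_le_of_le_one_right hϑ.le (hr τ hτ.le _ (by linarith))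
    have b2 : v * ((1 + τ) ^ (-ϑ) * ((1 + τ) ^ 2)⁻¹) ≤ v := by
      refine mul_le_of_le_one_right hv (mul_le_one₀ (hr τ hτ.le _ (by linarith)) (by positivity) ?_)
      exact inv_le_one_of_one_le₀ (one_le_pow₀ (by linarith))
    linarith

/-- Kummer's transformation. It compares two expansions of the heat orbit of a Gaussian: in powers of
`v / (1 + τ)`, and, after splitting off `e^{-v}`, in powers of `v τ / (1 + τ)`. -/
theorem _root_.VarLap.oneFOne_neg (h0 : 0 < a) (h1 : a ≤ 1) (hϑ : 0 < ϑ) (hv : 0 ≤ v) :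
    oneFOne (ϑ + a) ϑ (-v) = Real.exp (-v) * oneFOne (-a) ϑ v := by
  have hG : 0 < Real.Gamma ϑ := Real.Gamma_pos_of_pos hϑ
  have hGa : 0 < Real.Gamma (ϑ + a) := Real.Gamma_pos_of_pos (by positivity)
  have hP : ∀ n, 0 < (ascPochhammer ℝ n).eval ϑ := fun n => ascPochhammer_pos n ϑ hϑ
  have hs : Summable fun n : ℕ => Real.exp (-v) * (v ^ n / n.factorial) *
      (2 * n.factorial * ((1 + ϑ) * Real.Gamma ϑ) / Real.Gamma (ϑ + n)) := by
    rw [← summable_nat_add_iff 1]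
    refine Summable.of_nonneg_of_le (fun n => by
      have : 0 < Real.Gamma (ϑ + (n + 1 : ℕ)) := Real.Gamma_pos_of_pos (by positivity)
      positivity) (fun n => ?_)
      ((Real.summable_pow_div_factorial v).mul_left (Real.exp (-v) * v * (2 * (1 + ϑ)) / ϑ))
    rw [Gamma_add_nat hϑ]
    have := hP (n + 1)
    have hn : (0 : ℝ) < n.factorial := by positivity
    have e : Real.exp (-v) * (v ^ (n + 1) / (n + 1).factorial) * (2 * (n + 1).factorial *
        ((1 + ϑ) * Real.Gamma ϑ) / ((ascPochhammer ℝ (n + 1)).eval ϑ * Real.Gamma ϑ)) =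
        Real.exp (-v) * v ^ (n + 1) * (2 * (1 + ϑ)) / (ascPochhammer ℝ (n + 1)).eval ϑ := by
      field_simp
    rw [e, show Real.exp (-v) * v * (2 * (1 + ϑ)) / ϑ * (v ^ n / n.factorial) =
      Real.exp (-v) * v ^ (n + 1) * (2 * (1 + ϑ)) / (ϑ * n.factorial) by field_simp; ring]
    exact div_le_div_of_nonneg_left (by positivity) (by positivity)
      (mul_factorial_le_ascPochhammer hϑ n)
  have key := HasFracPower.tsum (a := a) (M := fun n : ℕ => Real.exp (-v) * (v ^ n / n.factorial) *
      (2 * n.factorial * ((1 + ϑ) * Real.Gamma ϑ) / Real.Gamma (ϑ + n)))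
    (g := fun n τ => Real.exp (-v) * (v ^ n / n.factorial) * (τ ^ n * (1 + τ) ^ (-(ϑ + n))))
    (c := fun n => Real.exp (-v) * (v ^ n / n.factorial) *
      ((ascPochhammer ℝ n).eval (-a) * Real.Gamma (ϑ + a) / Real.Gamma (ϑ + n))) h0
    (fun n => by fun_prop) hs (fun n => ?_)
  · have e : ∑' n : ℕ, Real.exp (-v) * (v ^ n / n.factorial) *
      ((ascPochhammer ℝ n).eval (-a) * Real.Gamma (ϑ + a) / Real.Gamma (ϑ + n)) =
        Real.Gamma (ϑ + a) / Real.Gamma ϑ * (Real.exp (-v) * oneFOne (-a) ϑ v) := by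
      rw [oneFOne, hypSeries, ← tsum_mul_left, ← tsum_mul_left]
      refine tsum_congr fun n => ?_
      rw [Gamma_add_nat hϑ n]
      have := (hP n).ne'
      simp only [List.map_cons, List.map_nil, List.prod_cons, List.prod_nil, mul_one]
      field_simp
    rw [e] at key
    have key2 := key.congr (h' := fun τ => (1 + τ) ^ (-ϑ) * Real.exp (-v / (1 + τ))) fun τ hτ => ?_
    · have := (gaussian h0 hϑ hv).unique h1 key2
      exact mul_left_cancel₀ (by positivity) this
    have h1 : 0 < 1 + τ := by linarith
    rw [show -v / (1 + τ) = -v + v * τ / (1 + τ) by field_simp; ring, Real.exp_add,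
      congrFun Real.exp_eq_exp_ℝ (v * τ / (1 + τ)), NormedSpace.exp_eq_tsum_div, ← tsum_mul_left, ← tsum_mul_left]
    refine tsum_congr fun n => ?_
    rw [neg_add, Real.rpow_add h1, Real.rpow_neg h1.le (n : ℝ), Real.rpow_natCast, div_pow, mul_pow]
    field_simp
  · refine ((pow_mul_one_add_rpow h0 hϑ n).const_mul _).mono (le_of_eq ?_)
    rw [abs_of_nonneg (by positivity)]

end HasFracPower

/-! ### Gaussian functions -/

theorem contDiff_polyVal (p : MvPolynomial (Fin d) ℂ) : ContDiff ℝ ∞ (polyVal p) := by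
  induction p using MvPolynomial.induction_on with
  | C a =>
    have : polyVal (d := d) (MvPolynomial.C a) = fun _ => a := by funext y; simp [polyVal]
    rw [this]
    exact contDiff_const
  | add p q hp hq =>
    have : polyVal (p + q) = fun y => polyVal p y + polyVal q y := by funext y; simp [polyVal]
    rw [this]
    exact hp.add hq
  | mul_X p i hp =>
    have h : ContDiff ℝ ∞ fun y : E d => (y i : ℂ) :=
      Complex.ofRealCLM.contDiff.comp (EuclideanSpace.proj i : E d →L[ℝ] ℝ).contDiff
    have e : polyVal (p * MvPolynomial.X i) = fun y => polyVal p y * (y i : ℂ) := by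
      funext y
      simp [polyVal]
    rw [e]
    exact hp.mul h

theorem contDiff_ofReal_comp {f : E d → ℝ} (hf : ContDiff ℝ ∞ f) :
    ContDiff ℝ ∞ fun x => (f x : ℂ) := Complex.ofRealCLM.contDiff.comp hf

theorem four_rpow_half (b : ℝ) : (4 : ℝ) ^ (b / 2) = 2 ^ b := by
  rw [show (4 : ℝ) = 2 ^ (2 : ℝ) by norm_num, ← Real.rpow_mul two_pos.le]
  congr 1
  ring

section

variable {V : MvPolynomial (Fin d) ℂ} {l : ℕ} {ϑ : ℝ}

theorem varLaplacianEq_gaussian (hd : 1 ≤ d) (hV : IsSolidHarmonic V l) (hϑ : ϑ = (d : ℝ) / 2 + l)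
    {α : E d → ℝ} {x : E d} (hα : 0 < α x ∧ α x ≤ 2) :
    VarLaplacianEq α (fun y => polyVal V y * (Real.exp (-‖y‖ ^ 2) : ℂ)) x
      (((2 : ℝ) ^ α x * Real.Gamma (ϑ + α x / 2) / Real.Gamma ϑ : ℝ) * polyVal V x *
        (oneFOne (ϑ + α x / 2) ϑ (-‖x‖ ^ 2) : ℂ)) := by
  have hϑ0 : 0 < ϑ := by
    have : (1 : ℝ) ≤ d := by exact_mod_cast hd
    rw [hϑ]
    positivity
  have H := (HasFracPower.gaussian (a := α x / 2) (by linarith [hα.1]) hϑ0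
    (sq_nonneg ‖x‖)).comp_mul four_pos
  have := varLaplacianEq_of_heat hd (u := fun y => polyVal V y * (Real.exp (-‖y‖ ^ 2) : ℂ))
    ((hasPolyGrowth_polyVal V).of_le fun y => ?_)
    ((contDiff_polyVal V).mul (contDiff_ofReal_comp
      ((contDiff_norm_sq ℝ (E := E d)).neg.exp))) hα (A := polyVal V x) (fun τ hτ => ?_) ?_ H
  · convert! this using 1
    rw [four_rpow_half]
    push_cast
    ring
  · rw [norm_mul, Complex.norm_real, Real.norm_of_nonneg (Real.exp_pos _).le]
    refine mul_le_of_le_one_right (norm_nonneg _) (Real.exp_le_one_iff.2 ?_)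
    have := sq_nonneg ‖y‖
    linarith
  · have := integral_polyVal_mul_exp_mul_heatKernel hV hd hϑ x zero_le_one hτ
    simpa using this
  · simp

end

/-! ### The Gauss hypergeometric function -/

theorem hypSeries_two_one (p B C r : ℝ) : hypSeries [p, B] [C] r =
    ∑' n : ℕ, (ascPochhammer ℝ n).eval p * (ascPochhammer ℝ n).eval B /
      (ascPochhammer ℝ n).eval C * (r ^ n / n.factorial) := by
  simp [hypSeries]

theorem hypSeries_eq_ordinaryHypergeometric (p B C : ℝ) :
    hypSeries [p, B] [C] = ordinaryHypergeometric p B C := by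
  funext r
  rw [ordinaryHypergeometric_eq_tsum, hypSeries_two_one]
  refine tsum_congr fun n => ?_
  rw [smul_eq_mul]
  ring

theorem one_le_radius_ordinaryHypergeometricSeries (p : ℝ) {B C : ℝ} (hB : 0 < B) (hC : 0 < C) :
    1 ≤ (ordinaryHypergeometricSeries ℝ p B C).radius := by
  by_cases hp : ∃ k : ℕ, (k : ℝ) = -p
  · obtain ⟨k, hk⟩ := hp
    rw [show p = -(k : ℝ) by linarith, ordinaryHypergeometric_radius_top_of_neg_nat₁]
    exact le_top
  · push Not at hp
    refine (ordinaryHypergeometricSeries_radius_eq_one _ _ _ _ fun k => ⟨hp k, ?_, ?_⟩).ge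
    · have : (0 : ℝ) ≤ k := k.cast_nonneg
      linarith
    · have : (0 : ℝ) ≤ k := k.cast_nonneg
      linarith

theorem summable_norm_gauss (p : ℝ) {B C r : ℝ} (hB : 0 < B) (hC : 0 < C) (hr : |r| < 1) :
    Summable fun n : ℕ => ‖(ascPochhammer ℝ n).eval p * (ascPochhammer ℝ n).eval B /
      (ascPochhammer ℝ n).eval C * (r ^ n / n.factorial)‖ := by
  have h := (ordinaryHypergeometricSeries ℝ p B C).summable_norm_apply (x := r) ?_
  · refine h.congr fun n => ?_
    rw [ordinaryHypergeometricSeries_apply_eq, smul_eq_mul]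
    congr 1
    ring
  · rw [Metric.mem_eball, edist_zero_right]
    refine lt_of_lt_of_le ?_ (one_le_radius_ordinaryHypergeometricSeries p hB hC)
    rwa [← ofReal_norm, ENNReal.ofReal_lt_one]

theorem analyticAt_hypSeries_two_one (p : ℝ) {B C r : ℝ} (hB : 0 < B) (hC : 0 < C) (hr : |r| < 1) :
    AnalyticAt ℝ (hypSeries [p, B] [C]) r := by
  have h1 := one_le_radius_ordinaryHypergeometricSeries p hB hC
  rw [hypSeries_eq_ordinaryHypergeometric]
  refine ((ordinaryHypergeometricSeries ℝ p B C).hasFPowerSeriesOnBall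
    (zero_lt_one.trans_le h1)).analyticOnNhd r ?_
  rw [Metric.mem_eball, edist_zero_right]
  refine lt_of_lt_of_le ?_ h1
  rwa [← ofReal_norm, ENNReal.ofReal_lt_one]

/-- The Laplace transform of Kummer's function. -/
theorem integral_rpow_mul_exp_mul_oneFOne (A : ℝ) {B C s z : ℝ} (hB : 0 < B) (hC : 0 < C)
    (hs : 0 < s) (hz : |z / s| < 1) :
    ∫ t in Ioi (0 : ℝ), t ^ (B - 1) * Real.exp (-(s * t)) * oneFOne A C (t * z) =
      Real.Gamma B * (s ^ (-B) * hypSeries [A, B] [C] (z / s)) := by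
  let k : ℕ → ℝ := fun n => (ascPochhammer ℝ n).eval A / (ascPochhammer ℝ n).eval C *
    (z ^ n / n.factorial)
  have hpos : ∀ n : ℕ, 0 < B + n := fun n => by positivity
  have hint : ∀ n : ℕ, ∫ t in Ioi (0 : ℝ), t ^ (B + n - 1) * Real.exp (-(s * t)) =
      (ascPochhammer ℝ n).eval B * Real.Gamma B * (s ^ (-B) * (s ^ n)⁻¹) := fun n => by
    rw [Real.integral_rpow_mul_exp_neg_mul_Ioi (hpos n) hs, Gamma_add_nat hB, one_div,
      Real.inv_rpow hs.le, Real.rpow_neg hs.le, Real.rpow_add hs, Real.rpow_natCast]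
    field_simp
  have hF : ∀ n : ℕ, EqOn (fun t : ℝ => t ^ (B - 1) * Real.exp (-(s * t)) * (k n * t ^ n))
      (fun t => k n * (t ^ (B + n - 1) * Real.exp (-(s * t)))) (Ioi 0) := fun n t ht => by
    have ht : 0 < t := ht
    simp only
    rw [show B + n - 1 = (B - 1) + n by ring, Real.rpow_add ht, Real.rpow_natCast]
    ring
  have hi : ∀ n : ℕ, IntegrableOn (fun t : ℝ => t ^ (B + n - 1) * Real.exp (-(s * t))) (Ioi 0) :=
    fun n => by
      refine Integrable.of_integral_ne_zero ?_
      rw [Real.integral_rpow_mul_exp_neg_mul_Ioi (hpos n) hs]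
      have := Real.Gamma_pos_of_pos (hpos n)
      positivity
  have hval : ∀ n : ℕ, k n * ((ascPochhammer ℝ n).eval B * Real.Gamma B * (s ^ (-B) * (s ^ n)⁻¹)) =
      Real.Gamma B * s ^ (-B) * ((ascPochhammer ℝ n).eval A * (ascPochhammer ℝ n).eval B /
        (ascPochhammer ℝ n).eval C * ((z / s) ^ n / n.factorial)) := fun n => by
    simp only [k, div_pow]
    field_simp
  have key := hasSum_integral_of_summable_integral_norm (μ := volume.restrict (Ioi (0 : ℝ)))
    (F := fun n t => t ^ (B - 1) * Real.exp (-(s * t)) * (k n * t ^ n)) (fun n => ?_) ?_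
  · have e : ∀ t : ℝ, t ^ (B - 1) * Real.exp (-(s * t)) * oneFOne A C (t * z) =
        ∑' n, t ^ (B - 1) * Real.exp (-(s * t)) * (k n * t ^ n) := fun t => by
      rw [oneFOne, hypSeries, ← tsum_mul_left]
      refine tsum_congr fun n => ?_
      simp only [k, List.map_cons, List.map_nil, List.prod_cons, List.prod_nil, mul_one, mul_pow]
      ring
    simp_rw [e]
    rw [← key.tsum_eq, hypSeries_two_one, ← mul_assoc, ← tsum_mul_left]
    refine tsum_congr fun n => ?_
    rw [setIntegral_congr_fun measurableSet_Ioi (hF n), integral_const_mul, hint, hval]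
  · exact IntegrableOn.congr_fun ((hi n).const_mul _) (hF n).symm measurableSet_Ioi
  · refine ((summable_norm_gauss A hB hC hz).mul_left (Real.Gamma B * s ^ (-B))).congr fun n => ?_
    have e : EqOn (fun t : ℝ => ‖t ^ (B - 1) * Real.exp (-(s * t)) * (k n * t ^ n)‖)
      (fun t => |k n| * (t ^ (B + n - 1) * Real.exp (-(s * t)))) (Ioi 0) := fun t ht => by
      have ht' : 0 < t := ht
      have := hF n ht
      simp only at this ⊢
      rw [this, norm_mul, Real.norm_eq_abs, Real.norm_of_nonneg (by positivity)]
    have hG := Real.Gamma_pos_of_pos hB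
    have hP : 0 < (ascPochhammer ℝ n).eval B := ascPochhammer_pos n B hB
    rw [setIntegral_congr_fun measurableSet_Ioi e, integral_const_mul, hint,
      ← abs_of_pos (show 0 < (ascPochhammer ℝ n).eval B * Real.Gamma B * (s ^ (-B) * (s ^ n)⁻¹) by
        positivity), ← abs_mul, hval, abs_mul, abs_of_pos (show 0 < Real.Gamma B * s ^ (-B) by
        positivity), Real.norm_eq_abs]

section

variable {a B C : ℝ}

/-- Kummer's transformation, under which the Laplace transform gives a series that converges for all
`w ≥ 0`. -/
theorem integral_rpow_mul_exp_mul_oneFOne_neg (h0 : 0 < a) (h1 : a ≤ 1) (hB : 0 < B) (hC : 0 < C)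
    {w : ℝ} (hw : 0 ≤ w) :
    ∫ t in Ioi (0 : ℝ), t ^ (B - 1) * Real.exp (-t) * oneFOne (C + a) C (-(t * w)) =
      Real.Gamma B * ((1 + w) ^ (-B) * hypSeries [-a, B] [C] (w / (1 + w))) := by
  have hw1 : 0 < 1 + w := by linarith
  rw [← integral_rpow_mul_exp_mul_oneFOne (-a) hB hC hw1]
  · refine setIntegral_congr_fun measurableSet_Ioi fun t ht => ?_
    have ht : 0 < t := ht
    rw [oneFOne_neg h0 h1 hC (by positivity), show -((1 + w) * t) = -t + -(t * w) by ring,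
      Real.exp_add]
    ring
  · rw [abs_of_nonneg (by positivity), div_lt_one hw1]
    linarith

/-- Pfaff's transformation, from the evaluations of a Laplace transform before and after Kummer's
transformation. -/
theorem hypSeries_pfaff (h0 : 0 < a) (h1 : a ≤ 1) (hB : 0 < B) (hC : 0 < C)
    {w : ℝ} (hw : 0 ≤ w) (hw1 : w < 1) :
    (1 + w) ^ (-B) * hypSeries [-a, B] [C] (w / (1 + w)) = hypSeries [C + a, B] [C] (-w) := by
  have h := integral_rpow_mul_exp_mul_oneFOne_neg h0 h1 hB hC hw
  have h2 := integral_rpow_mul_exp_mul_oneFOne (C + a) hB hC one_pos (z := -w)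
    (by rw [div_one, abs_neg, abs_of_nonneg hw]; exact hw1)
  simp only [one_mul, mul_neg, Real.one_rpow, div_one] at h2
  exact mul_left_cancel₀ (Real.Gamma_pos_of_pos hB).ne' (h.symm.trans h2)

/-- The continuation of the Gauss series by Pfaff's transformation. -/
theorem isGaussContinuation_pfaff (h0 : 0 < a) (h1 : a ≤ 1) (hB : 0 < B) (hC : 0 < C) :
    IsGaussContinuation (C + a) B C fun r => if r < 0 then
      (1 - r) ^ (-B) * hypSeries [-a, B] [C] (r / (r - 1)) else hypSeries [C + a, B] [C] r := by
  have hser : ∀ r : ℝ, |r| < 1 → (if r < 0 then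
      (1 - r) ^ (-B) * hypSeries [-a, B] [C] (r / (r - 1)) else hypSeries [C + a, B] [C] r) =
      hypSeries [C + a, B] [C] r := fun r hr => by
    split_ifs with h
    · have := hypSeries_pfaff h0 h1 hB hC (w := -r) (by linarith) (by linarith [(abs_lt.1 hr).1])
      rw [neg_neg] at this
      rw [← this, ← sub_eq_add_neg, ← neg_sub 1 r, div_neg, neg_div]
    · rfl
  refine ⟨fun r hr => ?_, hser⟩
  have hr : r < 1 := hr
  rcases lt_or_ge r 0 with h | h
  · have ha : AnalyticAt ℝ (fun r : ℝ => (1 - r) ^ (-B) * hypSeries [-a, B] [C] (r / (r - 1))) r := by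
      have d1 : AnalyticAt ℝ (fun r : ℝ => (1 - r) ^ (-B)) r :=
        ((contDiffAt_const.sub contDiffAt_id).rpow_const_of_ne (p := -B)
          (by simp only [id]; linarith)).analyticAt
      have d2 : AnalyticAt ℝ (fun r : ℝ => r / (r - 1)) r :=
        analyticAt_id.div (analyticAt_id.sub analyticAt_const) (by simp; linarith)
      refine d1.mul (AnalyticAt.fun_comp (analyticAt_hypSeries_two_one (-a) hB hC ?_) d2)
      rw [← neg_div_neg_eq, abs_of_nonneg (div_nonneg (by linarith) (by linarith)),
        div_lt_one (by linarith)]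
      linarith
    refine ha.congr ?_
    filter_upwards [gt_mem_nhds h] with s hs
    rw [if_pos hs]
  · have ha := analyticAt_hypSeries_two_one (C + a) hB hC (r := r) (by rwa [abs_of_nonneg h])
    refine ha.congr ?_
    filter_upwards [Ioo_mem_nhds (show -1 < r by linarith) hr] with s hs
    exact (hser s (abs_lt.2 hs)).symm

theorem IsGaussContinuation.eqOn {p B C : ℝ} {F F' : ℝ → ℝ} (h : IsGaussContinuation p B C F)
    (h' : IsGaussContinuation p B C F') : EqOn F F' (Iio 1) := by
  refine h.1.eqOn_of_preconnected_of_eventuallyEq h'.1 isPreconnected_Iio (z₀ := 0)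
    (by simp) ?_
  filter_upwards [Ioo_mem_nhds (show (-1 : ℝ) < 0 by norm_num) one_pos] with r hr
  rw [h.2 r (abs_lt.2 hr), h'.2 r (abs_lt.2 hr)]

theorem IsGaussContinuation.twoFOne_eq {p B C : ℝ} {F : ℝ → ℝ} (h : IsGaussContinuation p B C F)
    {r : ℝ} (hr : r < 1) : twoFOne p B C r = F r := by
  have hex : ∃ F, IsGaussContinuation p B C F := ⟨F, h⟩
  rw [twoFOne, dif_pos hex]
  exact hex.choose_spec.eqOn h hr

theorem integral_eq_twoFOne (h0 : 0 < a) (h1 : a ≤ 1) (hB : 0 < B) (hC : 0 < C)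
    {w : ℝ} (hw : 0 ≤ w) :
    ∫ t in Ioi (0 : ℝ), t ^ (B - 1) * Real.exp (-t) * oneFOne (C + a) C (-(t * w)) =
      Real.Gamma B * twoFOne (C + a) B C (-w) := by
  rw [integral_rpow_mul_exp_mul_oneFOne_neg h0 h1 hB hC hw,
    (isGaussContinuation_pfaff h0 h1 hB hC).twoFOne_eq (by linarith)]
  rcases hw.lt_or_eq with hw' | rfl
  · rw [if_pos (by linarith), sub_neg_eq_add, show -w / (-w - 1) = w / (1 + w) by
      rw [← neg_div_neg_eq]; congr 1 <;> ring]
  · rw [if_neg (by simp), hypSeries_pfaff h0 h1 hB hC le_rfl one_pos]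

end

/-! ### Inverse multiquadrics -/

section

variable {V : MvPolynomial (Fin d) ℂ} {l : ℕ} {ϑ β : ℝ}

/-- The heat orbit of an inverse multiquadric, which is the superposition of the Gaussians
`e^{-t|x|²}` with respect to `t^{β-1} e^{-t} dt / Γ(β)`. -/
theorem HasFracPower.multiquadric {a w : ℝ} (h0 : 0 < a) (h1 : a ≤ 1) (hϑ : 0 < ϑ) (hβ : 0 < β)
    (hw : 0 ≤ w) :
    ∃ M, HasFracPower a M (fun τ => ∫ t in Ioi (0 : ℝ), t ^ (β - 1) * Real.exp (-t) / Real.Gamma β *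
        ((1 + 4 * t * τ) ^ (-ϑ) * Real.exp (-t * w / (1 + 4 * t * τ))))
      (4 ^ a * Real.Gamma (ϑ + a) * Real.Gamma (β + a) / (Real.Gamma ϑ * Real.Gamma β) *
        twoFOne (ϑ + a) (β + a) ϑ (-w)) := by
  have hG : 0 < Real.Gamma β := Real.Gamma_pos_of_pos hβ
  let k : ℝ → ℝ := fun t => t ^ (β - 1) * Real.exp (-t) / Real.Gamma β
  have hi : ∀ q : ℝ, 0 < q → IntegrableOn (fun t : ℝ => Real.exp (-t) * t ^ (q - 1)) (Ioi 0) :=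
    fun q hq => Real.GammaIntegral_convergent hq
  have key := integral_param (μ := volume.restrict (Ioi (0 : ℝ))) (a := a)
    (g := fun t τ => k t * ((1 + 4 * t * τ) ^ (-ϑ) * Real.exp (-(t * w) / (1 + 4 * t * τ))))
    (M := fun t => |k t| * ((1 + ϑ + t * w) * (1 + 4 * t)))
    (c := fun t => k t * ((4 * t) ^ a * (Real.Gamma (ϑ + a) / Real.Gamma ϑ *
      oneFOne (ϑ + a) ϑ (-(t * w))))) h0 ?_ ?_ ?_
  · have e : EqOn (fun t => k t * ((4 * t) ^ a * (Real.Gamma (ϑ + a) / Real.Gamma ϑ *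
        oneFOne (ϑ + a) ϑ (-(t * w))))) (fun t => 4 ^ a * Real.Gamma (ϑ + a) /
        (Real.Gamma ϑ * Real.Gamma β) * (t ^ (β + a - 1) * Real.exp (-t) *
        oneFOne (ϑ + a) ϑ (-(t * w)))) (Ioi 0) := fun t ht => by
      have ht : 0 < t := ht
      simp only [k]
      rw [Real.mul_rpow (by norm_num) ht.le, show β + a - 1 = (β - 1) + a by ring, Real.rpow_add ht]
      field_simp
    rw [setIntegral_congr_fun measurableSet_Ioi e, integral_const_mul,
      integral_eq_twoFOne h0 h1 (by positivity) hϑ hw] at key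
    refine ⟨∫ t in Ioi (0 : ℝ), |k t| * ((1 + ϑ + t * w) * (1 + 4 * t)), ?_⟩
    convert! key using 1
    · simp only [k, neg_mul]
    · field_simp
  · simp only [Function.uncurry_def, k]
    fun_prop
  · refine IntegrableOn.congr_fun (((hi β hβ).const_mul ((1 + ϑ) / Real.Gamma β)).add
      (((hi (β + 1) (by linarith)).const_mul ((w + 4 * (1 + ϑ)) / Real.Gamma β)).add
      ((hi (β + 1 + 1) (by linarith)).const_mul (4 * w / Real.Gamma β)))) (fun t ht => ?_)
      measurableSet_Ioi
    have ht : 0 < t := ht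
    simp only [Pi.add_apply, k]
    rw [abs_of_nonneg (by positivity), show β + 1 + 1 - 1 = (β - 1) + 1 + 1 by ring,
      show β + 1 - 1 = (β - 1) + 1 by ring]
    simp only [Real.rpow_add_one ht.ne']
    generalize t ^ (β - 1) = q
    field_simp
    ring
  · refine (ae_restrict_iff' measurableSet_Ioi).2 (ae_of_all _ fun t ht => ?_)
    have ht : 0 < t := ht
    exact ((gaussian h0 hϑ (show 0 ≤ t * w by positivity)).comp_mul
      (show 0 < 4 * t by positivity)).const_mul (k t)

theorem integral_rpow_mul_exp_mul_exp (hβ : 0 < β) {r : ℝ} (hr : 0 ≤ r) :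
    ∫ t in Ioi (0 : ℝ), t ^ (β - 1) * Real.exp (-t) / Real.Gamma β * Real.exp (-t * r) =
      (1 + r) ^ (-β) := by
  have hG : 0 < Real.Gamma β := Real.Gamma_pos_of_pos hβ
  have e : ∀ t : ℝ, t ^ (β - 1) * Real.exp (-t) / Real.Gamma β * Real.exp (-t * r) =
      1 / Real.Gamma β * (t ^ (β - 1) * Real.exp (-((1 + r) * t))) := fun t => by
    rw [show -((1 + r) * t) = -t + -t * r by ring, Real.exp_add]
    ring
  simp_rw [e]
  rw [integral_const_mul, Real.integral_rpow_mul_exp_neg_mul_Ioi hβ (by positivity), one_div (1 + r),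
    Real.inv_rpow (by positivity), Real.rpow_neg (by positivity)]
  field_simp

theorem integral_multiquadric_mul_heatKernel (hd : 1 ≤ d) (hV : IsSolidHarmonic V l)
    (hϑ : ϑ = (d : ℝ) / 2 + l) (hβ : 0 < β) (x : E d) {τ : ℝ} (hτ : 0 < τ) :
    ∫ y, polyVal V y * (((1 + ‖y‖ ^ 2) ^ (-β) : ℝ) : ℂ) * heatKernel d τ (x - y) =
      polyVal V x * ((∫ t in Ioi (0 : ℝ), t ^ (β - 1) * Real.exp (-t) / Real.Gamma β *
        ((1 + 4 * t * τ) ^ (-ϑ) * Real.exp (-t * ‖x‖ ^ 2 / (1 + 4 * t * τ))) : ℝ) : ℂ) := by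
  have hG : 0 < Real.Gamma β := Real.Gamma_pos_of_pos hβ
  let k : ℝ → ℝ := fun t => t ^ (β - 1) * Real.exp (-t) / Real.Gamma β
  have hk : IntegrableOn k (Ioi 0) := by
    have : IntegrableOn (fun t : ℝ => Real.exp (-t) * t ^ (β - 1)) (Ioi 0) :=
      Real.GammaIntegral_convergent hβ
    refine (this.div_const (Real.Gamma β)).congr (ae_of_all _ fun t => ?_)
    simp only [k]
    ring
  let F : E d → ℝ → ℂ := fun y t =>
    (k t : ℂ) * (polyVal V y * (Real.exp (-t * ‖y‖ ^ 2) : ℝ) * heatKernel d τ (x - y))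
  have hF : Integrable (Function.uncurry F) (volume.prod (volume.restrict (Ioi 0))) := by
    have h1 := integrable_mul_heatKernel (hasPolyGrowth_polyVal V)
      (continuous_polyVal V).aestronglyMeasurable x hτ
    refine (h1.norm.mul_prod hk.norm).mono' ?_ ?_
    · refine Measurable.aestronglyMeasurable ?_
      have m1 := (continuous_polyVal V).measurable
      have m2 := (continuous_heatKernel (d := d) τ).measurable
      simp only [Function.uncurry_def, F, k]
      fun_prop
    · have hσ : ∀ᵐ p : E d × ℝ ∂(volume.prod (volume.restrict (Ioi 0))), 0 < p.2 :=
        Measure.quasiMeasurePreserving_snd.ae (ae_restrict_mem measurableSet_Ioi)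
      filter_upwards [hσ] with p hp
      simp only [Function.uncurry_def, F, norm_mul, Complex.norm_real]
      rw [Real.norm_of_nonneg (Real.exp_pos _).le]
      have he : Real.exp (-p.2 * ‖p.1‖ ^ 2) ≤ 1 := by
        rw [Real.exp_le_one_iff, neg_mul]
        have : 0 ≤ p.2 * ‖p.1‖ ^ 2 := by positivity
        linarith
      rw [mul_comm]
      gcongr
      exact mul_le_of_le_one_right (norm_nonneg _) he
  have e1 : ∀ y, polyVal V y * (((1 + ‖y‖ ^ 2) ^ (-β) : ℝ) : ℂ) * heatKernel d τ (x - y) =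
      ∫ t in Ioi (0 : ℝ), F y t := fun y => by
    rw [← integral_rpow_mul_exp_mul_exp hβ (sq_nonneg ‖y‖), ← integral_complex_ofReal,
      ← integral_const_mul, ← integral_mul_const]
    refine integral_congr_ae (ae_of_all _ fun t => ?_)
    simp only [F, k]
    push_cast
    ring
  simp_rw [e1]
  rw [integral_integral_swap hF, ← integral_complex_ofReal, ← integral_const_mul]
  refine setIntegral_congr_fun measurableSet_Ioi fun t ht => ?_
  have ht : 0 < t := ht
  simp only [F]
  rw [integral_const_mul, integral_polyVal_mul_exp_mul_heatKernel hV hd hϑ x ht.le hτ]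
  simp only [k]
  push_cast
  ring

theorem contDiff_multiquadric (V : MvPolynomial (Fin d) ℂ) (β : ℝ) :
    ContDiff ℝ ∞ fun y : E d => polyVal V y * (((1 + ‖y‖ ^ 2) ^ (-β) : ℝ) : ℂ) := by
  refine (contDiff_polyVal V).mul (contDiff_ofReal_comp ?_)
  refine ContDiff.rpow_const_of_ne (contDiff_const.add (contDiff_norm_sq ℝ)) fun y => ?_
  positivity

theorem varLaplacianEq_multiquadric (hd : 1 ≤ d) (hV : IsSolidHarmonic V l)
    (hϑ : ϑ = (d : ℝ) / 2 + l) (hβ : 0 < β) {α : E d → ℝ} {x : E d} (hα : 0 < α x ∧ α x ≤ 2) :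
    VarLaplacianEq α (fun y => polyVal V y * (((1 + ‖y‖ ^ 2) ^ (-β) : ℝ) : ℂ)) x
      (((2 : ℝ) ^ α x * Real.Gamma (ϑ + α x / 2) * Real.Gamma (β + α x / 2) /
        (Real.Gamma ϑ * Real.Gamma β) : ℝ) * polyVal V x *
        (twoFOne (ϑ + α x / 2) (β + α x / 2) ϑ (-‖x‖ ^ 2) : ℂ)) := by
  have hϑ0 : 0 < ϑ := by
    have : (1 : ℝ) ≤ d := by exact_mod_cast hd
    rw [hϑ]
    positivity
  obtain ⟨M, H⟩ := HasFracPower.multiquadric (a := α x / 2) (by linarith [hα.1])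
    (by linarith [hα.2]) hϑ0 hβ (sq_nonneg ‖x‖)
  have := varLaplacianEq_of_heat hd
    (u := fun y => polyVal V y * (((1 + ‖y‖ ^ 2) ^ (-β) : ℝ) : ℂ))
    ((hasPolyGrowth_polyVal V).of_le fun y => ?_) (contDiff_multiquadric V β) hα
    (A := polyVal V x)
    (fun τ hτ => integral_multiquadric_mul_heatKernel hd hV hϑ hβ x hτ) ?_ H
  · convert! this using 1
    rw [four_rpow_half]
    push_cast
    ring
  · rw [norm_mul, Complex.norm_real, Real.norm_of_nonneg (by positivity)]
    refine mul_le_of_le_one_right (norm_nonneg _)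
      (Real.rpow_le_one_of_one_le_of_nonpos ?_ (by linarith))
    have := sq_nonneg ‖y‖
    linarith
  · simp only [mul_zero, add_zero, Real.one_rpow, one_mul, div_one]
    rw [integral_rpow_mul_exp_mul_exp hβ (sq_nonneg ‖x‖)]

end

/-! ### Bessel functions -/

/-- The entire function `∑ₙ (-w/4)ⁿ / (n! Γ(n + s))`, in terms of which
`J_{s-1}(r) / r^{s-1} = 2^{1-s} besselSeries s (r²)`. -/
noncomputable def besselSeries (s w : ℝ) : ℝ :=
  ∑' n : ℕ, (-w / 4) ^ n / (n.factorial * Real.Gamma (n + s))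

theorem exists_inv_Gamma_le {s : ℝ} (hs : 0 < s) :
    ∃ K, 0 < K ∧ ∀ n : ℕ, (Real.Gamma (n + s))⁻¹ ≤ K * 2 ^ n / n.factorial := by
  have hG : 0 < Real.Gamma s := Real.Gamma_pos_of_pos hs
  refine ⟨(1 + 1 / s) / Real.Gamma s, by positivity, fun n => ?_⟩
  rcases n with _ | n
  · simp only [Nat.cast_zero, zero_add, pow_zero, mul_one, Nat.factorial_zero, Nat.cast_one, div_one]
    rw [inv_eq_one_div]
    gcongr
    simp [hs.le]
  · rw [add_comm, Gamma_add_nat hs]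
    have h1 := mul_factorial_le_ascPochhammer hs n
    have h2 : ((n + 1 : ℕ) : ℝ) ≤ 2 ^ (n + 1) := by exact_mod_cast Nat.lt_two_pow_self.le
    have hn : (0 : ℝ) < n.factorial := by positivity
    calc ((ascPochhammer ℝ (n + 1)).eval s * Real.Gamma s)⁻¹ ≤ (s * n.factorial * Real.Gamma s)⁻¹ := by
          gcongr
      _ = (1 / s) / Real.Gamma s * (n + 1 : ℕ) / (n + 1).factorial := by
          rw [Nat.factorial_succ]
          push_cast
          field_simp
      _ ≤ _ := by
          gcongr
          linarith

theorem summable_besselSeries {s : ℝ} (hs : 0 < s) (w : ℝ) :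
    Summable fun n : ℕ => (-w / 4) ^ n / (n.factorial * Real.Gamma (n + s)) := by
  obtain ⟨K, hK, h⟩ := exists_inv_Gamma_le hs
  refine Summable.of_norm_bounded ((Real.summable_pow_div_factorial (|w| / 2)).mul_left K) fun n => ?_
  have hG : 0 < Real.Gamma (n + s) := Real.Gamma_pos_of_pos (by positivity)
  have hn : (1 : ℝ) ≤ n.factorial := by exact_mod_cast Nat.one_le_iff_ne_zero.2 n.factorial_ne_zero
  have e : ‖(-w / 4) ^ n / (n.factorial * Real.Gamma (n + s))‖ =
      (|w| / 4) ^ n / n.factorial * (Real.Gamma (n + s))⁻¹ := by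
    rw [norm_div, norm_pow, norm_div, norm_neg, Real.norm_eq_abs w,
      Real.norm_of_nonneg (show 0 ≤ n.factorial * Real.Gamma (n + s) by positivity)]
    norm_num
    field_simp
  rw [e]
  calc _ ≤ (|w| / 4) ^ n / n.factorial * (K * 2 ^ n / n.factorial) := by gcongr; exact h n
    _ ≤ (|w| / 4) ^ n / n.factorial * (K * 2 ^ n / 1) := by gcongr
    _ = _ := by
        rw [show |w| / 2 = |w| / 4 * 2 by ring, mul_pow]
        ring

theorem besselSeries_zero (s : ℝ) : besselSeries s 0 = (Real.Gamma s)⁻¹ := by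
  rw [besselSeries, tsum_eq_single 0]
  · simp
  · intro n hn
    simp [hn]

/-- The three-term recurrence of the Bessel functions. -/
theorem besselSeries_recurrence {s : ℝ} (hs : 0 < s) (w : ℝ) :
    besselSeries s w = s * besselSeries (s + 1) w - w / 4 * besselSeries (s + 2) w := by
  have s1 := (summable_besselSeries (show 0 < s + 1 by linarith) w).mul_left s
  have s2 := (summable_besselSeries (show 0 < s + 2 by linarith) w).mul_left (-w / 4)
  let f : ℕ → ℝ := fun n => n * ((-w / 4) ^ n / (n.factorial * Real.Gamma (n + (s + 1))))
  have hf : ∀ n, f (n + 1) = -w / 4 * ((-w / 4) ^ n / (n.factorial * Real.Gamma (n + (s + 2)))) :=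
    fun n => by
      simp only [f]
      rw [Nat.factorial_succ, show ((n + 1 : ℕ) : ℝ) + (s + 1) = n + (s + 2) by push_cast; ring]
      push_cast
      have : Real.Gamma (n + (s + 2)) ≠ 0 := (Real.Gamma_pos_of_pos (by positivity)).ne'
      field_simp
      ring
  have hfs : Summable f := by
    rw [← summable_nat_add_iff 1]
    exact s2.congr fun n => (hf n).symm
  have e1 : ∑' n, f n = -w / 4 * besselSeries (s + 2) w := by
    rw [hfs.tsum_eq_zero_add, besselSeries, ← tsum_mul_left]
    simp only [hf]
    simp [f]
  have e2 : besselSeries s w = s * besselSeries (s + 1) w + ∑' n, f n := by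
    rw [besselSeries, besselSeries, ← tsum_mul_left, ← s1.tsum_add hfs]
    refine tsum_congr fun n => ?_
    have : 0 < Real.Gamma (n + s) := Real.Gamma_pos_of_pos (by positivity)
    have h1 : (n + s : ℝ) ≠ 0 := by positivity
    simp only [f]
    rw [← add_assoc, Real.Gamma_add_one h1]
    field_simp
    ring
  rw [e2, e1]
  ring

theorem hasDerivAt_besselSeries {s : ℝ} (hs : 0 < s) (w : ℝ) :
    HasDerivAt (besselSeries s) (-(1 / 4) * besselSeries (s + 1) w) w := by
  let g' : ℕ → ℝ → ℝ := fun n w => n * (-w / 4) ^ (n - 1) * (-1 / 4) /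
    (n.factorial * Real.Gamma (n + s))
  set R := |w| + 1 with hR
  have hR0 : 0 < R := by positivity
  have hg' : ∀ n w, g' (n + 1) w =
      -(1 / 4) * ((-w / 4) ^ n / (n.factorial * Real.Gamma (n + (s + 1)))) := fun n w => by
    simp only [g', Nat.add_sub_cancel]
    rw [Nat.factorial_succ, show ((n + 1 : ℕ) : ℝ) + s = n + (s + 1) by push_cast; ring]
    push_cast
    have : Real.Gamma (n + (s + 1)) ≠ 0 := (Real.Gamma_pos_of_pos (by positivity)).ne'
    field_simp
  have hs' : ∀ w, Summable fun n => g' n w := fun w => by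
    rw [← summable_nat_add_iff 1]
    exact ((summable_besselSeries (show 0 < s + 1 by linarith) w).mul_left (-(1 / 4))).congr
      fun n => (hg' n w).symm
  have hval : -(1 / 4) * besselSeries (s + 1) w = ∑' n, g' n w := by
    rw [(hs' w).tsum_eq_zero_add, besselSeries, ← tsum_mul_left]
    simp only [hg']
    simp [g']
  rw [hval]
  refine hasDerivAt_tsum_of_isPreconnected (hs' (-R)).norm Metric.isOpen_ball
    (Metric.isPreconnected_ball (x := (0 : ℝ)) (r := R)) (fun n y _ => ?_) (fun n y hy => ?_)
    (Metric.mem_ball_self hR0) (summable_besselSeries hs 0) ?_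
  · have h1 : HasDerivAt (fun y : ℝ => -y / 4) (-1 / 4) y := ((hasDerivAt_id y).neg).div_const 4
    exact (h1.fun_pow n).div_const _
  · have hy : |y| ≤ R := by
      rw [Metric.mem_ball, dist_zero_right] at hy
      exact hy.le
    simp only [g', norm_div, norm_mul, norm_pow, norm_neg, Real.norm_eq_abs]
    rw [abs_of_pos hR0]
    gcongr
  · rw [Metric.mem_ball, dist_zero_right, Real.norm_eq_abs]
    linarith

theorem contDiff_besselSeries {s : ℝ} (hs : 0 < s) : ContDiff ℝ ∞ (besselSeries s) := by
  refine contDiff_infty.2 fun n => ?_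
  induction n generalizing s with
  | zero =>
    exact contDiff_zero.2 (continuous_iff_continuousAt.2 fun w =>
      (hasDerivAt_besselSeries hs w).continuousAt)
  | succ n ih =>
    push_cast
    refine contDiff_succ_iff_deriv.2 ⟨fun w => (hasDerivAt_besselSeries hs w).differentiableAt,
      by simp, ?_⟩
    rw [show deriv (besselSeries s) = fun w => -(1 / 4) * besselSeries (s + 1) w from
      funext fun w => (hasDerivAt_besselSeries hs w).deriv]
    exact contDiff_const.mul (ih (by linarith))

/-- Polynomial growth of Bessel functions. With `f = besselSeries (s + 1)` and
`g = besselSeries (s + 2)`, the energy `f² + w g² / 4` is nonincreasing. -/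
theorem abs_besselSeries_le {s w : ℝ} (hs : 0 < s) (hw : 0 ≤ w) :
    |besselSeries s w| ≤ (s + Real.sqrt w / 2) / Real.Gamma (s + 1) := by
  have hG : 0 < Real.Gamma (s + 1) := Real.Gamma_pos_of_pos (by linarith)
  set f := besselSeries (s + 1) with hf
  set g := besselSeries (s + 2) with hg
  let En : ℝ → ℝ := fun w => f w ^ 2 + w * g w ^ 2 / 4
  have hE : ∀ w, HasDerivAt En (-(s / 2 + 1 / 4) * g w ^ 2) w := fun w => by
    have d1 : HasDerivAt f (-(1 / 4) * g w) w := by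
      have := hasDerivAt_besselSeries (show 0 < s + 1 by linarith) w
      rwa [show s + 1 + 1 = s + 2 by ring] at this
    have d2 := hasDerivAt_besselSeries (show 0 < s + 2 by linarith) w
    have r := besselSeries_recurrence (show 0 < s + 1 by linarith) w
    rw [show s + 1 + 1 = s + 2 by ring, show s + 1 + 2 = s + 2 + 1 by ring] at r
    have := (d1.fun_pow 2).add (((hasDerivAt_id w).mul (d2.fun_pow 2)).div_const 4)
    refine this.congr_deriv ?_
    simp only [← hf, ← hg, id] at r ⊢
    push_cast
    linear_combination (-(g w) / 2) * r
  have hanti : AntitoneOn En (Ici 0) := by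
    refine antitoneOn_of_deriv_nonpos (convex_Ici 0) (fun w _ => (hE w).continuousAt.continuousWithinAt)
      (fun w _ => (hE w).differentiableAt.differentiableWithinAt) fun w _ => ?_
    rw [(hE w).deriv]
    have := sq_nonneg (g w)
    nlinarith
  have hb : En w ≤ (Real.Gamma (s + 1))⁻¹ ^ 2 := by
    refine (hanti self_mem_Ici hw hw).trans (le_of_eq ?_)
    simp [En, hf, besselSeries_zero]
  have h1 : |f w| ≤ (Real.Gamma (s + 1))⁻¹ := by
    refine abs_le_of_sq_le_sq ?_ (by positivity)
    have : 0 ≤ w * g w ^ 2 / 4 := by positivity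
    simp only [En] at hb
    linarith
  have h2 : |Real.sqrt w * g w / 2| ≤ (Real.Gamma (s + 1))⁻¹ := by
    refine abs_le_of_sq_le_sq ?_ (by positivity)
    rw [div_pow, mul_pow, Real.sq_sqrt hw]
    simp only [En] at hb
    have := sq_nonneg (f w)
    linarith
  rw [besselSeries_recurrence hs, ← hf, ← hg]
  have e : s * f w - w / 4 * g w = s * f w - Real.sqrt w / 2 * (Real.sqrt w * g w / 2) := by
    linear_combination (g w / 4) * Real.mul_self_sqrt hw
  rw [e, div_eq_mul_inv _ (Real.Gamma (s + 1)), add_mul]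
  refine (abs_sub _ _).trans (add_le_add ?_ ?_)
  · rw [abs_mul, abs_of_pos hs]
    gcongr
  · rw [abs_mul, abs_of_nonneg (by positivity)]
    gcongr

theorem besselQuotient_eq {s r : ℝ} (hr : 0 ≤ r) :
    besselQuotient s r = 2 ^ (1 - s) * besselSeries s (r ^ 2) := by
  rcases hr.eq_or_lt with rfl | hr
  · rw [besselQuotient, if_pos rfl, zero_pow two_ne_zero, besselSeries_zero, div_eq_mul_inv]
  · rw [besselQuotient, if_neg hr.ne', besselJ, besselSeries, ← tsum_div_const, ← tsum_mul_left]
    refine tsum_congr fun n => ?_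
    rw [show (n : ℝ) + (s - 1) + 1 = n + s by ring, Real.rpow_add (by positivity),
      Real.div_rpow hr.le two_pos.le (s - 1), show (2 : ℝ) * n = ((2 * n : ℕ) : ℝ) by push_cast; ring,
      Real.rpow_natCast, pow_mul, show (1 : ℝ) - s = -(s - 1) by ring, Real.rpow_neg two_pos.le,
      show -r ^ 2 / 4 = -1 * (r / 2) ^ 2 by ring, mul_pow]
    have : 0 < r ^ (s - 1) := by positivity
    field_simp

/-! ### Orbits of Bessel type -/

/-- The series `∑ₖ (-τ)ᵏ / k! * Γ(p + k) / Γ(p + k + δ)`, a multiple of `₁F₁(p; p + δ; -τ)`. -/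
noncomputable def gammaRatioSeries (p δ τ : ℝ) : ℝ :=
  ∑' k : ℕ, (-τ) ^ k / k.factorial * (Real.Gamma (p + k) / Real.Gamma (p + k + δ))

section

variable {p δ : ℝ}

theorem Gamma_div_Gamma_le (hp : 0 < p) (hδ : 0 < p + δ) (k : ℕ) :
    Real.Gamma (p + k) / Real.Gamma (p + k + δ) ≤
      (1 + p / (p + δ)) ^ k * (Real.Gamma p / Real.Gamma (p + δ)) := by
  induction k with
  | zero => simp
  | succ k ih =>
    have h1 : 0 < p + k := by positivity
    have h2 : 0 < p + k + δ := by have := k.cast_nonneg (α := ℝ); linarith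
    have g1 := Real.Gamma_pos_of_pos h1
    have g2 := Real.Gamma_pos_of_pos h2
    have h3 : (p + k) / (p + k + δ) ≤ 1 + p / (p + δ) := by
      rw [div_le_iff₀ h2]
      have h4 : p / (p + δ) * (p + k + δ) = p + p / (p + δ) * k := by field_simp; ring
      have h5 : 0 ≤ p / (p + δ) * k := by positivity
      rw [add_mul, h4, one_mul]
      linarith
    rw [show p + (k + 1 : ℕ) = p + k + 1 by push_cast; ring, show p + k + 1 + δ = p + k + δ + 1 by ring,
      Real.Gamma_add_one h1.ne', Real.Gamma_add_one h2.ne', mul_div_mul_comm, pow_succ']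
    calc _ ≤ (1 + p / (p + δ)) * ((1 + p / (p + δ)) ^ k * (Real.Gamma p / Real.Gamma (p + δ))) := by
          gcongr
      _ = _ := by ring

theorem summable_gammaRatioSeries (hp : 0 < p) (hδ : 0 < p + δ) (τ : ℝ) :
    Summable fun k : ℕ => (-τ) ^ k / k.factorial * (Real.Gamma (p + k) / Real.Gamma (p + k + δ)) := by
  refine Summable.of_norm_bounded ((Real.summable_pow_div_factorial
    (|τ| * (1 + p / (p + δ)))).mul_left (Real.Gamma p / Real.Gamma (p + δ))) fun k => ?_
  have h1 : 0 < p + k := by positivity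
  have h2 : 0 < p + k + δ := by have := k.cast_nonneg (α := ℝ); linarith
  have g1 := Real.Gamma_pos_of_pos h1
  have g2 := Real.Gamma_pos_of_pos h2
  rw [norm_mul, norm_div, norm_pow, norm_neg, Real.norm_eq_abs τ, Real.norm_natCast,
    Real.norm_of_nonneg (by positivity)]
  calc _ ≤ |τ| ^ k / k.factorial * ((1 + p / (p + δ)) ^ k * (Real.Gamma p / Real.Gamma (p + δ))) := by
        gcongr
        exact Gamma_div_Gamma_le hp hδ k
    _ = _ := by rw [mul_pow]; ring

theorem measurable_gammaRatioSeries (hp : 0 < p) (hδ : 0 < p + δ) :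
    Measurable (gammaRatioSeries p δ) :=
  measurable_of_tendsto_metrizable (f := fun n τ => ∑ k ∈ Finset.range n, (-τ) ^ k / k.factorial *
      (Real.Gamma (p + k) / Real.Gamma (p + k + δ))) (fun n => by fun_prop)
    (tendsto_pi_nhds.2 fun τ => (summable_gammaRatioSeries hp hδ τ).hasSum.tendsto_sum_nat)

theorem gammaRatioSeries_recurrence (hp : 0 < p) (hδ : 0 < p + δ) (τ : ℝ) :
    gammaRatioSeries p δ τ =
      (p + δ) * gammaRatioSeries p (δ + 1) τ - τ * gammaRatioSeries (p + 1) (δ + 1) τ := by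
  have s1 := (summable_gammaRatioSeries hp (show 0 < p + (δ + 1) by linarith) τ).mul_left (p + δ)
  have s2 := (summable_gammaRatioSeries (show 0 < p + 1 by linarith)
    (show 0 < p + 1 + (δ + 1) by linarith) τ).mul_left (-τ)
  let f : ℕ → ℝ := fun k => k * ((-τ) ^ k / k.factorial *
    (Real.Gamma (p + k) / Real.Gamma (p + k + (δ + 1))))
  have hf : ∀ k, f (k + 1) = -τ * ((-τ) ^ k / k.factorial *
      (Real.Gamma (p + 1 + k) / Real.Gamma (p + 1 + k + (δ + 1)))) := fun k => by
    simp only [f]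
    rw [Nat.factorial_succ, show p + ((k + 1 : ℕ) : ℝ) = p + 1 + k by push_cast; ring]
    push_cast
    have : Real.Gamma (p + 1 + k + (δ + 1)) ≠ 0 :=
      (Real.Gamma_pos_of_pos (by have := k.cast_nonneg (α := ℝ); linarith)).ne'
    field_simp
    ring
  have hfs : Summable f := by
    rw [← summable_nat_add_iff 1]
    exact s2.congr fun k => (hf k).symm
  have e1 : ∑' k, f k = -τ * gammaRatioSeries (p + 1) (δ + 1) τ := by
    rw [hfs.tsum_eq_zero_add, gammaRatioSeries, ← tsum_mul_left]
    simp only [hf]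
    simp [f]
  have e2 : gammaRatioSeries p δ τ = (p + δ) * gammaRatioSeries p (δ + 1) τ + ∑' k, f k := by
    rw [gammaRatioSeries, gammaRatioSeries, ← tsum_mul_left, ← s1.tsum_add hfs]
    refine tsum_congr fun k => ?_
    have h2 : 0 < p + k + δ := by have := k.cast_nonneg (α := ℝ); linarith
    have := Real.Gamma_pos_of_pos h2
    simp only [f]
    rw [← add_assoc (p + k) δ 1, Real.Gamma_add_one h2.ne']
    field_simp
    ring
  rw [e2, e1]
  ring

theorem integral_rpow_mul_one_sub_rpow (hp : 0 < p) (hδ : 0 < δ) :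
    IntegrableOn (fun ρ : ℝ => ρ ^ (p - 1) * (1 - ρ) ^ (δ - 1)) (Ioo 0 1) ∧
    ∫ ρ in Ioo (0 : ℝ) 1, ρ ^ (p - 1) * (1 - ρ) ^ (δ - 1) =
      Real.Gamma p * Real.Gamma δ / Real.Gamma (p + δ) := by
  have hb : 0 < ProbabilityTheory.beta p δ := ProbabilityTheory.beta_pos hp hδ
  have h := ProbabilityTheory.lintegral_betaPDF_eq_one hp hδ
  rw [ProbabilityTheory.lintegral_betaPDF] at h
  have h2 : ∫ ρ in Ioo (0 : ℝ) 1, 1 / ProbabilityTheory.beta p δ * ρ ^ (p - 1) * (1 - ρ) ^ (δ - 1) =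
      1 := by
    rw [integral_eq_lintegral_of_nonneg_ae ?_ (Measurable.aestronglyMeasurable (by fun_prop)), h,
      ENNReal.toReal_one]
    refine (ae_restrict_iff' measurableSet_Ioo).2 (ae_of_all _ fun ρ hρ => ?_)
    have h1 : 0 < ρ := hρ.1
    have h2 : 0 < 1 - ρ := by linarith [hρ.2]
    simp only [Pi.zero_apply]
    positivity
  simp_rw [mul_assoc] at h2
  rw [integral_const_mul] at h2
  have h3 : ∫ ρ in Ioo (0 : ℝ) 1, ρ ^ (p - 1) * (1 - ρ) ^ (δ - 1) =
      Real.Gamma p * Real.Gamma δ / Real.Gamma (p + δ) := by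
    change _ = ProbabilityTheory.beta p δ
    field_simp at h2
    exact h2
  refine ⟨Integrable.of_integral_ne_zero ?_, h3⟩
  rw [h3]
  exact hb.ne'

/-- Euler's integral for `₁F₁`. -/
theorem gammaRatioSeries_eq_integral (hp : 0 < p) (hδ : 0 < δ) (τ : ℝ) :
    gammaRatioSeries p δ τ = ∫ ρ in Ioo (0 : ℝ) 1,
      ρ ^ (p - 1) * (1 - ρ) ^ (δ - 1) / Real.Gamma δ * Real.exp (-(ρ * τ)) := by
  have hG := Real.Gamma_pos_of_pos hδ
  have hpk : ∀ k : ℕ, 0 < p + k := fun k => by positivity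
  let F : ℕ → ℝ → ℝ := fun k ρ =>
    ρ ^ (p - 1) * (1 - ρ) ^ (δ - 1) / Real.Gamma δ * ((-(ρ * τ)) ^ k / k.factorial)
  have eF : ∀ k, EqOn (F k) (fun ρ => (-τ) ^ k / k.factorial / Real.Gamma δ *
      (ρ ^ (p + k - 1) * (1 - ρ) ^ (δ - 1))) (Ioo 0 1) := fun k ρ hρ => by
    simp only [F]
    rw [show p + k - 1 = (p - 1) + k by ring, Real.rpow_add hρ.1, Real.rpow_natCast,
      show -(ρ * τ) = ρ * -τ by ring, mul_pow]
    ring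
  have hi : ∀ k, IntegrableOn (F k) (Ioo 0 1) := fun k =>
    IntegrableOn.congr_fun ((integral_rpow_mul_one_sub_rpow (hpk k) hδ).1.const_mul _) (eF k).symm
      measurableSet_Ioo
  have key := hasSum_integral_of_summable_integral_norm (μ := volume.restrict (Ioo (0 : ℝ) 1))
    (F := F) hi ?_
  · have e : ∀ ρ : ℝ, ρ ^ (p - 1) * (1 - ρ) ^ (δ - 1) / Real.Gamma δ * Real.exp (-(ρ * τ)) =
        ∑' k, F k ρ := fun ρ => by
      rw [Real.exp_eq_exp_ℝ, NormedSpace.exp_eq_tsum_div, ← tsum_mul_left]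
    simp_rw [e]
    rw [← key.tsum_eq, gammaRatioSeries]
    refine tsum_congr fun k => ?_
    rw [setIntegral_congr_fun measurableSet_Ioo (eF k), integral_const_mul,
      (integral_rpow_mul_one_sub_rpow (hpk k) hδ).2]
    field_simp
  · refine (summable_gammaRatioSeries hp (show 0 < p + δ by linarith) (-|τ|)).congr fun k => ?_
    have e : EqOn (fun ρ => ‖F k ρ‖) (fun ρ => |τ| ^ k / k.factorial / Real.Gamma δ *
        (ρ ^ (p + k - 1) * (1 - ρ) ^ (δ - 1))) (Ioo 0 1) := fun ρ hρ => by
      have h1 : 0 < ρ := hρ.1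
      have h2 : 0 < 1 - ρ := by linarith [hρ.2]
      simp only
      rw [eF k hρ, norm_mul, norm_div, norm_div, norm_pow, norm_neg, Real.norm_eq_abs τ,
        Real.norm_natCast, Real.norm_of_nonneg hG.le, Real.norm_of_nonneg (by positivity)]
    rw [setIntegral_congr_fun measurableSet_Ioo e, integral_const_mul,
      (integral_rpow_mul_one_sub_rpow (hpk k) hδ).2, neg_neg]
    field_simp

end

namespace HasFracPower

variable {a : ℝ}

/-- For `δ > 0`, Euler's integral writes the orbit as a superposition of exponential orbits. The
bound is uniform in `p ≥ p₀`. -/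
theorem gammaRatioSeries_of_pos (h0 : 0 < a) {p₀ δ : ℝ} (hp₀ : 0 < p₀) (hδ : 0 < δ) (j : ℕ) :
    ∃ C, 0 ≤ C ∧ ∀ p, p₀ ≤ p → HasFracPower a C (fun τ => τ ^ j * gammaRatioSeries (p + j) δ τ)
      ((ascPochhammer ℝ j).eval (-a) * (Real.Gamma (p + a) / Real.Gamma (p + a + δ))) := by
  have hG := Real.Gamma_pos_of_pos hδ
  let M : ℝ → ℝ := fun ρ => 4 * j.factorial / Real.Gamma δ * (ρ ^ (p₀ - 1) * (1 - ρ) ^ (δ - 1))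
  have hM : IntegrableOn M (Ioo 0 1) := (integral_rpow_mul_one_sub_rpow hp₀ hδ).1.const_mul _
  refine ⟨∫ ρ in Ioo (0 : ℝ) 1, M ρ, setIntegral_nonneg measurableSet_Ioo fun ρ hρ => ?_,
    fun p hp => ?_⟩
  · have h1 : 0 < ρ := hρ.1
    have h2 : 0 < 1 - ρ := by linarith [hρ.2]
    simp only [M]
    positivity
  have hp0 : 0 < p := hp₀.trans_le hp
  let b : ℝ → ℝ := fun ρ => ρ ^ (p - 1) * (1 - ρ) ^ (δ - 1) / Real.Gamma δ
  have key := integral_param (μ := volume.restrict (Ioo (0 : ℝ) 1)) (a := a)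
    (g := fun ρ τ => b ρ * ((ρ * τ) ^ j * Real.exp (-(ρ * τ)))) (M := M)
    (c := fun ρ => b ρ * (ρ ^ a * (ascPochhammer ℝ j).eval (-a))) h0 ?_ hM ?_
  · have e : EqOn (fun ρ => b ρ * (ρ ^ a * (ascPochhammer ℝ j).eval (-a))) (fun ρ =>
        (ascPochhammer ℝ j).eval (-a) / Real.Gamma δ * (ρ ^ (p + a - 1) * (1 - ρ) ^ (δ - 1)))
        (Ioo 0 1) := fun ρ hρ => by
      simp only [b]
      rw [show p + a - 1 = (p - 1) + a by ring, Real.rpow_add hρ.1]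
      ring
    rw [setIntegral_congr_fun measurableSet_Ioo e,
      integral_const_mul ((ascPochhammer ℝ j).eval (-a) / Real.Gamma δ),
      (integral_rpow_mul_one_sub_rpow (show 0 < p + a by positivity) hδ).2] at key
    convert! key.congr (h' := fun τ => τ ^ j * gammaRatioSeries (p + j) δ τ) fun τ hτ => ?_ using 1
    · field_simp
    rw [gammaRatioSeries_eq_integral (by positivity) hδ, ← integral_const_mul]
    refine setIntegral_congr_fun measurableSet_Ioo fun ρ hρ => ?_
    simp only [b]
    rw [show p + j - 1 = (p - 1) + j by ring, Real.rpow_add hρ.1, Real.rpow_natCast, mul_pow]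
    ring
  · simp only [Function.uncurry_def, b]
    fun_prop
  · refine (ae_restrict_iff' measurableSet_Ioo).2 (ae_of_all _ fun ρ hρ => ?_)
    have h1 : 0 < ρ := hρ.1
    have h2 : 0 < 1 - ρ := by linarith [hρ.2]
    refine (((pow_mul_exp_neg h0 j).comp_mul h1).const_mul (b ρ)).mono ?_
    simp only [M, b]
    rw [abs_of_nonneg (by positivity)]
    have h3 : ρ ^ (p - 1) ≤ ρ ^ (p₀ - 1) := Real.rpow_le_rpow_of_exponent_ge h1 hρ.2.le (by linarith)
    calc _ ≤ ρ ^ (p₀ - 1) * (1 - ρ) ^ (δ - 1) / Real.Gamma δ * (2 * j.factorial * (1 + 1)) := by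
          gcongr
          exact hρ.2.le
      _ = _ := by ring

/-- The values for all `δ`, by induction on the number of unit steps that `δ` is below the range of
Euler's integral: the recurrence lowers `δ` by `1` at the expense of a factor growing linearly in
`p`. -/
theorem exists_gammaRatioSeries (h0 : 0 < a) {p₀ : ℝ} (hp₀ : 0 < p₀) (N : ℕ) :
    ∀ δ : ℝ, -(N : ℝ) < δ → ∀ j : ℕ, ∃ C, 0 ≤ C ∧ ∀ p, p₀ ≤ p → 0 < p + δ →
      HasFracPower a (C * Real.exp (N * p)) (fun τ => τ ^ j * gammaRatioSeries (p + j) δ τ)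
        ((ascPochhammer ℝ j).eval (-a) * (Real.Gamma (p + a) / Real.Gamma (p + a + δ))) := by
  induction N with
  | zero =>
    intro δ hδ j
    obtain ⟨C, hC, h⟩ := gammaRatioSeries_of_pos h0 hp₀ (by simpa using hδ) j
    exact ⟨C, hC, fun p hp _ => by simpa using h p hp⟩
  | succ N ih =>
    intro δ hδ j
    push_cast at hδ ⊢
    obtain ⟨C, hC, h⟩ := ih (δ + 1) (by linarith) j
    obtain ⟨C', hC', h'⟩ := ih (δ + 1) (by linarith) (j + 1)
    refine ⟨(1 + j + |δ|) * C + C', by positivity, fun p hp hpδ => ?_⟩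
    have hp0 : 0 < p := hp₀.trans_le hp
    have H := ((h p hp (by linarith)).const_mul (p + j + δ)).add h0
      ((h' p hp (by linarith)).const_mul (-1))
    have hpa : 0 < p + a + δ := by linarith
    have hc : (p + j + δ) * ((ascPochhammer ℝ j).eval (-a) *
        (Real.Gamma (p + a) / Real.Gamma (p + a + (δ + 1)))) + -1 *
        ((ascPochhammer ℝ (j + 1)).eval (-a) * (Real.Gamma (p + a) / Real.Gamma (p + a + (δ + 1)))) =
        (ascPochhammer ℝ j).eval (-a) * (Real.Gamma (p + a) / Real.Gamma (p + a + δ)) := by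
      have := Real.Gamma_pos_of_pos hpa
      rw [ascPochhammer_succ_eval, ← add_assoc, Real.Gamma_add_one hpa.ne']
      field_simp
      ring
    rw [hc] at H
    refine (H.congr fun τ hτ => ?_).mono ?_
    · rw [gammaRatioSeries_recurrence (by positivity) (by have := j.cast_nonneg (α := ℝ); linarith),
        show p + ((j + 1 : ℕ) : ℝ) = p + j + 1 by push_cast; ring]
      ring
    · have h1 : |p + j + δ| ≤ (1 + j + |δ|) * Real.exp p := by
        have e1 : p ≤ Real.exp p := by linarith [Real.add_one_le_exp p]
        have e2 : 1 ≤ Real.exp p := Real.one_le_exp hp0.le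
        have e3 : |p + j + δ| ≤ p + j + |δ| := by
          refine (abs_add_le _ _).trans ?_
          rw [abs_of_nonneg (show 0 ≤ p + j by positivity)]
        have e4 : (j + |δ|) * 1 ≤ (j + |δ|) * Real.exp p := by gcongr
        linarith
      have h2 : Real.exp (N * p) ≤ Real.exp ((N + 1) * p) := by
        rw [Real.exp_le_exp]
        nlinarith
      rw [abs_neg, abs_one, one_mul, add_mul]
      refine add_le_add ?_ (by gcongr)
      calc _ ≤ (1 + j + |δ|) * Real.exp p * (C * Real.exp (N * p)) := by gcongr
        _ = _ := by
          rw [add_mul (N : ℝ) 1 p, Real.exp_add, one_mul]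
          ring

/-- The heat orbit of a Bessel function. The exponential bounds of `exists_gammaRatioSeries` are
harmless against the factorials of the series over `m`. -/
theorem exists_bessel (h0 : 0 < a) {ϑ s w : ℝ} (hϑ : 0 < ϑ) (hs : 0 < s) (hw : 0 ≤ w) :
    ∃ M, HasFracPower a M (fun τ => ∑' m : ℕ, (-w / 4) ^ m / (m.factorial * Real.Gamma (m + ϑ)) *
        gammaRatioSeries (m + ϑ) (s - ϑ) τ)
      (Real.Gamma (ϑ + a) / (Real.Gamma ϑ * Real.Gamma (s + a)) *
        oneFTwo (ϑ + a) (s + a) ϑ (-(1 / 4) * w)) := by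
  obtain ⟨N, hN⟩ := exists_nat_gt (ϑ - s)
  obtain ⟨C, hC, h⟩ := exists_gammaRatioSeries h0 hϑ N (s - ϑ) (by linarith) 0
  obtain ⟨K, hK, hG⟩ := exists_inv_Gamma_le hϑ
  have hΓ : ∀ m : ℕ, 0 < Real.Gamma (m + ϑ) := fun m => Real.Gamma_pos_of_pos (by positivity)
  have hpδ : ∀ m : ℕ, 0 < (m : ℝ) + ϑ + (s - ϑ) := fun m => by
    have := m.cast_nonneg (α := ℝ); linarith
  have H : ∀ m : ℕ, HasFracPower a ((w / 4) ^ m / (m.factorial * Real.Gamma (m + ϑ)) *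
      (C * Real.exp (N * (m + ϑ)))) (fun τ => (-w / 4) ^ m / (m.factorial * Real.Gamma (m + ϑ)) *
        gammaRatioSeries (m + ϑ) (s - ϑ) τ) ((-w / 4) ^ m / (m.factorial * Real.Gamma (m + ϑ)) *
        (Real.Gamma (m + ϑ + a) / Real.Gamma (m + ϑ + a + (s - ϑ)))) := fun m => by
    have hm := m.cast_nonneg (α := ℝ)
    have h1 := (h (m + ϑ) (by linarith) (hpδ m)).const_mul
      ((-w / 4) ^ m / (m.factorial * Real.Gamma (m + ϑ)))
    simp only [pow_zero, one_mul, Nat.cast_zero, add_zero, ascPochhammer_zero,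
      Polynomial.eval_one] at h1
    refine h1.mono (le_of_eq ?_)
    have := hΓ m
    rw [abs_div, abs_pow, abs_div, abs_neg, abs_of_nonneg hw, abs_of_pos (show 0 < m.factorial *
      Real.Gamma (m + ϑ) by positivity), abs_of_pos (show (0 : ℝ) < 4 by norm_num)]
  have hsum : Summable fun m : ℕ => (w / 4) ^ m / (m.factorial * Real.Gamma (m + ϑ)) *
      (C * Real.exp (N * (m + ϑ))) := by
    refine Summable.of_nonneg_of_le (fun m => by have := hΓ m; positivity) (fun m => ?_)
      ((Real.summable_pow_div_factorial (w / 4 * 2 * Real.exp N)).mul_left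
        (K * C * Real.exp (N * ϑ)))
    have hm := hΓ m
    have hn : (1 : ℝ) ≤ m.factorial := by
      exact_mod_cast Nat.one_le_iff_ne_zero.2 m.factorial_ne_zero
    calc _ = (w / 4) ^ m / m.factorial * (Real.Gamma (m + ϑ))⁻¹ * (C * Real.exp (N * (m + ϑ))) := by
          field_simp
      _ ≤ (w / 4) ^ m / m.factorial * (K * 2 ^ m / 1) * (C * Real.exp (N * (m + ϑ))) := by
          gcongr
          refine (hG m).trans ?_
          gcongr
      _ = _ := by
          rw [mul_add, Real.exp_add, mul_comm (N : ℝ) m, Real.exp_nat_mul, mul_pow, mul_pow]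
          ring
  have key := HasFracPower.tsum h0 (fun m => measurable_const.mul
    (measurable_gammaRatioSeries (by positivity) (hpδ m))) hsum H
  have hsa : 0 < s + a := by linarith
  have hv : ∑' m : ℕ, (-w / 4) ^ m / (m.factorial * Real.Gamma (m + ϑ)) *
      (Real.Gamma (m + ϑ + a) / Real.Gamma (m + ϑ + a + (s - ϑ))) =
      Real.Gamma (ϑ + a) / (Real.Gamma ϑ * Real.Gamma (s + a)) *
        oneFTwo (ϑ + a) (s + a) ϑ (-(1 / 4) * w) := by
    rw [oneFTwo, hypSeries, ← tsum_mul_left]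
    refine tsum_congr fun m => ?_
    have p1 := ascPochhammer_pos m ϑ hϑ
    have p2 := ascPochhammer_pos m (s + a) hsa
    have p3 := Real.Gamma_pos_of_pos hϑ
    have p4 := Real.Gamma_pos_of_pos hsa
    rw [show (m : ℝ) + ϑ + a = ϑ + a + m by ring, show ϑ + a + m + (s - ϑ) = s + a + m by ring,
      show (m : ℝ) + ϑ = ϑ + m by ring, Gamma_add_nat hϑ, Gamma_add_nat hsa,
      Gamma_add_nat (show 0 < ϑ + a by positivity), show -(1 / 4) * w = -w / 4 by ring]
    simp only [List.map_cons, List.map_nil, List.prod_cons, List.prod_nil, mul_one]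
    field_simp
  rw [hv] at key
  exact ⟨_, key⟩

end HasFracPower

/-! ### Bessel type functions -/

/-- The series of a Bessel function is dominated by that of `K cosh (2r)`. -/
theorem abs_besselSeries_term_le {s : ℝ} (hs : 0 < s) :
    ∃ K, 0 < K ∧ ∀ (n : ℕ) (r : ℝ), |(-r ^ 2 / 4) ^ n / (n.factorial * Real.Gamma (n + s))| ≤
      K * ((2 * r) ^ (2 * n) / (2 * n).factorial) := by
  obtain ⟨K, hK, h⟩ := exists_inv_Gamma_le hs
  refine ⟨K, hK, fun n r => ?_⟩
  have hΓ : 0 < Real.Gamma (n + s) := Real.Gamma_pos_of_pos (by positivity)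
  have h1 : ((2 * n).factorial : ℝ) ≤ 4 ^ n * (n.factorial * n.factorial) := by
    have h2 := Nat.add_choose_mul_factorial_mul_factorial n n
    have h3 := Nat.choose_le_two_pow (n + n) n
    rw [← two_mul, pow_mul] at h3
    rw [← two_mul] at h2
    rw [← h2]
    push_cast
    rw [mul_assoc]
    gcongr
    exact_mod_cast h3
  rw [abs_div, abs_pow, abs_div, abs_neg, abs_of_nonneg (sq_nonneg r), abs_of_pos (show (0 : ℝ) < 4 by
    norm_num), abs_of_pos (show 0 < n.factorial * Real.Gamma (n + s) by positivity)]
  calc _ = (r ^ 2 / 4) ^ n / n.factorial * (Real.Gamma (n + s))⁻¹ := by field_simp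
    _ ≤ (r ^ 2 / 4) ^ n / n.factorial * (K * 2 ^ n / n.factorial) := by gcongr; exact h n
    _ = K * (2 * r ^ 2) ^ n / (4 ^ n * (n.factorial * n.factorial)) := by
        rw [div_pow, mul_pow]
        field_simp
    _ ≤ K * (4 * r ^ 2) ^ n / (2 * n).factorial := by gcongr; norm_num
    _ = _ := by
        rw [pow_mul, mul_pow 2 r 2]
        norm_num
        ring

/-- Exponential growth is absorbed by doubling the time in the heat kernel. -/
theorem cosh_mul_heatKernel_le {τ : ℝ} (hτ : 0 < τ) (x y : E d) :
    Real.cosh (2 * ‖y‖) * heatKernel d τ (x - y) ≤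
      Real.exp (2 * ‖x‖ + 8 * τ) * 2 ^ ((d : ℝ) / 2) * heatKernel d (2 * τ) (x - y) := by
  have hp := Real.pi_pos
  set z := x - y with hz
  have hy : ‖y‖ ≤ ‖x‖ + ‖z‖ := by
    have := norm_sub_le x z
    rwa [hz, sub_sub_cancel] at this
  have h1 : Real.cosh (2 * ‖y‖) ≤ Real.exp (2 * ‖y‖) := by
    rw [Real.cosh_eq]
    have : Real.exp (-(2 * ‖y‖)) ≤ Real.exp (2 * ‖y‖) := by
      rw [Real.exp_le_exp]
      linarith [norm_nonneg y]
    linarith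
  have h2 : 2 * ‖z‖ ≤ ‖z‖ ^ 2 / (8 * τ) + 8 * τ := by
    have : ‖z‖ ^ 2 / (8 * τ) + 8 * τ - 2 * ‖z‖ = (‖z‖ - 8 * τ) ^ 2 / (8 * τ) := by
      field_simp
      ring
    have h3 : 0 ≤ (‖z‖ - 8 * τ) ^ 2 / (8 * τ) := by positivity
    linarith
  have h3 : heatKernel d τ z =
      2 ^ ((d : ℝ) / 2) * heatKernel d (2 * τ) z * Real.exp (-(‖z‖ ^ 2 / (8 * τ))) := by
    rw [heatKernel, heatKernel, show 4 * Real.pi * (2 * τ) = 2 * (4 * Real.pi * τ) by ring,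
      neg_div (2 : ℝ) (d : ℝ),
      Real.mul_rpow two_pos.le (show 0 ≤ 4 * Real.pi * τ by positivity), Real.rpow_neg two_pos.le,
      show -‖z‖ ^ 2 / (4 * τ) = -‖z‖ ^ 2 / (4 * (2 * τ)) + -(‖z‖ ^ 2 / (8 * τ)) by field_simp; ring,
      Real.exp_add]
    have : (0 : ℝ) < 2 ^ ((d : ℝ) / 2) := by positivity
    field_simp
  have h4 : 0 < heatKernel d (2 * τ) z := heatKernel_pos (by positivity) z
  rw [h3]
  calc _ ≤ Real.exp (2 * ‖y‖) * (2 ^ ((d : ℝ) / 2) * heatKernel d (2 * τ) z *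
        Real.exp (-(‖z‖ ^ 2 / (8 * τ)))) := by gcongr
    _ = Real.exp (2 * ‖y‖ + -(‖z‖ ^ 2 / (8 * τ))) * 2 ^ ((d : ℝ) / 2) * heatKernel d (2 * τ) z := by
        rw [Real.exp_add]; ring
    _ ≤ _ := by
        refine mul_le_mul_of_nonneg_right (mul_le_mul_of_nonneg_right (Real.exp_le_exp.2 ?_)
          (by positivity)) h4.le
        linarith

/-- The double series of the heat orbit of a Bessel function, summed in two ways. -/
theorem tsum_gammaRatioSeries {ϑ s w τ : ℝ} (hϑ : 0 < ϑ) (hs : 0 < s) (hw : 0 ≤ w) (hτ : 0 < τ) :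
    ∑' n : ℕ, ∑ k ∈ Finset.range (n + 1), (-w / 4) ^ (n - k) /
        ((n - k).factorial * Real.Gamma ((n - k : ℕ) + ϑ)) *
        ((-τ) ^ k / k.factorial * (Real.Gamma (n + ϑ) / Real.Gamma (n + s))) =
      ∑' m : ℕ, (-w / 4) ^ m / (m.factorial * Real.Gamma (m + ϑ)) *
        gammaRatioSeries (m + ϑ) (s - ϑ) τ := by
  obtain ⟨K, hK, hG⟩ := exists_inv_Gamma_le hϑ
  have hc : 0 < Real.Gamma ϑ / Real.Gamma (ϑ + (s - ϑ)) :=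
    div_pos (Real.Gamma_pos_of_pos hϑ) (Real.Gamma_pos_of_pos (by linarith))
  set c := Real.Gamma ϑ / Real.Gamma (ϑ + (s - ϑ)) with hcdef
  set r := 1 + ϑ / (ϑ + (s - ϑ)) with hr
  have hr0 : 0 < r := by
    rw [hr, add_sub_cancel]
    positivity
  let G : ℕ × ℕ → ℝ := fun q => (-w / 4) ^ q.2 / (q.2.factorial * Real.Gamma (q.2 + ϑ)) *
    ((-τ) ^ q.1 / q.1.factorial * (Real.Gamma (q.2 + ϑ + q.1) / Real.Gamma (q.2 + ϑ + q.1 + (s - ϑ))))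
  have hsum : Summable G := by
    have s1 := (Real.summable_pow_div_factorial (τ * r)).mul_of_nonneg
      (Real.summable_pow_div_factorial (w / 4 * 2 * r)) (fun k => by simp only [Pi.zero_apply]; positivity)
      (fun k => by simp only [Pi.zero_apply]; positivity)
    refine Summable.of_norm_bounded (s1.mul_left (K * c)) fun q => ?_
    obtain ⟨k, m⟩ := q
    have p1 : 0 < Real.Gamma (m + ϑ) := Real.Gamma_pos_of_pos (by positivity)
    have hmk : (0 : ℝ) ≤ ((m + k : ℕ) : ℝ) := by positivity
    have p2 : 0 < Real.Gamma (m + ϑ + k) := Real.Gamma_pos_of_pos (by positivity)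
    have p3 : 0 < Real.Gamma (m + ϑ + k + (s - ϑ)) :=
      Real.Gamma_pos_of_pos (by push_cast at hmk; linarith)
    have hn : (1 : ℝ) ≤ m.factorial := by
      exact_mod_cast Nat.one_le_iff_ne_zero.2 m.factorial_ne_zero
    have b := Gamma_div_Gamma_le hϑ (show 0 < ϑ + (s - ϑ) by linarith) (m + k)
    rw [← hcdef, ← hr, show ϑ + ((m + k : ℕ) : ℝ) = m + ϑ + k by push_cast; ring] at b
    have e : ‖G (k, m)‖ = (w / 4) ^ m / m.factorial * (Real.Gamma (m + ϑ))⁻¹ * (τ ^ k / k.factorial *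
        (Real.Gamma (m + ϑ + k) / Real.Gamma (m + ϑ + k + (s - ϑ)))) := by
      simp only [G]
      rw [norm_mul, norm_mul, norm_div, norm_div, norm_pow, norm_pow, norm_div, norm_neg, norm_neg,
        Real.norm_of_nonneg hw, Real.norm_of_nonneg hτ.le, Real.norm_of_nonneg (show 0 ≤ m.factorial *
          Real.Gamma (m + ϑ) by positivity), Real.norm_of_nonneg (show 0 ≤ Real.Gamma (m + ϑ + k) /
          Real.Gamma (m + ϑ + k + (s - ϑ)) by positivity), Real.norm_natCast,
        Real.norm_of_nonneg (show (0 : ℝ) ≤ 4 by norm_num)]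
      field_simp
    rw [e]
    calc _ ≤ (w / 4) ^ m / m.factorial * (K * 2 ^ m / 1) * (τ ^ k / k.factorial *
          (r ^ (m + k) * c)) := by
          gcongr
          refine (hG m).trans ?_
          gcongr
      _ = _ := by
          simp only [mul_pow, pow_add]
          ring
  have e1 : ∑' q, G q = ∑' m : ℕ, (-w / 4) ^ m / (m.factorial * Real.Gamma (m + ϑ)) *
        gammaRatioSeries (m + ϑ) (s - ϑ) τ := by
    rw [← (Equiv.prodComm ℕ ℕ).tsum_eq]
    refine (Summable.tsum_prod ((Equiv.prodComm ℕ ℕ).summable_iff.2 hsum)).trans ?_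
    refine tsum_congr fun m => ?_
    rw [gammaRatioSeries, ← tsum_mul_left]
    rfl
  have e2 : ∑' q, G q = ∑' n : ℕ, ∑ q ∈ Finset.HasAntidiagonal.antidiagonal n, G q := by
    rw [← Finset.HasAntidiagonal.sigmaAntidiagonalEquivProd.tsum_eq]
    refine (Summable.tsum_sigma' (fun n => (hasSum_fintype _).summable)
      (Finset.HasAntidiagonal.sigmaAntidiagonalEquivProd.summable_iff.2 hsum)).trans ?_
    refine tsum_congr fun n => ?_
    rw [tsum_fintype]
    exact Finset.sum_coe_sort (Finset.HasAntidiagonal.antidiagonal n) G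
  rw [← e1, e2]
  refine tsum_congr fun n => ?_
  rw [Finset.Nat.sum_antidiagonal_eq_sum_range_succ (fun k m => G (k, m))]
  refine Finset.sum_congr rfl fun k hk => ?_
  have hkn : k ≤ n := by simpa [Nat.lt_succ_iff] using hk
  simp only [G]
  rw [show (((n - k : ℕ) : ℝ) + ϑ + k) = n + ϑ by push_cast [hkn]; ring,
    show (n : ℝ) + ϑ + (s - ϑ) = n + s by ring]

theorem gammaRatioSeries_zero (p δ : ℝ) :
    gammaRatioSeries p δ 0 = Real.Gamma p / Real.Gamma (p + δ) := by
  rw [gammaRatioSeries, tsum_eq_single 0]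
  · simp
  · intro n hn
    simp [hn]

section

variable {V : MvPolynomial (Fin d) ℂ} {l : ℕ} {ϑ s : ℝ}

/-- The heat flow of a solid harmonic times a Bessel function, term by term from the heat flow of
`V(x) |x|^{2n}`. -/
theorem integral_besselSeries_mul_heatKernel (hV : IsSolidHarmonic V l)
    (hϑ : ϑ = (d : ℝ) / 2 + l) (hϑ0 : 0 < ϑ) (hs : 0 < s) (x : E d) {τ : ℝ} (hτ : 0 < τ) :
    ∫ y, polyVal V y * (besselSeries s (‖y‖ ^ 2) : ℂ) * heatKernel d τ (x - y) =
      polyVal V x * ((∑' m : ℕ, (-‖x‖ ^ 2 / 4) ^ m / (m.factorial * Real.Gamma (m + ϑ)) *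
        gammaRatioSeries (m + ϑ) (s - ϑ) τ : ℝ) : ℂ) := by
  obtain ⟨K, hK, hb⟩ := abs_besselSeries_term_le hs
  let F : ℕ → E d → ℂ := fun n y => polyVal V y *
    (((-‖y‖ ^ 2 / 4) ^ n / (n.factorial * Real.Gamma (n + s)) : ℝ) : ℂ) * heatKernel d τ (x - y)
  let bound : ℕ → E d → ℝ := fun n y => ‖polyVal V y‖ * K * heatKernel d τ (x - y) *
    ((2 * ‖y‖) ^ (2 * n) / (2 * n).factorial)
  have hk : ∀ y, 0 < heatKernel d τ (x - y) := fun y => heatKernel_pos hτ _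
  have hbs : ∀ y, HasSum (fun n => bound n y)
      (‖polyVal V y‖ * K * heatKernel d τ (x - y) * Real.cosh (2 * ‖y‖)) := fun y =>
    (Real.hasSum_cosh _).mul_left _
  have key := hasSum_integral_of_dominated_convergence (μ := volume) (F := F)
    (f := fun y => polyVal V y * (besselSeries s (‖y‖ ^ 2) : ℂ) * heatKernel d τ (x - y)) bound
    (fun n => ?_) (fun n => ae_of_all _ fun y => ?_) (ae_of_all _ fun y => (hbs y).summable) ?_
    (ae_of_all _ fun y => ?_)
  · rw [← key.tsum_eq, ← tsum_gammaRatioSeries hϑ0 hs (sq_nonneg ‖x‖) hτ, Complex.ofReal_tsum,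
      ← tsum_mul_left]
    refine tsum_congr fun n => ?_
    have hΓ : Real.Gamma (n + ϑ) ≠ 0 := (Real.Gamma_pos_of_pos (by positivity)).ne'
    have hΓs : Real.Gamma (n + s) ≠ 0 := (Real.Gamma_pos_of_pos (by positivity)).ne'
    have e : ∀ y, F n y = (((-1) ^ n * (Real.Gamma (n + ϑ) / Real.Gamma (n + s)) : ℝ) : ℂ) *
        (polyVal (harmonicTower V ϑ n) y * heatKernel d τ (x - y)) := fun y => by
      simp only [F]
      rw [polyVal_harmonicTower]
      have : (-‖y‖ ^ 2 / 4) ^ n / (n.factorial * Real.Gamma (n + s)) =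
          (-1) ^ n * (Real.Gamma (n + ϑ) / Real.Gamma (n + s)) *
          ((‖y‖ ^ 2 / 4) ^ n / (n.factorial * Real.Gamma (n + ϑ))) := by
        rw [neg_div, neg_pow]
        field_simp
      rw [this]
      push_cast
      ring
    simp_rw [e]
    rw [integral_const_mul, integral_harmonicTower hV hϑ hϑ0 n x hτ, Complex.ofReal_sum,
      Finset.mul_sum, Finset.mul_sum]
    refine Finset.sum_congr rfl fun k hk => ?_
    have hkn : k ≤ n := by simpa [Nat.lt_succ_iff] using hk
    rw [polyVal_harmonicTower]
    have : (-‖x‖ ^ 2 / 4) ^ (n - k) / ((n - k).factorial * Real.Gamma ((n - k : ℕ) + ϑ)) *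
        ((-τ) ^ k / k.factorial * (Real.Gamma (n + ϑ) / Real.Gamma (n + s))) =
        (-1) ^ n * (Real.Gamma (n + ϑ) / Real.Gamma (n + s)) * (τ ^ k / k.factorial) *
        ((‖x‖ ^ 2 / 4) ^ (n - k) / ((n - k).factorial * Real.Gamma ((n - k : ℕ) + ϑ))) := by
      rw [neg_div, neg_pow (‖x‖ ^ 2 / 4), neg_pow τ]
      have hpow : (-1 : ℝ) ^ n = (-1) ^ (n - k) * (-1) ^ k := by rw [← pow_add, Nat.sub_add_cancel hkn]
      rw [hpow]
      ring
    rw [this]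
    push_cast
    ring
  · refine Continuous.aestronglyMeasurable ?_
    have c1 := continuous_polyVal V
    have c2 : Continuous fun y => heatKernel d τ (x - y) :=
      (continuous_heatKernel τ).comp (by fun_prop)
    simp only [F]
    fun_prop
  · simp only [F, bound, norm_mul, Complex.norm_real, Real.norm_eq_abs]
    rw [abs_of_pos (hk y)]
    calc _ ≤ ‖polyVal V y‖ * (K * ((2 * ‖y‖) ^ (2 * n) / (2 * n).factorial)) *
          heatKernel d τ (x - y) := by
          have := (hk y).le
          gcongr
          exact hb n ‖y‖
      _ = _ := by ring
  · simp_rw [fun y => (hbs y).tsum_eq]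
    have h1 := (integrable_mul_heatKernel (hasPolyGrowth_polyVal V)
      (continuous_polyVal V).aestronglyMeasurable x (show 0 < 2 * τ by positivity)).norm.const_mul
      (K * (Real.exp (2 * ‖x‖ + 8 * τ) * 2 ^ ((d : ℝ) / 2)))
    refine h1.mono' (Continuous.aestronglyMeasurable ?_) (ae_of_all _ fun y => ?_)
    · have c1 := continuous_polyVal V
      have c2 : Continuous fun y => heatKernel d τ (x - y) :=
        (continuous_heatKernel τ).comp (by fun_prop)
      have c3 := Real.continuous_cosh
      fun_prop
    · have hk2 : 0 < heatKernel d (2 * τ) (x - y) := heatKernel_pos (by positivity) _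
      have := hk y
      have hch := Real.cosh_pos (2 * ‖y‖)
      rw [Real.norm_of_nonneg (by positivity), norm_mul, Complex.norm_real,
        Real.norm_of_nonneg hk2.le]
      calc _ = ‖polyVal V y‖ * K * (Real.cosh (2 * ‖y‖) * heatKernel d τ (x - y)) := by ring
        _ ≤ ‖polyVal V y‖ * K * (Real.exp (2 * ‖x‖ + 8 * τ) * 2 ^ ((d : ℝ) / 2) *
            heatKernel d (2 * τ) (x - y)) :=
            mul_le_mul_of_nonneg_left (cosh_mul_heatKernel_le hτ x y) (by positivity)
        _ = _ := by ring
  · have h1 : HasSum (fun n : ℕ => (-‖y‖ ^ 2 / 4) ^ n / (n.factorial * Real.Gamma (n + s)))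
        (besselSeries s (‖y‖ ^ 2)) := (summable_besselSeries hs (‖y‖ ^ 2)).hasSum
    exact ((Complex.hasSum_ofReal.2 h1).mul_left _).mul_right _

theorem hasPolyGrowth_besselSeries (hs : 0 < s) :
    HasPolyGrowth fun y : E d => (besselSeries s (‖y‖ ^ 2) : ℂ) := by
  have hG : 0 < Real.Gamma (s + 1) := Real.Gamma_pos_of_pos (by linarith)
  refine ⟨(s + 1) / Real.Gamma (s + 1), 1, fun y => ?_⟩
  rw [Complex.norm_real, Real.norm_eq_abs, pow_one]
  refine (abs_besselSeries_le hs (sq_nonneg _)).trans ?_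
  rw [Real.sqrt_sq (norm_nonneg y), div_mul_eq_mul_div]
  gcongr
  nlinarith [norm_nonneg y]

theorem contDiff_bessel (V : MvPolynomial (Fin d) ℂ) (hs : 0 < s) :
    ContDiff ℝ ∞ fun y : E d => polyVal V y * (besselQuotient s ‖y‖ : ℂ) := by
  have e : ∀ y : E d, besselQuotient s ‖y‖ = 2 ^ (1 - s) * besselSeries s (‖y‖ ^ 2) := fun y =>
    besselQuotient_eq (norm_nonneg y)
  simp_rw [e]
  exact (contDiff_polyVal V).mul (contDiff_ofReal_comp (contDiff_const.mul
    ((contDiff_besselSeries hs).comp (contDiff_norm_sq ℝ))))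

theorem varLaplacianEq_bessel (hd : 1 ≤ d) (hV : IsSolidHarmonic V l)
    (hϑ : ϑ = (d : ℝ) / 2 + l) (hs : 0 < s) {α : E d → ℝ} {x : E d} (hα : 0 < α x ∧ α x ≤ 2) :
    VarLaplacianEq α (fun y => polyVal V y * (besselQuotient s ‖y‖ : ℂ)) x
      (((2 : ℝ) ^ (1 - s) * Real.Gamma (ϑ + α x / 2) /
        (Real.Gamma ϑ * Real.Gamma (s + α x / 2)) : ℝ) * polyVal V x *
        (oneFTwo (ϑ + α x / 2) (s + α x / 2) ϑ (-(1 / 4) * ‖x‖ ^ 2) : ℂ)) := by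
  have hϑ0 : 0 < ϑ := by
    have : (1 : ℝ) ≤ d := by exact_mod_cast hd
    rw [hϑ]
    positivity
  have e : ∀ y : E d, besselQuotient s ‖y‖ = 2 ^ (1 - s) * besselSeries s (‖y‖ ^ 2) := fun y =>
    besselQuotient_eq (norm_nonneg y)
  have hsm := contDiff_bessel V hs
  simp_rw [e] at hsm ⊢
  obtain ⟨M, H⟩ := HasFracPower.exists_bessel (a := α x / 2) (by linarith [hα.1]) hϑ0 hs
    (sq_nonneg ‖x‖)
  have e2 : ∀ y : E d, polyVal V y * ((2 ^ (1 - s) * besselSeries s (‖y‖ ^ 2) : ℝ) : ℂ) =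
      ((2 ^ (1 - s) : ℝ) : ℂ) * (polyVal V y * (besselSeries s (‖y‖ ^ 2) : ℂ)) := fun y => by
    push_cast
    ring
  have := varLaplacianEq_of_heat hd
    (u := fun y => polyVal V y * ((2 ^ (1 - s) * besselSeries s (‖y‖ ^ 2) : ℝ) : ℂ))
    (((HasPolyGrowth.const ((2 ^ (1 - s) : ℝ) : ℂ)).mul ((hasPolyGrowth_polyVal V).mul
      (hasPolyGrowth_besselSeries hs))).of_le fun y => by rw [e2]) hsm hα
    (A := ((2 ^ (1 - s) : ℝ) : ℂ) * polyVal V x) (fun τ hτ => ?_) ?_ H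
  · convert! this using 1
    push_cast
    ring
  · simp_rw [e2, mul_assoc]
    rw [integral_const_mul]
    simp_rw [← mul_assoc (polyVal V _)]
    rw [integral_besselSeries_mul_heatKernel hV hϑ hϑ0 hs x hτ]
  · have e0 : besselSeries s (‖x‖ ^ 2) = ∑' m : ℕ, (-‖x‖ ^ 2 / 4) ^ m /
        (m.factorial * Real.Gamma (m + ϑ)) * gammaRatioSeries (m + ϑ) (s - ϑ) 0 := by
      refine tsum_congr fun m => ?_
      have hΓ : Real.Gamma (m + ϑ) ≠ 0 := (Real.Gamma_pos_of_pos (by positivity)).ne'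
      rw [gammaRatioSeries_zero, show (m : ℝ) + ϑ + (s - ϑ) = m + s by ring]
      field_simp
    rw [← e0]
    exact (e2 x).trans (mul_assoc _ _ _).symm

end

end VarLap

theorem lemma3 (d : ℕ) (hd : 1 ≤ d) (l : ℕ) (V : MvPolynomial (Fin d) ℂ)
    (hV : VarLap.IsSolidHarmonic V l)
    (α : EuclideanSpace ℝ (Fin d) → ℝ) (hα : ∀ x, 0 < α x ∧ α x ≤ 2)
    (ϑ : ℝ) (hϑ : ϑ = (d : ℝ) / 2 + l) :
    -- Gaussian type functions
    (ContDiff ℝ ∞ (fun x : EuclideanSpace ℝ (Fin d) =>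
        VarLap.polyVal V x * (Real.exp (-‖x‖ ^ 2) : ℂ)) ∧
      ∀ x : EuclideanSpace ℝ (Fin d), VarLap.VarLaplacianEq α
        (fun y => VarLap.polyVal V y * (Real.exp (-‖y‖ ^ 2) : ℂ)) x
        (((2 : ℝ) ^ α x * Real.Gamma (ϑ + α x / 2) / Real.Gamma ϑ : ℝ) *
          VarLap.polyVal V x * (VarLap.oneFOne (ϑ + α x / 2) ϑ (-‖x‖ ^ 2) : ℂ))) ∧
    -- inverse multiquadric type functions
    (∀ β : ℝ, 0 < β →
      ContDiff ℝ ∞ (fun x : EuclideanSpace ℝ (Fin d) =>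
        VarLap.polyVal V x * (((1 + ‖x‖ ^ 2) ^ (-β) : ℝ) : ℂ)) ∧
      ∀ x : EuclideanSpace ℝ (Fin d), VarLap.VarLaplacianEq α
        (fun y => VarLap.polyVal V y * (((1 + ‖y‖ ^ 2) ^ (-β) : ℝ) : ℂ)) x
        (((2 : ℝ) ^ α x * Real.Gamma (ϑ + α x / 2) * Real.Gamma (β + α x / 2) /
            (Real.Gamma ϑ * Real.Gamma β) : ℝ) *
          VarLap.polyVal V x *
          (VarLap.twoFOne (ϑ + α x / 2) (β + α x / 2) ϑ (-‖x‖ ^ 2) : ℂ))) ∧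
    -- Bessel type functions
    (∀ s : ℝ, 0 < s →
      ContDiff ℝ ∞ (fun x : EuclideanSpace ℝ (Fin d) =>
        VarLap.polyVal V x * (VarLap.besselQuotient s ‖x‖ : ℂ)) ∧
      ∀ x : EuclideanSpace ℝ (Fin d), VarLap.VarLaplacianEq α
        (fun y => VarLap.polyVal V y * (VarLap.besselQuotient s ‖y‖ : ℂ)) x
        (((2 : ℝ) ^ (1 - s) * Real.Gamma (ϑ + α x / 2) /
            (Real.Gamma ϑ * Real.Gamma (s + α x / 2)) : ℝ) *
          VarLap.polyVal V x *
          (VarLap.oneFTwo (ϑ + α x / 2) (s + α x / 2) ϑ (-(1 / 4) * ‖x‖ ^ 2) : ℂ))) :=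
  ⟨⟨(VarLap.contDiff_polyVal V).mul (VarLap.contDiff_ofReal_comp (contDiff_norm_sq ℝ).neg.exp),
      fun x => VarLap.varLaplacianEq_gaussian hd hV hϑ (hα x)⟩,
    fun _ hβ => ⟨VarLap.contDiff_multiquadric V _,
      fun x => VarLap.varLaplacianEq_multiquadric hd hV hϑ hβ (hα x)⟩,
    fun _ hs => ⟨VarLap.contDiff_bessel V hs,
      fun x => VarLap.varLaplacianEq_bessel hd hV hϑ hs (hα x)⟩⟩
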